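/- Let $\beta\in(0,1]$, $\gamma>0$, $\mu>0$, $n\ge 0$, and let $A_0,\dots,A_n\in\mathbb R$, $\kappa_0,\dots,\kappa_n\in(0,1)$, $w_0=0$, $w_1,\dots,w_n>0$ with $\sum_{j=0}^n A_j=1$. Let $\xi(x)$, $x\in\mathbb R$, be a measurable zero-mean real stationary Gaussian process with covariance function $$r(x)=\mathrm{Cov}(\xi(y),\xi(y+x))=\sum_{j=0}^{n}A_j\,\frac{\cos(w_jx)}{(1+x^2)^{\kappa_j/2}},\qquad x\in\mathbb R,$$ and spectral representation $\xi(x)=\int_{\mathbb R}e^{i\lambda x}Z(d\lambda)$, where $Z$ is an orthogonal random measure. Let $u(t,x)$ be a mean-square solution of the fractional Riesz–Bessel equation $$\frac{\partial^\beta u}{\partial t^\beta}(t,x)=-\mu\,(I-\Delta)^{\gamma/2}(-\Delta)^{\alpha/2}u(t,x),\quad t>0,\ x\in\mathbb R,\qquad u(0,x)=\xi(x).$$ Here $\partial^\beta/\partial t^\beta$ is the ordinary derivative if $\beta=1$ and the regularized Caputo–Djrbashian derivative $\frac{1}{\Gamma(1-\beta)}\big[\frac{\partial}{\partial t}\int_0^t(t-\tau)^{-\beta}u(\tau,x)\,d\tau-t^{-\beta}u(0,x)\big]$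 if $\beta<1$, in the sense of $L^2(\Omega)$; the solution is mean-square continuous in $t\ge0$; for each $t>0$ it has the form $u(t,x)=\int e^{i\lambda x}g_t(\lambda)Z(d\lambda)$ for some $g_t$; and the spatial operator replaces $g_t(\lambda)$ by $|\lambda|^\alpha(1+\lambda^2)^{\gamma/2}g_t(\lambda)$, the resulting integral being required to exist. Put $E_\beta(s)=\sum_{k\ge0}s^k/\Gamma(1+\beta k)$ and $c_2(\kappa)=\big(2\,\Gamma(\kappa)\cos(\kappa\pi/2)\big)^{-1}$. Assume $A_0\ne0$ and $\alpha>\kappa_0/2$. Then, as $\varepsilon\to0^+$, the finite-dimensional distributions of the random fields $$U_\varepsilon(t,x)=\varepsilon^{-\frac{\kappa_0\beta}{2\alpha}}\,u\!\left(\frac t\varepsilon,\frac{x}{\varepsilon^{\beta/\alpha}}\right),\qquad t>0,\ x\in\mathbb R,$$ converge weakly to the finite-dimensional distributions of the real zero-mean Gaussian field $$U_0(t,x)=\sqrt{c_2(\kappa_0)A_0}\int_{\mathbb R}\frac{e^{i\lambda x}E_\beta(-\mu|\lambda|^\alpha t^\beta)}{|\lambda|^{(1-\kappa_0)/2}}\,W(d\lambda),\qquad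 t>0,\ x\in\mathbb R,$$ where $W$ is a complex Gaussian white noise on $\mathbb R$ with $\mathbb E\,W(S)\overline{W(T)}=|S\cap T|$ and $W(-S)=\overline{W(S)}$. The integral exists, and the covariance function of $U_0$ is $$\mathrm{Cov}(U_0(t,x),U_0(t',x'))=2A_0c_2(\kappa_0)\int_0^{\infty}\frac{\cos(\lambda(x-x'))}{\lambda^{1-\kappa_0}}\,E_\beta(-\mu\lambda^\alpha t^\beta)\,E_\beta(-\mu\lambda^\alpha (t')^\beta)\,d\lambda,$$ the integral being absolutely convergent. -/

import Mathlib

open MeasureTheory ProbabilityTheory Filter Topology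
open scoped ENNReal

namespace RieszBessel

noncomputable section

/-- The one-parameter Mittag-Leffler function `E_β(s) = ∑ₖ sᵏ / Γ(1 + β k)`. -/
def mittagLeffler (β s : ℝ) : ℝ :=
  ∑' k : ℕ, s ^ k / Real.Gamma (1 + β * k)

/-- The constant `c₂(κ) = 1 / (2 Γ(κ) cos(κ π / 2))`: the Fourier transform of
`c₂(κ) |λ| ^ (κ - 1)` is `|x| ^ (-κ)`. -/
def c₂ (κ : ℝ) : ℝ :=
  (2 * Real.Gamma κ * Real.cos (κ * Real.pi / 2))⁻¹

/-- The covariance function `r(x) = ∑ⱼ Aⱼ cos(wⱼ x) / (1 + x²) ^ (κⱼ / 2)`, `0 ≤ j ≤ n`. -/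
def cyclicCov {n : ℕ} (A w κ : Fin (n + 1) → ℝ) (x : ℝ) : ℝ :=
  ∑ j, Real.cos (w j * x) / (1 + x ^ 2) ^ (κ j / 2) * A j

section RandomMeasures

variable {Ω : Type*} [MeasurableSpace Ω]

/-- `Z` is a (complex, centred) orthogonal random measure on `ℝ` with control measure `ν`:
`E Z(S) = 0` and `E Z(S) conj(Z(T)) = ν(S ∩ T)` for Borel sets of finite `ν`-measure. -/
structure IsOrthogonalRandomMeasure (P : Measure Ω) (ν : Measure ℝ) (Z : Set ℝ → Ω → ℂ) :
    Prop where
  memLp : ∀ S, MeasurableSet S → ν S < ∞ → MemLp (Z S) 2 P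
  mean_zero : ∀ S, MeasurableSet S → ν S < ∞ → ∫ ω, Z S ω ∂P = 0
  inner_eq : ∀ S T, MeasurableSet S → ν S < ∞ → MeasurableSet T → ν T < ∞ →
    ∫ ω, Z S ω * (starRingEnd ℂ) (Z T ω) ∂P = ((ν (S ∩ T)).toReal : ℂ)

/-- `W` is a symmetric (Hermitian) complex Gaussian white noise on `ℝ`: a jointly Gaussian
orthogonal random measure controlled by Lebesgue measure, with `W(-S) = conj(W(S))`. -/
structure IsGaussianWhiteNoise (P : Measure Ω) (W : Set ℝ → Ω → ℂ) : Prop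
    extends IsOrthogonalRandomMeasure P volume W where
  gaussian : IsGaussianProcess
    (fun S : {S : Set ℝ // MeasurableSet S ∧ volume S < ∞} => W S.1) P
  symm : ∀ S, MeasurableSet S → volume S < ∞ →
    ∀ᵐ ω ∂P, W (Neg.neg ⁻¹' S) ω = (starRingEnd ℂ) (W S ω)

/-- The integral `∑ c · Z(s = c)` of a simple function against a random measure. -/
def simpleIntegral (Z : Set ℝ → Ω → ℂ) (s : SimpleFunc ℝ ℂ) (ω : Ω) : ℂ :=
  ∑ c ∈ s.range, c * Z (s ⁻¹' {c}) ω

/-- `X = ∫ g dZ`: `g` is square integrable for the control measure `ν`, and `X` is the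
mean-square limit of the integrals of simple functions that approximate `g` in `L²(ν)`. -/
def IsStochIntegral (P : Measure Ω) (ν : Measure ℝ) (Z : Set ℝ → Ω → ℂ)
    (g : ℝ → ℂ) (X : Ω → ℂ) : Prop :=
  MemLp g 2 ν ∧ MemLp X 2 P ∧
    ∃ s : ℕ → SimpleFunc ℝ ℂ, (∀ k, MemLp (s k) 2 ν) ∧
      Tendsto (fun k => eLpNorm (fun l => s k l - g l) 2 ν) atTop (𝓝 0) ∧
      Tendsto (fun k => eLpNorm (fun ω => simpleIntegral Z (s k) ω - X ω) 2 P) atTop (𝓝 0)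

/-- The real random field `v` has the spectral representation
`v(x) = ∫ exp(i l x) g(l) Z(dl)`. -/
def HasSpectralRep (P : Measure Ω) (F : Measure ℝ) (Z : Set ℝ → Ω → ℂ)
    (g : ℝ → ℂ) (v : ℝ → Ω → ℝ) : Prop :=
  ∀ x, IsStochIntegral P F Z (fun l => Complex.exp (Complex.I * (l * x : ℝ)) * g l)
    (fun ω => (v x ω : ℂ))

/-- `w = (I - Δ)^(γ/2) (-Δ)^(α/2) v` in the mean-square sense: the operator acts on a field
with a spectral representation as the Fourier multiplier `|l|^α (1 + |l|²)^(γ/2)`. -/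
def IsRieszBesselImage (P : Measure Ω) (F : Measure ℝ) (Z : Set ℝ → Ω → ℂ) (α γ : ℝ)
    (v w : ℝ → Ω → ℝ) : Prop :=
  ∃ g : ℝ → ℂ, HasSpectralRep P F Z g v ∧
    HasSpectralRep P F Z (fun l => ((|l| ^ α * (1 + |l| ^ 2) ^ (γ / 2) : ℝ) : ℂ) * g l) w

/-- The class in `L²(P)` of a square-integrable random variable (zero otherwise). -/
def toL2 (P : Measure Ω) (X : Ω → ℝ) : Lp ℝ 2 P :=
  open Classical in if h : MemLp X 2 P then h.toLp X else 0

end RandomMeasures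

/-- `V : [0, ∞) → H` has at `t > 0` the derivative `d` of order `β ∈ (0, 1]`: the usual
derivative for `β = 1`, and for `β < 1` the regularized Caputo–Djrbashian derivative
`Γ(1-β)⁻¹ (d/dt ∫₀ᵗ (t-τ)^(-β) V(τ) dτ - t^(-β) V(0))`. -/
def HasCaputoDerivAt {H : Type*} [NormedAddCommGroup H] [NormedSpace ℝ H]
    (β : ℝ) (V : ℝ → H) (d : H) (t : ℝ) : Prop :=
  if β = 1 then HasDerivAt V d t
  else ∃ d' : H,
    HasDerivAt (fun s : ℝ => ∫ τ in (0 : ℝ)..s, (s - τ) ^ (-β) • V τ) d' t ∧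
      d = (Real.Gamma (1 - β))⁻¹ • (d' - t ^ (-β) • V 0)

/-- `u` is a mean-square solution of
`∂^β u / ∂t^β = -μ (I - Δ)^(γ/2) (-Δ)^(α/2) u`, `t > 0`, with `u(0, x) = ξ(x)`.
`Z` is the random spectral measure of `ξ` and `F` its spectral measure. The solution is
mean-square continuous in time up to `t = 0`, for every `t > 0` the field `u(t, ·)` is a
linear filter of `ξ` (with an unspecified transfer function) in the domain of the spatial
operator, and the equation holds in `L²(P)` at every `(t, x)`. -/
def IsMeanSquareSolution {Ω : Type*} [MeasurableSpace Ω] (P : Measure Ω) (α β γ μ : ℝ)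
    (ξ : ℝ → Ω → ℝ) (u : ℝ → ℝ → Ω → ℝ) : Prop :=
  ∃ (F : Measure ℝ) (Z : Set ℝ → Ω → ℂ), IsFiniteMeasure F ∧
    IsOrthogonalRandomMeasure P F Z ∧
    HasSpectralRep P F Z (fun _ => 1) ξ ∧
    (∀ x, u 0 x =ᵐ[P] ξ x) ∧
    (∀ x, ContinuousOn (fun t => toL2 P (u t x)) (Set.Ici 0)) ∧
    ∀ t, 0 < t → ∃ w : ℝ → Ω → ℝ, IsRieszBesselImage P F Z α γ (u t) w ∧
      ∀ x, HasCaputoDerivAt β (fun τ => toL2 P (u τ x)) (-μ • toL2 P (w x)) t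

/-- The rescaled field `U_ε(t, x) = ε^(-κ₀β/(2α)) u(t/ε, x/ε^(β/α))`. -/
def rescaled {Ω : Type*} (α β κ₀ : ℝ) (u : ℝ → ℝ → Ω → ℝ) (ε t x : ℝ) (ω : Ω) : ℝ :=
  ε ^ (-(κ₀ * β / (2 * α))) * u (t / ε) (x / ε ^ (β / α)) ω

end

end RieszBessel

/-! Put σ(l) = |l|^α (1 + l²)^(γ/2). A mean-square solution is a linear filter of ξ, and the
equation forces its transfer function to be E_β(-μ σ(l) t^β). To see this without any regularity of
g_t(l) in t, take a set A on which σ is bounded and pair u(t, 0) with ∫ 1_A (-μσ)^k dZ. The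
resulting continuous functions a_k satisfy D^β a_k = a_(k+1), hence a_k = a_k(0) + I^β a_(k+1)
(`eq_add_fracInt_of_hasCaputoDerivAt`). Iteration is a fractional Taylor expansion whose remainder
tends to zero, and its sum is the Mittag-Leffler series integrated over A
(`setIntegral_transfer_eq`).

So u is an L²-limit of linear combinations of values of ξ, hence Gaussian and centred, and
convergence of the finite-dimensional distributions reduces to convergence of covariances
(`tendstoInDistribution_of_tendsto_covariance`). With h = ε^(β/α), the covariance of the rescaled
field is h^(-κ₀) times the F-integral of a kernel dominated by a product of two functions E_β(-μ
|l/h|^α t^β).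

The characteristic function of F is r, so F is the signed combination of the spectral measures of
the summands of r (`integral_eq_sum_of_charFun_eq_sum`). The density f of (1 + x²)^(-κ/2) is a
Gaussian mixture; it satisfies f(l) ≤ c₂(κ) |l|^(κ-1), and f(l) |l|^(1-κ) → c₂(κ) at the origin. For
j = 0 the substitution l = h v and dominated convergence produce the limit covariance; the factor (1
+ h²v²)^(γ/2) tends to 1, so γ disappears. For j ≠ 0 the singularities lie at ±w_j ≠ 0. There the
kernel is O(h^p) for some p > κ₀, while the singularity is integrable whatever κ_j is, so the
contribution vanishes (`tendsto_integral_rescaledKernel`).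

Domination rests on 0 ≤ E_β(-s) ≤ 1, monotonicity, and s E_β(-s) ≤ Γ(1 + β). All follow from a
minimum principle for the fractional relaxation equation (`nonneg_of_eq_add_fracInt`). The decay 1/s
makes the limit integral converge at infinity exactly when α > κ₀/2. -/

namespace RieszBessel

/-! ### Riemann–Liouville integrals and the regularized fractional derivative -/

section FractionalCalculus

/-- Euler's Beta integral, translated by τ and scaled by t - τ. It is the composition rule for the
kernels of fractional integration. -/
theorem integral_rpow_mul_rpow {a b τ t : ℝ} (ha : 0 < a) (hb : 0 < b) (h : τ < t) :
    ∫ s in τ..t, (t - s) ^ (a - 1) * (s - τ) ^ (b - 1) =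
      (t - τ) ^ (a + b - 1) * (Real.Gamma a * Real.Gamma b / Real.Gamma (a + b)) := by
  have hc : 0 < t - τ := sub_pos.2 h
  have h1 : ∫ s in τ..t, (t - s) ^ (a - 1) * (s - τ) ^ (b - 1)
      = ∫ x in (0 : ℝ)..(t - τ), x ^ (b - 1) * (t - τ - x) ^ (a - 1) := by
    have h0 := intervalIntegral.integral_comp_sub_right
      (fun x => x ^ (b - 1) * (t - τ - x) ^ (a - 1)) (a := τ) (b := t) τ
    rw [sub_self] at h0
    rw [← h0]
    refine intervalIntegral.integral_congr fun s _ => ?_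
    rw [mul_comm]
    congr 2
    ring
  rw [h1]
  have h2 := Complex.betaIntegral_scaled (b : ℂ) (a : ℂ) hc
  rw [Complex.betaIntegral_eq_Gamma_mul_div _ _ (by simpa) (by simpa)] at h2
  have h3 : ∫ x in (0 : ℝ)..(t - τ), (x : ℂ) ^ ((b : ℂ) - 1) * (((t - τ : ℝ) : ℂ) - x) ^ ((a : ℂ) - 1)
      = ((∫ x in (0 : ℝ)..(t - τ), x ^ (b - 1) * (t - τ - x) ^ (a - 1) : ℝ) : ℂ) := by
    rw [← intervalIntegral.integral_ofReal]
    refine intervalIntegral.integral_congr fun x hx => ?_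
    rw [Set.uIcc_of_le hc.le] at hx
    rw [Complex.ofReal_mul, Complex.ofReal_cpow hx.1, Complex.ofReal_cpow (by linarith [hx.2])]
    push_cast
    rfl
  rw [h3] at h2
  apply Complex.ofReal_injective
  rw [h2, Complex.ofReal_mul, Complex.ofReal_cpow hc.le, Complex.ofReal_div, Complex.ofReal_mul,
    ← Complex.Gamma_ofReal, ← Complex.Gamma_ofReal, ← Complex.Gamma_ofReal]
  push_cast
  rw [add_comm (b : ℂ) a, mul_comm (Complex.Gamma b)]

/-- The integral of a non-integrable function is 0 by convention, whereas the Beta value is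
positive. -/
theorem intervalIntegrable_rpow_mul_rpow {a b τ t : ℝ} (ha : 0 < a) (hb : 0 < b) (h : τ < t) :
    IntervalIntegrable (fun s => (t - s) ^ (a - 1) * (s - τ) ^ (b - 1)) volume τ t := by
  by_contra hn
  have h0 := intervalIntegral.integral_undef hn
  rw [integral_rpow_mul_rpow ha hb h] at h0
  have h1 : 0 < t - τ := sub_pos.2 h
  have := Real.Gamma_pos_of_pos ha
  have := Real.Gamma_pos_of_pos hb
  have := Real.Gamma_pos_of_pos (add_pos ha hb)
  have h2 : 0 < (t - τ) ^ (a + b - 1) * (Real.Gamma a * Real.Gamma b / Real.Gamma (a + b)) := by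
    positivity
  exact h2.ne' h0

theorem intervalIntegrable_sub_rpow {a : ℝ} (ha : 0 < a) (t : ℝ) :
    IntervalIntegrable (fun s => (t - s) ^ (a - 1)) volume 0 t := by
  have h := (intervalIntegral.intervalIntegrable_rpow' (a := 0) (b := t) (r := a - 1)
    (by linarith)).comp_sub_left t
  simpa using h.symm

theorem integral_sub_rpow {a : ℝ} (ha : 0 < a) (t : ℝ) :
    ∫ s in (0 : ℝ)..t, (t - s) ^ (a - 1) = t ^ a / a := by
  rw [intervalIntegral.integral_comp_sub_left (fun x => x ^ (a - 1)) t,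
    integral_rpow (Or.inl (by linarith))]
  simp [ha.ne']

variable {E : Type*} [NormedAddCommGroup E] [NormedSpace ℝ E]

theorem intervalIntegrable_sub_rpow_smul {a : ℝ} (ha : 0 < a) {t : ℝ} {φ : ℝ → E}
    (hφ : Continuous φ) :
    IntervalIntegrable (fun s => (t - s) ^ (a - 1) • φ s) volume 0 t :=
  (intervalIntegrable_sub_rpow ha t).smul_continuousOn hφ.continuousOn

/-- The Riemann–Liouville fractional integral of order `a`. -/
noncomputable def fracInt (a : ℝ) (φ : ℝ → E) (t : ℝ) : E :=
  (Real.Gamma a)⁻¹ • ∫ τ in (0 : ℝ)..t, (t - τ) ^ (a - 1) • φ τ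

@[simp]
theorem fracInt_zero_right (a : ℝ) (φ : ℝ → E) : fracInt a φ 0 = 0 := by
  simp [fracInt]

theorem fracInt_one (φ : ℝ → E) (t : ℝ) : fracInt 1 φ t = ∫ τ in (0 : ℝ)..t, φ τ := by
  simp [fracInt]

theorem fracInt_congr {a t : ℝ} (ht : 0 ≤ t) {φ ψ : ℝ → E} (h : ∀ s ∈ Set.Icc 0 t, φ s = ψ s) :
    fracInt a φ t = fracInt a ψ t := by
  unfold fracInt
  congr 1
  refine intervalIntegral.integral_congr fun s hs => ?_
  rw [Set.uIcc_of_le ht] at hs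
  simp only [h s hs]

theorem fracInt_sub {a : ℝ} (ha : 0 < a) (t : ℝ) {φ ψ : ℝ → E}
    (hφ : Continuous φ) (hψ : Continuous ψ) :
    fracInt a (fun s => φ s - ψ s) t = fracInt a φ t - fracInt a ψ t := by
  simp only [fracInt, smul_sub]
  rw [intervalIntegral.integral_sub (intervalIntegrable_sub_rpow_smul ha hφ)
    (intervalIntegrable_sub_rpow_smul ha hψ), smul_sub]

/-- With the normalisation s^b / Γ(1 + b), fractional integration only shifts the exponent. The
point t = 0 is separated because a + b = 0 is allowed and 0^0 = 1. -/
theorem fracInt_rpow [CompleteSpace E] {a b t : ℝ} (ha : 0 < a) (hb : -1 < b) (ht : 0 ≤ t) (c : E) :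
    fracInt a (fun s => (s ^ b / Real.Gamma (1 + b)) • c) t =
      if t = 0 then 0 else (t ^ (a + b) / Real.Gamma (1 + (a + b))) • c := by
  split_ifs with h0
  · simp [h0]
  have ht' : 0 < t := lt_of_le_of_ne ht (Ne.symm h0)
  have h := integral_rpow_mul_rpow ha (b := 1 + b) (by linarith) ht'
  simp only [sub_zero] at h
  unfold fracInt
  have h2 : ∀ s : ℝ, (t - s) ^ (a - 1) • (s ^ b / Real.Gamma (1 + b)) • c
      = ((t - s) ^ (a - 1) * s ^ (1 + b - 1)) • (Real.Gamma (1 + b))⁻¹ • c := by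
    intro s
    rw [smul_smul, smul_smul]
    congr 1
    rw [show 1 + b - 1 = b by ring]
    ring
  simp_rw [h2]
  rw [intervalIntegral.integral_smul_const, h, smul_smul, smul_smul]
  congr 1
  have := (Real.Gamma_pos_of_pos ha).ne'
  have := (Real.Gamma_pos_of_pos (show 0 < 1 + b by linarith)).ne'
  rw [show a + (1 + b) - 1 = a + b by ring, show a + (1 + b) = 1 + (a + b) by ring]
  field_simp

theorem norm_fracInt_le {a b t C : ℝ} (ha : 0 < a) (hb : 0 ≤ b) (ht : 0 ≤ t) {φ : ℝ → E}
    (h : ∀ s ∈ Set.Icc 0 t, ‖φ s‖ ≤ C * (s ^ b / Real.Gamma (1 + b))) :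
    ‖fracInt a φ t‖ ≤ C * (t ^ (a + b) / Real.Gamma (1 + (a + b))) := by
  have hG := Real.Gamma_pos_of_pos ha
  have h1 := fracInt_rpow ha (b := b) (by linarith) ht (C : ℝ)
  have h2 : fracInt a (fun s => (s ^ b / Real.Gamma (1 + b)) • (C : ℝ)) t =
      C * (t ^ (a + b) / Real.Gamma (1 + (a + b))) := by
    rw [h1]
    split_ifs with h0
    · rw [h0, Real.zero_rpow (by linarith)]; simp
    · rw [smul_eq_mul, mul_comm]
  rw [← h2]
  unfold fracInt
  rw [norm_smul, smul_eq_mul, norm_inv, Real.norm_eq_abs, abs_of_pos hG]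
  refine mul_le_mul_of_nonneg_left ?_ (by positivity)
  refine intervalIntegral.norm_integral_le_of_norm_le ht ?_ ?_
  · filter_upwards with s hs
    have h3 : 0 ≤ (t - s) ^ (a - 1) := Real.rpow_nonneg (by linarith [hs.2]) _
    rw [norm_smul, Real.norm_eq_abs, abs_of_nonneg h3, smul_eq_mul, smul_eq_mul]
    refine mul_le_mul_of_nonneg_left ?_ h3
    rw [mul_comm]
    exact h s ⟨hs.1.le, hs.2⟩
  · refine (intervalIntegrable_sub_rpow ha t).smul_continuousOn ?_
    exact (((Real.continuous_rpow_const hb).div_const _).smul continuous_const).continuousOn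

/-- Semigroup law I^a I^b = I^(a+b): exchange the integrals over the triangle τ ≤ s ≤ t; the inner
one is then a Beta integral. -/
theorem fracInt_fracInt [CompleteSpace E] {a b t : ℝ} (ha : 0 < a) (hb : 0 < b) (ht : 0 ≤ t)
    {φ : ℝ → E} (hφ : Continuous φ) :
    fracInt a (fracInt b φ) t = fracInt (a + b) φ t := by
  set F : ℝ → ℝ → E := fun s τ =>
    ({p : ℝ × ℝ | p.2 ≤ p.1}).indicator
      (fun p => ((t - p.1) ^ (a - 1) * (p.1 - p.2) ^ (b - 1)) • φ p.2) (s, τ) with hF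
  set ν : Measure ℝ := volume.restrict (Set.Ioc 0 t) with hν
  have hms : MeasurableSet {p : ℝ × ℝ | p.2 ≤ p.1} := measurableSet_le measurable_snd measurable_fst
  have hFs : ∀ s τ, F s τ = (Set.Ici τ).indicator
      (fun s => ((t - s) ^ (a - 1) * (s - τ) ^ (b - 1)) • φ τ) s := by
    intro s τ
    simp only [hF, Set.indicator, Set.mem_ofPred_eq, Set.mem_Ici]
  have hFτ : ∀ s τ, F s τ = (Set.Iic s).indicator
      (fun τ => ((t - s) ^ (a - 1) * (s - τ) ^ (b - 1)) • φ τ) τ := by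
    intro s τ
    simp only [hF, Set.indicator, Set.mem_ofPred_eq, Set.mem_Iic]
  have hmeas : AEStronglyMeasurable (Function.uncurry F) (ν.prod ν) := by
    have : StronglyMeasurable (Function.uncurry F) := by
      have h1 : Function.uncurry F = ({p : ℝ × ℝ | p.2 ≤ p.1}).indicator
          (fun p => ((t - p.1) ^ (a - 1) * (p.1 - p.2) ^ (b - 1)) • φ p.2) := rfl
      rw [h1]
      refine StronglyMeasurable.indicator ?_ hms
      refine StronglyMeasurable.smul (Measurable.stronglyMeasurable (by fun_prop)) ?_
      exact (hφ.comp continuous_snd).stronglyMeasurable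
    exact this.aestronglyMeasurable
  have hset : ∀ τ ∈ Set.Ioc 0 t, Set.Ici τ ∩ Set.Ioc 0 t = Set.Icc τ t := by
    intro τ hτ
    ext s
    simp only [Set.mem_inter_iff, Set.mem_Ici, Set.mem_Ioc, Set.mem_Icc]
    exact ⟨fun h => ⟨h.1, h.2.2⟩, fun h => ⟨h.1, lt_of_lt_of_le hτ.1 h.1, h.2⟩⟩
  have hset' : ∀ s ∈ Set.Ioc 0 t, Set.Iic s ∩ Set.Ioc 0 t = Set.Ioc 0 s := by
    intro s hs
    ext τ
    simp only [Set.mem_inter_iff, Set.mem_Iic, Set.mem_Ioc]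
    exact ⟨fun h => ⟨h.2.1, h.1⟩, fun h => ⟨h.2, h.1, h.2.trans hs.2⟩⟩
  have hne : ∀ᵐ τ ∂ν, τ ∈ Set.Ioo 0 t := by
    have h1 : ∀ᵐ τ ∂ν, τ ∈ Set.Ioc 0 t := ae_restrict_mem measurableSet_Ioc
    have h2 : ∀ᵐ τ ∂ν, τ ≠ t := ae_restrict_of_ae (Measure.ae_ne volume t)
    filter_upwards [h1, h2] with τ h3 h4
    exact ⟨h3.1, lt_of_le_of_ne h3.2 h4⟩
  -- Absolute integrability on the triangle: integrating the norm in s is again a Beta integral,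
  -- leaving the integrable weight (t - τ)^(a+b-1) ‖φ τ‖. The endpoint τ = t, where the Beta formula
  -- is unavailable, is a null set.
  have hint : Integrable (Function.uncurry F) (ν.prod ν) := by
    rw [integrable_prod_iff' hmeas]
    constructor
    · filter_upwards [hne] with τ hτ
      have h1 : (fun s => Function.uncurry F (s, τ)) = (Set.Ici τ).indicator
          (fun s => ((t - s) ^ (a - 1) * (s - τ) ^ (b - 1)) • φ τ) := by
        ext s; exact hFs s τ
      rw [h1, integrable_indicator_iff measurableSet_Ici, IntegrableOn, hν,
        Measure.restrict_restrict measurableSet_Ici, hset τ ⟨hτ.1, hτ.2.le⟩]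
      have h2 := (intervalIntegrable_rpow_mul_rpow ha hb hτ.2)
      rw [intervalIntegrable_iff_integrableOn_Icc_of_le hτ.2.le] at h2
      exact h2.smul_const _
    · have h1 : Integrable (fun τ => ((t - τ) ^ (a + b - 1) *
          (Real.Gamma a * Real.Gamma b / Real.Gamma (a + b))) * ‖φ τ‖) ν := by
        have h2 := (((intervalIntegrable_sub_rpow (add_pos ha hb) t).mul_const
          (Real.Gamma a * Real.Gamma b / Real.Gamma (a + b)))).mul_continuousOn
          (hφ.norm.continuousOn)
        rwa [intervalIntegrable_iff_integrableOn_Ioc_of_le ht] at h2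
      refine h1.congr ?_
      filter_upwards [hne] with τ hτ
      have h1 : (fun s => ‖Function.uncurry F (s, τ)‖) = (Set.Ici τ).indicator
          (fun s => ‖((t - s) ^ (a - 1) * (s - τ) ^ (b - 1)) • φ τ‖) := by
        ext s
        rw [show Function.uncurry F (s, τ) = F s τ from rfl, hFs s τ, norm_indicator_eq_indicator_norm]
      rw [h1, integral_indicator measurableSet_Ici, hν,
        Measure.restrict_restrict measurableSet_Ici, hset τ ⟨hτ.1, hτ.2.le⟩,
        integral_Icc_eq_integral_Ioc, ← intervalIntegral.integral_of_le hτ.2.le,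
        ← integral_rpow_mul_rpow ha hb hτ.2, ← intervalIntegral.integral_mul_const]
      refine intervalIntegral.integral_congr fun s hs => ?_
      rw [Set.uIcc_of_le hτ.2.le] at hs
      have h3 : 0 ≤ (t - s) ^ (a - 1) := Real.rpow_nonneg (by linarith [hs.2]) _
      have h4 : 0 ≤ (s - τ) ^ (b - 1) := Real.rpow_nonneg (by linarith [hs.1]) _
      rw [norm_smul, Real.norm_eq_abs, abs_of_nonneg (mul_nonneg h3 h4)]
  have hswap := integral_integral_swap hint
  have hG := (Real.Gamma_pos_of_pos ha).ne'
  have hG' := (Real.Gamma_pos_of_pos hb).ne'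
  have hG'' := (Real.Gamma_pos_of_pos (add_pos ha hb)).ne'
  have hL : ∫ s, ∫ τ, F s τ ∂ν ∂ν
      = ∫ s in (0 : ℝ)..t, (t - s) ^ (a - 1) • ∫ τ in (0 : ℝ)..s, (s - τ) ^ (b - 1) • φ τ := by
    rw [intervalIntegral.integral_of_le ht]
    refine setIntegral_congr_fun measurableSet_Ioc fun s hs => ?_
    simp_rw [hFτ s]
    rw [integral_indicator measurableSet_Iic, hν,
      Measure.restrict_restrict measurableSet_Iic, hset' s hs,
      ← intervalIntegral.integral_of_le hs.1.le, ← intervalIntegral.integral_smul]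
    simp_rw [smul_smul]
  have hR : ∫ τ, ∫ s, F s τ ∂ν ∂ν
      = (Real.Gamma a * Real.Gamma b / Real.Gamma (a + b)) •
        ∫ τ in (0 : ℝ)..t, (t - τ) ^ (a + b - 1) • φ τ := by
    rw [intervalIntegral.integral_of_le ht, ← integral_smul]
    refine integral_congr_ae ?_
    filter_upwards [hne] with τ hτ
    simp_rw [fun s => hFs s τ]
    rw [integral_indicator measurableSet_Ici, hν,
      Measure.restrict_restrict measurableSet_Ici, hset τ ⟨hτ.1, hτ.2.le⟩,
      integral_Icc_eq_integral_Ioc, ← intervalIntegral.integral_of_le hτ.2.le,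
      intervalIntegral.integral_smul_const, integral_rpow_mul_rpow ha hb hτ.2, smul_smul,
      mul_comm]
  rw [hL, hR] at hswap
  unfold fracInt
  have h5 : ∀ s : ℝ, (t - s) ^ (a - 1) • (Real.Gamma b)⁻¹ • ∫ τ in (0 : ℝ)..s, (s - τ) ^ (b - 1) • φ τ
      = (Real.Gamma b)⁻¹ • ((t - s) ^ (a - 1) • ∫ τ in (0 : ℝ)..s, (s - τ) ^ (b - 1) • φ τ) :=
    fun s => smul_comm _ _ _
  simp_rw [h5]
  rw [intervalIntegral.integral_smul, hswap, smul_smul, smul_smul]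
  congr 1
  field_simp

/-- The substitution τ = t x removes t from the singular kernel, I^a φ(t) = Γ(a)⁻¹ t^a ∫₀¹
(1-x)^(a-1) φ(t x) dx, after which dominated convergence applies. -/
theorem continuousOn_fracInt {a : ℝ} (ha : 0 < a) {φ : ℝ → E} (hφ : Continuous φ) :
    ContinuousOn (fracInt a φ) (Set.Ici 0) := by
  have h1 : ∀ t ∈ Set.Ici (0 : ℝ), fracInt a φ t
      = (Real.Gamma a)⁻¹ • t ^ a • ∫ x in (0 : ℝ)..1, (1 - x) ^ (a - 1) • φ (t * x) := by
    intro t ht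
    rcases eq_or_lt_of_le (Set.mem_Ici.1 ht) with h0 | h0
    · simp [← h0, ha.ne']
    unfold fracInt
    congr 1
    have h2 := intervalIntegral.smul_integral_comp_mul_left (a := 0) (b := 1)
      (fun τ => (t - τ) ^ (a - 1) • φ τ) t
    simp only [mul_zero, mul_one] at h2
    rw [← h2]
    have h3 : t ^ a = t * t ^ (a - 1) := by
      rw [Real.rpow_sub_one h0.ne']; field_simp
    rw [h3, mul_smul]
    congr 1
    rw [← intervalIntegral.integral_smul]
    refine intervalIntegral.integral_congr fun x hx => ?_
    rw [Set.uIcc_of_le zero_le_one] at hx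
    rw [smul_smul, ← Real.mul_rpow h0.le (by linarith [hx.2]), mul_sub, mul_one]
  refine ContinuousOn.congr ?_ h1
  refine ContinuousOn.const_smul (ContinuousOn.smul
    (Real.continuous_rpow_const ha.le).continuousOn ?_) _
  refine Continuous.continuousOn (continuous_iff_continuousAt.2 fun t₀ => ?_)
  obtain ⟨M, hM⟩ := (isCompact_Icc (a := -(|t₀| + 1)) (b := |t₀| + 1)).exists_bound_of_continuousOn
    hφ.continuousOn
  refine intervalIntegral.continuousAt_of_dominated_interval
    (bound := fun x => (1 - x) ^ (a - 1) * M) ?_ ?_ ?_ ?_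
  · refine Eventually.of_forall fun t => ?_
    refine AEStronglyMeasurable.smul (Measurable.aestronglyMeasurable (by fun_prop)) ?_
    exact (hφ.comp (continuous_const_mul t)).aestronglyMeasurable
  · filter_upwards [Metric.ball_mem_nhds t₀ one_pos] with t ht
    refine Eventually.of_forall fun x hx => ?_
    rw [Set.uIoc_of_le zero_le_one] at hx
    have h3 : 0 ≤ (1 - x) ^ (a - 1) := Real.rpow_nonneg (by linarith [hx.2]) _
    rw [norm_smul, Real.norm_eq_abs, abs_of_nonneg h3]
    refine mul_le_mul_of_nonneg_left (hM _ ?_) h3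
    rw [Metric.mem_ball, Real.dist_eq] at ht
    have h4 : |t| ≤ |t₀| + 1 := by
      have := abs_sub_abs_le_abs_sub t t₀
      linarith
    have h5 : |t * x| ≤ |t₀| + 1 := by
      rw [abs_mul, abs_of_pos hx.1]
      exact (mul_le_of_le_one_right (abs_nonneg t) hx.2).trans h4
    exact abs_le.1 h5
  · exact (intervalIntegrable_sub_rpow ha 1).mul_const M
  · refine Eventually.of_forall fun x _ => ?_
    exact ((hφ.comp (continuous_mul_const x)).const_smul _).continuousAt

theorem hasDerivAt_fracInt_one [CompleteSpace E] {φ : ℝ → E} {t : ℝ} (ht : 0 < t)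
    (hφ : ContinuousOn φ (Set.Ici 0)) :
    HasDerivAt (fracInt 1 φ) (φ t) t := by
  have h1 : fracInt 1 φ = fun t => ∫ τ in (0 : ℝ)..t, φ τ := funext fun t => fracInt_one φ t
  rw [h1]
  have hc : ContinuousAt φ t := hφ.continuousAt (Ici_mem_nhds ht)
  refine intervalIntegral.integral_hasDerivAt_right ?_ ?_ hc
  · exact (hφ.mono (by rw [Set.uIcc_of_le ht.le]; exact Set.Icc_subset_Ici_self)).intervalIntegrable
  · exact (hφ.mono Set.Ioi_subset_Ici_self).stronglyMeasurableAtFilter isOpen_Ioi t ht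

/-- A function with a continuous regularized fractional derivative `ψ` is recovered from it by
fractional integration. -/
theorem eq_add_fracInt_of_hasCaputoDerivAt [CompleteSpace E] {β : ℝ} (hβ₀ : 0 < β) (hβ₁ : β ≤ 1)
    {φ ψ : ℝ → E} (hφ : Continuous φ) (hψ : Continuous ψ)
    (h : ∀ t, 0 < t → HasCaputoDerivAt β φ (ψ t) t) {t : ℝ} (ht : 0 ≤ t) :
    φ t = φ 0 + fracInt β ψ t := by
  rcases eq_or_lt_of_le hβ₁ with rfl | hβ
  · simp only [HasCaputoDerivAt, if_true] at h
    rw [fracInt_one, intervalIntegral.integral_eq_sub_of_hasDerivAt_of_le ht hφ.continuousOn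
      (fun x hx => h x hx.1) (hψ.intervalIntegrable _ _)]
    abel
  have hβ' : 0 < 1 - β := by linarith
  have hG := (Real.Gamma_pos_of_pos hβ').ne'
  have hG2 : Real.Gamma (1 + (1 - β)) = (1 - β) * Real.Gamma (1 - β) := by
    rw [add_comm, Real.Gamma_add_one hβ'.ne']
  -- For β < 1 the hypothesis says that I^(1-β)(φ - φ(0)) has the ordinary derivative ψ; it vanishes
  -- at 0, so it is the integral of ψ.
  have key : ∀ t, 0 ≤ t → fracInt (1 - β) φ t -
      (t ^ (1 - β) / Real.Gamma (1 + (1 - β))) • φ 0 = fracInt 1 ψ t := by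
    intro t ht
    have h1 : ∀ x ∈ Set.Ioo 0 t, HasDerivAt (fun t => fracInt (1 - β) φ t -
        (t ^ (1 - β) / Real.Gamma (1 + (1 - β))) • φ 0) (ψ x) x := by
      intro x hx
      have h2 := h x hx.1
      rw [HasCaputoDerivAt, if_neg hβ.ne] at h2
      obtain ⟨d, hd, hd'⟩ := h2
      have h3 : HasDerivAt (fracInt (1 - β) φ) ((Real.Gamma (1 - β))⁻¹ • d) x := by
        have h4 := hd.const_smul (Real.Gamma (1 - β))⁻¹
        refine h4.congr_of_eventuallyEq (Eventually.of_forall fun s => ?_)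
        simp only [fracInt, Pi.smul_apply]
        rw [show 1 - β - 1 = -β by ring]
      have h5 : HasDerivAt (fun t : ℝ => (t ^ (1 - β) / Real.Gamma (1 + (1 - β))) • φ 0)
          (((1 - β) * x ^ (1 - β - 1) / Real.Gamma (1 + (1 - β))) • φ 0) x :=
        ((Real.hasDerivAt_rpow_const (Or.inl hx.1.ne')).div_const _).smul_const _
      convert! h3.sub h5 using 1
      rw [hd', smul_sub, smul_smul, hG2, show 1 - β - 1 = -β by ring]
      congr 2
      field_simp
    have h6 : ContinuousOn (fun t => fracInt (1 - β) φ t -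
        (t ^ (1 - β) / Real.Gamma (1 + (1 - β))) • φ 0) (Set.Icc 0 t) := by
      refine ((continuousOn_fracInt hβ' hφ).mono Set.Icc_subset_Ici_self).sub ?_
      exact (((Real.continuous_rpow_const hβ'.le).div_const _).smul continuous_const).continuousOn
    rw [fracInt_one, intervalIntegral.integral_eq_sub_of_hasDerivAt_of_le ht h6 h1
      (hψ.intervalIntegrable _ _)]
    simp [hβ'.ne']
  -- Apply I^β to both sides and use the semigroup law; the claim then follows by differentiating
  -- the two primitives.
  have key2 : ∀ t, 0 ≤ t → fracInt 1 (fun s => φ s - φ 0) t = fracInt 1 (fracInt β ψ) t := by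
    intro t ht
    have hg : Continuous fun s : ℝ => (s ^ (1 - β) / Real.Gamma (1 + (1 - β))) • φ 0 :=
      ((Real.continuous_rpow_const hβ'.le).div_const _).smul continuous_const
    rw [fracInt_fracInt one_pos hβ₀ ht hψ, add_comm, ← fracInt_fracInt hβ₀ one_pos ht hψ,
      ← fracInt_congr ht (fun s hs => key s hs.1), fracInt_sub one_pos t hφ continuous_const]
    have h7 : fracInt β (fun t => fracInt (1 - β) φ t -
        (t ^ (1 - β) / Real.Gamma (1 + (1 - β))) • φ 0) t = fracInt β (fracInt (1 - β) φ) t -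
        fracInt β (fun t => (t ^ (1 - β) / Real.Gamma (1 + (1 - β))) • φ 0) t := by
      simp only [fracInt, smul_sub]
      rw [intervalIntegral.integral_sub, smul_sub]
      · refine (intervalIntegrable_sub_rpow hβ₀ t).smul_continuousOn ?_
        refine (continuousOn_fracInt hβ' hφ).mono ?_
        rw [Set.uIcc_of_le ht]
        exact Set.Icc_subset_Ici_self
      · exact intervalIntegrable_sub_rpow_smul hβ₀ hg
    rw [h7, fracInt_fracInt hβ₀ hβ' ht hφ, fracInt_rpow hβ₀ (by linarith) ht,
      show β + (1 - β) = 1 by ring, fracInt_one (fun _ => φ 0)]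
    congr 1
    split_ifs with h0
    · simp [h0]
    · have h2 : Real.Gamma (1 + 1) = 1 := by
        rw [Real.Gamma_add_one one_ne_zero, Real.Gamma_one, one_mul]
      simp [h2]
  rcases eq_or_lt_of_le ht with rfl | ht0
  · simp
  have d1 := hasDerivAt_fracInt_one ht0 (φ := fun s => φ s - φ 0)
    (hφ.sub continuous_const).continuousOn
  have d2 := hasDerivAt_fracInt_one ht0 (continuousOn_fracInt hβ₀ hψ)
  have d3 : HasDerivAt (fracInt 1 (fun s => φ s - φ 0)) (fracInt β ψ t) t := by
    refine d2.congr_of_eventuallyEq ?_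
    filter_upwards [Ici_mem_nhds ht0] with s hs using key2 s hs
  rw [← d1.unique d3]
  abel

/-- Fractional Taylor formula with the remainder estimated. -/
theorem norm_sub_sum_le_of_eq_add_fracInt [CompleteSpace E] {β : ℝ} (hβ₀ : 0 < β) {a : ℕ → ℝ → E}
    (hc : ∀ k, Continuous (a k)) {T M N : ℝ}
    (ha : ∀ k t, 0 ≤ t → a k t = a k 0 + fracInt β (a (k + 1)) t)
    (hb : ∀ k, ∀ t ∈ Set.Icc 0 T, ‖a k t‖ ≤ M * N ^ k) (n : ℕ) :
    ∀ k, ∀ t ∈ Set.Icc 0 T,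
      ‖a k t - ∑ i ∈ Finset.range n, (t ^ (β * i) / Real.Gamma (1 + β * i)) • a (k + i) 0‖ ≤
        M * N ^ (k + n) * (t ^ (β * n) / Real.Gamma (1 + β * n)) := by
  induction n with
  | zero => intro k t ht; simpa using hb k t ht
  | succ n ih =>
    intro k t ht
    set S : ℝ → E := fun t => ∑ i ∈ Finset.range n,
      (t ^ (β * i) / Real.Gamma (1 + β * i)) • a (k + 1 + i) 0 with hS
    have hcS : ∀ i : ℕ, Continuous fun t : ℝ =>
        (t ^ (β * i) / Real.Gamma (1 + β * i)) • a (k + 1 + i) 0 := fun i =>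
      ((Real.continuous_rpow_const (by positivity)).div_const _).smul continuous_const
    have h1 : fracInt β S t = ∑ i ∈ Finset.range n,
        (t ^ (β * (i + 1 : ℕ)) / Real.Gamma (1 + β * (i + 1 : ℕ))) • a (k + (i + 1)) 0 := by
      simp only [hS, fracInt, Finset.smul_sum]
      rw [intervalIntegral.integral_finsetSum, Finset.smul_sum]
      · refine Finset.sum_congr rfl fun i _ => ?_
        have h2 := fracInt_rpow hβ₀ (b := β * i) (by nlinarith [mul_nonneg hβ₀.le i.cast_nonneg])
          ht.1 (a (k + 1 + i) 0)
        rw [fracInt] at h2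
        rw [h2]
        have h3 : β + β * i = β * (i + 1 : ℕ) := by push_cast; ring
        rw [h3, show k + 1 + i = k + (i + 1) by ring]
        split_ifs with h0
        · rw [h0, Real.zero_rpow (by positivity)]; simp
        · rfl
      · intro i _
        exact intervalIntegrable_sub_rpow_smul hβ₀ (hcS i)
    -- The remainder of order n + 1 at level k is I^β of the remainder of order n at level k + 1, so
    -- the induction hypothesis must hold for all levels.
    have h4 : a k t - ∑ i ∈ Finset.range (n + 1),
        (t ^ (β * i) / Real.Gamma (1 + β * i)) • a (k + i) 0
        = fracInt β (fun s => a (k + 1) s - S s) t := by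
      rw [fracInt_sub hβ₀ t (hc _) (continuous_finsetSum _ fun i _ => hcS i), h1, ha k t ht.1,
        Finset.sum_range_succ']
      simp
      abel
    rw [h4]
    have h5 := norm_fracInt_le hβ₀ (b := β * n) (C := M * N ^ (k + 1 + n)) (by positivity) ht.1
      (φ := fun s => a (k + 1) s - S s) (fun s hs => ih (k + 1) s ⟨hs.1, hs.2.trans ht.2⟩)
    have h3 : β + β * n = β * (n + 1 : ℕ) := by push_cast; ring
    rw [h3, show k + 1 + n = k + (n + 1) by ring] at h5
    exact h5

end FractionalCalculus

/-! ### The Mittag-Leffler function on the negative half-line -/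

section MittagLeffler

/-- Cut the Gamma integral to (R, ∞), where x^y ≥ R^y. As R is free, Γ(1 + βk) beats every geometric
sequence. -/
theorem rpow_mul_exp_neg_le_Gamma {R y : ℝ} (hR : 0 ≤ R) (hy : 0 ≤ y) :
    R ^ y * Real.exp (-R) ≤ Real.Gamma (1 + y) := by
  have hy1 : 0 < 1 + y := by linarith
  rw [Real.Gamma_eq_integral hy1, ← integral_exp_neg_Ioi R, ← integral_const_mul]
  calc ∫ x in Set.Ioi R, R ^ y * Real.exp (-x)
      ≤ ∫ x in Set.Ioi R, Real.exp (-x) * x ^ (1 + y - 1) := by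
        refine setIntegral_mono_on ((integrableOn_exp_neg_Ioi R).const_mul _)
          ((Real.GammaIntegral_convergent hy1).mono_set (Set.Ioi_subset_Ioi hR))
          measurableSet_Ioi fun x hx => ?_
        rw [mul_comm, show 1 + y - 1 = y by ring]
        exact mul_le_mul_of_nonneg_left (Real.rpow_le_rpow hR (Set.mem_Ioi.1 hx).le hy)
          (Real.exp_pos _).le
    _ ≤ ∫ x in Set.Ioi 0, Real.exp (-x) * x ^ (1 + y - 1) := by
        refine setIntegral_mono_set (Real.GammaIntegral_convergent hy1) ?_
          (Set.Ioi_subset_Ioi hR).eventuallyLE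
        filter_upwards [ae_restrict_mem measurableSet_Ioi] with x hx
        exact mul_nonneg (Real.exp_pos _).le (Real.rpow_nonneg (Set.mem_Ioi.1 hx).le _)

theorem Gamma_one_add_mul_pos {β : ℝ} (hβ : 0 < β) (k : ℕ) : 0 < Real.Gamma (1 + β * k) :=
  Real.Gamma_pos_of_pos (by positivity)

theorem summable_pow_div_Gamma {β : ℝ} (hβ : 0 < β) (s : ℝ) :
    Summable fun k : ℕ => s ^ k / Real.Gamma (1 + β * k) := by
  -- With R = c^(1/β) one has R^(βk) = c^k, so Γ(1 + βk) ≥ c^k e^(-R); any c > |s| gives a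
  -- convergent geometric majorant.
  set c : ℝ := 2 * |s| + 1 with hc
  have hc0 : 0 < c := by positivity
  set R : ℝ := c ^ (1 / β) with hR
  have hR0 : 0 ≤ R := by positivity
  have hgeo : Summable fun k : ℕ => Real.exp R * (|s| / c) ^ k := by
    refine (summable_geometric_of_lt_one (by positivity) ?_).mul_left _
    rw [div_lt_one hc0]
    linarith [abs_nonneg s]
  refine Summable.of_norm_bounded hgeo fun k => ?_
  have h1 := rpow_mul_exp_neg_le_Gamma hR0 (show 0 ≤ β * k by positivity)
  have h2 : R ^ (β * k) = c ^ k := by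
    rw [hR, ← Real.rpow_mul hc0.le, ← Real.rpow_natCast]
    congr 1
    field_simp
  rw [h2] at h1
  rw [norm_div, norm_pow, Real.norm_eq_abs, Real.norm_eq_abs,
    abs_of_pos (Gamma_one_add_mul_pos hβ k), div_le_iff₀ (Gamma_one_add_mul_pos hβ k)]
  calc |s| ^ k = Real.exp R * (|s| / c) ^ k * (c ^ k * Real.exp (-R)) := by
        rw [Real.exp_neg, div_pow]
        have := Real.exp_pos R
        field_simp
    _ ≤ _ := mul_le_mul_of_nonneg_left h1 (by positivity)

theorem differentiable_mittagLeffler {β : ℝ} (hβ : 0 < β) : Differentiable ℝ (mittagLeffler β) := by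
  intro s
  set r : ℝ := |s| + 1 with hr
  have hr0 : 0 < r := by positivity
  have h := hasDerivAt_tsum_of_isPreconnected
    (g := fun (k : ℕ) (s : ℝ) => s ^ k / Real.Gamma (1 + β * k))
    (g' := fun (k : ℕ) (s : ℝ) => (k * s ^ (k - 1)) / Real.Gamma (1 + β * k))
    (u := fun k : ℕ => (r + 1) ^ k / Real.Gamma (1 + β * k)) (t := Metric.ball (0 : ℝ) r)
    (y₀ := 0) (y := s)
    (summable_pow_div_Gamma hβ (r + 1)) Metric.isOpen_ball
    (convex_ball _ _).isPreconnected ?_ ?_ (Metric.mem_ball_self hr0)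
    (summable_pow_div_Gamma hβ 0) (by rw [mem_ball_zero_iff, Real.norm_eq_abs]; linarith)
  · exact h.differentiableAt
  · intro k y _
    exact (hasDerivAt_pow k y).div_const _
  · intro k y hy
    rw [mem_ball_zero_iff] at hy
    rw [norm_div, norm_mul, norm_pow, Real.norm_of_nonneg (Gamma_one_add_mul_pos hβ k).le]
    refine div_le_div_of_nonneg_right ?_ (Gamma_one_add_mul_pos hβ k).le
    rcases k with _ | k
    · simp
    · rw [Real.norm_of_nonneg (Nat.cast_nonneg _), Nat.add_sub_cancel]
      -- The left side is a single term of the binomial expansion of (r + 1)^(k+1); so the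
      -- differentiated series is dominated by the series at r + 1.
      have h1 : ((k + 1 : ℕ) : ℝ) * r ^ k ≤ (r + 1) ^ (k + 1) := by
        have h2 := Finset.single_le_sum (f := fun m => r ^ m * 1 ^ (k + 1 - m) * ((k + 1).choose m : ℝ))
          (fun m _ => by positivity) (Finset.mem_range.2 (by omega : k < k + 1 + 1))
        rw [← add_pow] at h2
        simp only [one_pow, mul_one, Nat.choose_succ_self_right] at h2
        linarith
      refine le_trans ?_ h1
      gcongr

theorem continuous_mittagLeffler {β : ℝ} (hβ : 0 < β) : Continuous (mittagLeffler β) :=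
  (differentiable_mittagLeffler hβ).continuous

@[simp]
theorem mittagLeffler_zero (β : ℝ) : mittagLeffler β 0 = 1 := by
  rw [mittagLeffler, tsum_eq_single 0]
  · simp
  · intro k hk
    simp [hk]

theorem mittagLeffler_one (s : ℝ) : mittagLeffler 1 s = Real.exp s := by
  rw [mittagLeffler, Real.exp_eq_exp_ℝ, NormedSpace.exp_eq_tsum_div]
  refine tsum_congr fun k => ?_
  rw [one_mul, add_comm, Real.Gamma_nat_eq_factorial]

theorem mul_rpow_pow {β s : ℝ} (hs : 0 ≤ s) (c : ℝ) (k : ℕ) :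
    (c * s ^ β) ^ k = c ^ k * s ^ (β * k) := by
  rw [mul_pow, Real.rpow_mul hs, Real.rpow_natCast]

/-- The Mittag-Leffler function solves the fractional relaxation equation. -/
theorem mittagLeffler_eq_add_fracInt {β : ℝ} (hβ : 0 < β) (c : ℝ) {t : ℝ} (ht : 0 ≤ t) :
    mittagLeffler β (c * t ^ β) =
      1 + fracInt β (fun s => c * mittagLeffler β (c * s ^ β)) t := by
  have hG := Real.Gamma_pos_of_pos hβ
  rcases eq_or_lt_of_le ht with rfl | ht0
  · simp [Real.zero_rpow hβ.ne']
  set ν : Measure ℝ := volume.restrict (Set.Ioc 0 t)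
  set F : ℕ → ℝ → ℝ := fun k s =>
    (t - s) ^ (β - 1) * (c * (c ^ k * s ^ (β * k) / Real.Gamma (1 + β * k))) with hF
  have hFrac : ∀ (d : ℝ) (k : ℕ), ∫ s in (0 : ℝ)..t,
      (t - s) ^ (β - 1) * (d * (s ^ (β * k) / Real.Gamma (1 + β * k)))
      = Real.Gamma β * (d * (t ^ (β * (k + 1 : ℕ)) / Real.Gamma (1 + β * (k + 1 : ℕ)))) := by
    intro d k
    have h := fracInt_rpow hβ (b := β * k) (by nlinarith [mul_nonneg hβ.le k.cast_nonneg]) ht d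
    rw [if_neg ht0.ne', fracInt, show β + β * k = β * (k + 1 : ℕ) by push_cast; ring, smul_eq_mul,
      smul_eq_mul, inv_mul_eq_iff_eq_mul₀ hG.ne'] at h
    rw [mul_comm d, ← h]
    refine intervalIntegral.integral_congr fun s _ => ?_
    simp only [smul_eq_mul]
    ring
  have hInt : ∀ k, Integrable (F k) ν := by
    intro k
    have h := (intervalIntegrable_sub_rpow hβ t).mul_continuousOn
      (g := fun s => c * (c ^ k * s ^ (β * k) / Real.Gamma (1 + β * k)))
      (Continuous.continuousOn (continuous_const.mul ((continuous_const.mul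
        (Real.continuous_rpow_const (by positivity))).div_const _)))
    rwa [intervalIntegrable_iff_integrableOn_Ioc_of_le ht] at h
  have hval : ∀ k, ∫ s, F k s ∂ν = Real.Gamma β * (c ^ (k + 1) * t ^ (β * (k + 1 : ℕ)) /
      Real.Gamma (1 + β * (k + 1 : ℕ))) := by
    intro k
    rw [← intervalIntegral.integral_of_le ht]
    have h := hFrac (c ^ (k + 1)) k
    rw [mul_div_assoc, ← h]
    refine intervalIntegral.integral_congr fun s _ => ?_
    simp only [hF]
    ring
  have hnorm : ∀ k, ∫ s, ‖F k s‖ ∂ν = Real.Gamma β * (|c| ^ (k + 1) * t ^ (β * (k + 1 : ℕ)) /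
      Real.Gamma (1 + β * (k + 1 : ℕ))) := by
    intro k
    rw [← intervalIntegral.integral_of_le ht]
    have h := hFrac (|c| ^ (k + 1)) k
    rw [mul_div_assoc, ← h]
    refine intervalIntegral.integral_congr fun s hs => ?_
    rw [Set.uIcc_of_le ht] at hs
    simp only [hF]
    rw [norm_mul, norm_mul, norm_div, norm_mul, norm_pow, Real.norm_eq_abs c,
      Real.norm_of_nonneg (Gamma_one_add_mul_pos hβ k).le,
      Real.norm_of_nonneg (Real.rpow_nonneg hs.1 _),
      Real.norm_of_nonneg (Real.rpow_nonneg (by linarith [hs.2]) _)]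
    ring
  have hsum : Summable fun k => ∫ s, ‖F k s‖ ∂ν := by
    simp_rw [hnorm]
    refine Summable.mul_left _ ?_
    have h := (summable_nat_add_iff 1).2 (summable_pow_div_Gamma hβ (|c| * t ^ β))
    simpa only [mul_rpow_pow ht] using h
  -- Termwise integration: I^β turns the k-th term of c E_β(c s^β) into the (k+1)-st term of E_β(c
  -- t^β), and the missing zeroth term is 1.
  have key := (hasSum_integral_of_summable_integral_norm hInt hsum).tsum_eq
  have hR : ∫ s, ∑' k, F k s ∂ν =
      ∫ s in (0 : ℝ)..t, (t - s) ^ (β - 1) • (c * mittagLeffler β (c * s ^ β)) := by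
    rw [intervalIntegral.integral_of_le ht]
    refine setIntegral_congr_fun measurableSet_Ioc fun s hs => ?_
    simp only [hF]
    rw [tsum_mul_left, tsum_mul_left, mittagLeffler, smul_eq_mul]
    simp_rw [mul_rpow_pow hs.1.le]
  rw [fracInt, ← hR, ← key]
  simp_rw [hval]
  rw [tsum_mul_left, smul_eq_mul, inv_mul_cancel_left₀ hG.ne', mittagLeffler,
    (summable_pow_div_Gamma hβ _).tsum_eq_zero_add]
  simp [mul_rpow_pow ht]

/-- Minimum principle for the fractional derivative of order `β < 1`. -/
theorem nonneg_of_eq_add_fracInt {β : ℝ} (hβ₀ : 0 < β) (hβ₁ : β < 1) {y z : ℝ → ℝ}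
    (hy : Continuous y) (hz : Continuous z) (hy₀ : 0 ≤ y 0)
    (h : ∀ t, 0 ≤ t → y t = y 0 + fracInt β z t) (hd : ∀ t, 0 < t → DifferentiableAt ℝ y t)
    (hneg : ∀ t, 0 < t → y t < 0 → 0 < z t) {t : ℝ} (ht : 0 ≤ t) : 0 ≤ y t := by
  by_contra hcon
  push Not at hcon
  obtain ⟨t₀, ht₀, hmin⟩ := (isCompact_Icc (a := 0) (b := t)).exists_isMinOn ⟨0, by simp [ht]⟩
    hy.continuousOn
  have hyt₀ : y t₀ < 0 := lt_of_le_of_lt (hmin ⟨ht, le_rfl⟩) hcon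
  have ht₀0 : 0 < t₀ := lt_of_le_of_ne ht₀.1 fun h0 => by rw [← h0] at hyt₀; linarith
  have hzpos := hneg t₀ ht₀0 hyt₀
  have hβ' : 0 < 1 - β := by linarith
  -- At a negative minimum `t₀` one has `0 < z t₀` by hypothesis; the contradiction will be `z t₀ ≤
  -- 0`. The increment q is nonnegative on [0, t₀], and `m < 0` because y(0) ≥ 0.
  set q : ℝ → ℝ := fun s => y s - y t₀ with hq
  have hqc : Continuous q := hy.sub continuous_const
  have hqn : ∀ s ∈ Set.Icc 0 t₀, 0 ≤ q s := fun s hs => sub_nonneg.2 (hmin ⟨hs.1, hs.2.trans ht₀.2⟩)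
  set m : ℝ := y t₀ - y 0 with hm
  have hm0 : m < 0 := by rw [hm]; linarith
  have hG := Real.Gamma_pos_of_pos hβ'
  have hqi : ∀ s : ℝ, IntervalIntegrable (fun τ => (s - τ) ^ (-β) * q τ) volume 0 s := by
    intro s
    have := intervalIntegrable_sub_rpow_smul hβ' (t := s) hqc
    simpa [show 1 - β - 1 = -β by ring] using this
  -- Since y - y(0) = I^β z, applying I^(1-β) expresses the primitive of z through q and m, whose
  -- signs are known.
  have hZ : ∀ s, 0 ≤ s → Real.Gamma (1 - β) * fracInt 1 z s =
      (∫ τ in (0 : ℝ)..s, (s - τ) ^ (-β) * q τ) + m * (s ^ (1 - β) / (1 - β)) := by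
    intro s hs
    have h1 : fracInt 1 z s = fracInt (1 - β) (fun r => q r + m) s := by
      conv_lhs => rw [show (1 : ℝ) = 1 - β + β by ring]
      rw [← fracInt_fracInt hβ' hβ₀ hs hz]
      refine fracInt_congr hs fun r hr => ?_
      have := h r hr.1
      simp only [hq, hm]
      linarith
    rw [h1, fracInt, smul_eq_mul, mul_inv_cancel_left₀ hG.ne', ← integral_sub_rpow hβ' s,
      show 1 - β - 1 = -β by ring, ← intervalIntegral.integral_const_mul,
      ← intervalIntegral.integral_add (hqi s)]
    · refine intervalIntegral.integral_congr fun r _ => ?_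
      simp only [smul_eq_mul]
      ring
    · have := (intervalIntegrable_sub_rpow hβ' s).const_mul m
      simpa [show 1 - β - 1 = -β by ring] using this
  -- Differentiability at the minimum gives q(τ) ≤ C |τ - t₀|, which tames the singular kernel next
  -- to `t₀`.
  obtain ⟨C, hC⟩ := (hd t₀ ht₀0).hasDerivAt.isBigO_sub.bound
  obtain ⟨δ, hδ, hball⟩ := Metric.eventually_nhds_iff.1 hC
  have hC0 : 0 ≤ C := by
    have h1 := hball (y := t₀ - δ / 2) (by
      rw [Real.dist_eq, show t₀ - δ / 2 - t₀ = -(δ / 2) by ring, abs_neg, abs_of_pos (by positivity)]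
      linarith)
    by_contra hC0
    push Not at hC0
    have h2 : 0 < ‖t₀ - δ / 2 - t₀‖ := by
      rw [show t₀ - δ / 2 - t₀ = -(δ / 2) by ring, norm_neg, Real.norm_of_nonneg (by positivity)]
      positivity
    nlinarith [norm_nonneg (y (t₀ - δ / 2) - y t₀)]
  have hbound : ∀ s, 0 ≤ s → s < t₀ → t₀ - s < δ →
      Real.Gamma (1 - β) * (fracInt 1 z t₀ - fracInt 1 z s) ≤
        C * (t₀ - s) * ((t₀ - s) ^ (1 - β) / (1 - β)) := by
    intro s hs hst hsδ
    rw [mul_sub, hZ t₀ ht₀0.le, hZ s hs]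
    have hi1 : IntervalIntegrable (fun τ => (t₀ - τ) ^ (-β) * q τ) volume 0 s :=
      (hqi t₀).mono_set (by rw [Set.uIcc_of_le hs, Set.uIcc_of_le ht₀0.le]; exact Set.Icc_subset_Icc_right hst.le)
    have hi2 : IntervalIntegrable (fun τ => (t₀ - τ) ^ (-β) * q τ) volume s t₀ :=
      (hqi t₀).mono_set (by rw [Set.uIcc_of_le hst.le, Set.uIcc_of_le ht₀0.le]; exact Set.Icc_subset_Icc_left hs)
    rw [← intervalIntegral.integral_add_adjacent_intervals hi1 hi2]
    -- Three pieces: on [0, s] moving the endpoint from s to `t₀` lowers the kernel; on [s, t₀] the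
    -- Lipschitz bound leaves O((t₀ - s)^(2-β)); the m-term decreases because m < 0.
    have e1 : ∫ τ in (0 : ℝ)..s, (t₀ - τ) ^ (-β) * q τ ≤ ∫ τ in (0 : ℝ)..s, (s - τ) ^ (-β) * q τ := by
      refine intervalIntegral.integral_mono_on_of_le_Ioo hs hi1 (hqi s) fun τ hτ => ?_
      refine mul_le_mul_of_nonneg_right ?_ (hqn τ ⟨hτ.1.le, by linarith [hτ.2]⟩)
      exact Real.rpow_le_rpow_of_nonpos (by linarith [hτ.2]) (by linarith) (by linarith)
    have hker : IntervalIntegrable (fun τ => (t₀ - τ) ^ (-β)) volume s t₀ := by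
      have := intervalIntegrable_sub_rpow hβ' t₀
      rw [show 1 - β - 1 = -β by ring] at this
      exact this.mono_set (by rw [Set.uIcc_of_le hst.le, Set.uIcc_of_le ht₀0.le]; exact Set.Icc_subset_Icc_left hs)
    have e2 : ∫ τ in s..t₀, (t₀ - τ) ^ (-β) * q τ ≤ C * (t₀ - s) * ((t₀ - s) ^ (1 - β) / (1 - β)) := by
      have h1 : ∫ τ in s..t₀, (t₀ - τ) ^ (-β) = (t₀ - s) ^ (1 - β) / (1 - β) := by
        rw [intervalIntegral.integral_comp_sub_left (fun x => x ^ (-β)) t₀,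
          integral_rpow (Or.inl (by linarith)), show -β + 1 = 1 - β by ring]
        simp [hβ'.ne']
      rw [← h1, ← intervalIntegral.integral_const_mul]
      refine intervalIntegral.integral_mono_on hst.le hi2 (hker.const_mul _) fun τ hτ => ?_
      rw [mul_comm]
      refine mul_le_mul_of_nonneg_right ?_ (Real.rpow_nonneg (by linarith [hτ.2]) _)
      have h2 := hball (y := τ) (by rw [Real.dist_eq, abs_sub_comm, abs_of_nonneg (by linarith [hτ.2])]; linarith [hτ.1])
      calc q τ ≤ ‖y τ - y t₀‖ := le_abs_self _
        _ ≤ C * ‖τ - t₀‖ := h2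
        _ ≤ C * (t₀ - s) := by
          refine mul_le_mul_of_nonneg_left ?_ hC0
          rw [Real.norm_eq_abs, abs_sub_comm, abs_of_nonneg (by linarith [hτ.2])]
          linarith [hτ.1]
    have e3 : m * (t₀ ^ (1 - β) / (1 - β)) ≤ m * (s ^ (1 - β) / (1 - β)) := by
      refine mul_le_mul_of_nonpos_left ?_ hm0.le
      exact div_le_div_of_nonneg_right (Real.rpow_le_rpow hs hst.le hβ'.le) hβ'.le
    linarith
  have hder := hasDerivAt_fracInt_one ht₀0 hz.continuousOn
  have hslope := (hasDerivAt_iff_tendsto_slope.1 hder).mono_left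
    (nhdsWithin_mono t₀ (fun x (hx : x ∈ Set.Iio t₀) => (ne_of_lt hx : x ∈ ({t₀} : Set ℝ)ᶜ)))
  have hlim : Tendsto (fun s : ℝ => (Real.Gamma (1 - β))⁻¹ * (C * ((t₀ - s) ^ (1 - β) / (1 - β))))
      (𝓝[<] t₀) (𝓝 0) := by
    have h1 : Continuous fun s : ℝ => (Real.Gamma (1 - β))⁻¹ * (C * ((t₀ - s) ^ (1 - β) / (1 - β))) :=
      continuous_const.mul (continuous_const.mul
        (((Real.continuous_rpow_const hβ'.le).comp (continuous_const.sub continuous_id)).div_const _))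
    have h2 := (h1.tendsto t₀).mono_left (nhdsWithin_le_nhds (s := Set.Iio t₀))
    simpa [Real.zero_rpow hβ'.ne'] using h2
  -- Dividing by t₀ - s bounds the left difference quotients of the primitive of z, which tend to `z
  -- t₀`, by O((t₀ - s)^(1-β)).
  have hle : z t₀ ≤ 0 := by
    refine le_of_tendsto_of_tendsto hslope hlim ?_
    have h1 : ∀ᶠ s in 𝓝[<] t₀, s ∈ Set.Ioo (max 0 (t₀ - δ)) t₀ :=
      Ioo_mem_nhdsLT (max_lt ht₀0 (by linarith))
    filter_upwards [h1] with s hs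
    have hs0 : 0 < s := lt_of_le_of_lt (le_max_left _ _) hs.1
    have hsδ : t₀ - δ < s := lt_of_le_of_lt (le_max_right _ _) hs.1
    have h2 := hbound s hs0.le hs.2 (by linarith)
    have h3 : 0 < t₀ - s := by linarith [hs.2]
    rw [slope_comm, slope_def_field, div_le_iff₀ h3, mul_assoc, ← div_eq_inv_mul, le_div_iff₀ hG]
    linarith
  linarith

theorem continuous_mittagLeffler_mul_rpow {β : ℝ} (hβ : 0 < β) (c : ℝ) :
    Continuous fun t : ℝ => mittagLeffler β (c * t ^ β) :=
  (continuous_mittagLeffler hβ).comp (continuous_const.mul (Real.continuous_rpow_const hβ.le))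

theorem differentiableAt_mittagLeffler_mul_rpow {β : ℝ} (hβ : 0 < β) (c : ℝ) {t : ℝ} (ht : 0 < t) :
    DifferentiableAt ℝ (fun t : ℝ => mittagLeffler β (c * t ^ β)) t :=
  ((differentiable_mittagLeffler hβ) _).comp t
    ((Real.differentiableAt_rpow_const_of_ne β ht.ne').const_mul c)

/-- Minimum principle for y = E_β(-s t^β), whose fractional derivative -s y is positive wherever y <
0 (for s > 0). For β = 1 the function is the exponential. -/
theorem mittagLeffler_neg_nonneg {β : ℝ} (hβ₀ : 0 < β) (hβ₁ : β ≤ 1) {s : ℝ} (hs : 0 ≤ s) :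
    0 ≤ mittagLeffler β (-s) := by
  rcases eq_or_lt_of_le hβ₁ with rfl | hβ
  · rw [mittagLeffler_one]; exact (Real.exp_pos _).le
  rcases eq_or_lt_of_le hs with rfl | hs0
  · simp
  have h := nonneg_of_eq_add_fracInt hβ₀ hβ (y := fun t => mittagLeffler β (-s * t ^ β))
    (z := fun t => -s * mittagLeffler β (-s * t ^ β))
    (continuous_mittagLeffler_mul_rpow hβ₀ _)
    ((continuous_mittagLeffler_mul_rpow hβ₀ _).const_mul _) (by simp [Real.zero_rpow hβ₀.ne'])
    (fun t ht => by
      rw [mittagLeffler_eq_add_fracInt hβ₀ (-s) ht]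
      simp [Real.zero_rpow hβ₀.ne'])
    (fun t ht => differentiableAt_mittagLeffler_mul_rpow hβ₀ _ ht)
    (fun t _ hneg => by nlinarith) zero_le_one
  simpa using h

/-- Minimum principle for the difference y = E - E', with E = E_β(-s t^β) and E' = E_β(-s' t^β). Its
fractional derivative is s'(E' - E) + (s' - s)E, which is positive where y < 0 because E ≥ 0. -/
theorem mittagLeffler_neg_anti {β : ℝ} (hβ₀ : 0 < β) (hβ₁ : β ≤ 1) {s s' : ℝ} (hs : 0 ≤ s)
    (hss' : s ≤ s') : mittagLeffler β (-s') ≤ mittagLeffler β (-s) := by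
  rcases eq_or_lt_of_le hβ₁ with rfl | hβ
  · rw [mittagLeffler_one, mittagLeffler_one]; exact Real.exp_le_exp.2 (by linarith)
  rcases eq_or_lt_of_le hss' with rfl | hlt
  · rfl
  have hc := fun c => continuous_mittagLeffler_mul_rpow hβ₀ c
  have h := nonneg_of_eq_add_fracInt hβ₀ hβ
    (y := fun t => mittagLeffler β (-s * t ^ β) - mittagLeffler β (-s' * t ^ β))
    (z := fun t => -s * mittagLeffler β (-s * t ^ β) - -s' * mittagLeffler β (-s' * t ^ β))
    ((hc _).sub (hc _)) (((hc _).const_mul _).sub ((hc _).const_mul _))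
    (by simp [Real.zero_rpow hβ₀.ne'])
    (fun t ht => by
      rw [mittagLeffler_eq_add_fracInt hβ₀ (-s) ht, mittagLeffler_eq_add_fracInt hβ₀ (-s') ht,
        fracInt_sub hβ₀ t ((hc _).const_mul _) ((hc _).const_mul _)]
      simp [Real.zero_rpow hβ₀.ne'])
    (fun t ht => (differentiableAt_mittagLeffler_mul_rpow hβ₀ _ ht).sub
      (differentiableAt_mittagLeffler_mul_rpow hβ₀ _ ht))
    (fun t ht hneg => by
      have h1 : 0 ≤ mittagLeffler β (-s * t ^ β) := by
        rw [neg_mul]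
        exact mittagLeffler_neg_nonneg hβ₀ hβ₁ (by positivity)
      nlinarith) zero_le_one
  simpa using h

theorem mittagLeffler_neg_le_one {β : ℝ} (hβ₀ : 0 < β) (hβ₁ : β ≤ 1) {s : ℝ} (hs : 0 ≤ s) :
    mittagLeffler β (-s) ≤ 1 := by
  simpa using mittagLeffler_neg_anti hβ₀ hβ₁ le_rfl hs

/-- In the relaxation equation at time 1, monotonicity allows replacing E_β(-s τ^β) by the smaller
E_β(-s): 0 ≤ E_β(-s) ≤ 1 - s E_β(-s) / Γ(1 + β). -/
theorem mittagLeffler_neg_mul_le {β : ℝ} (hβ₀ : 0 < β) (hβ₁ : β ≤ 1) {s : ℝ} (hs : 0 ≤ s) :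
    mittagLeffler β (-s) * s ≤ Real.Gamma (1 + β) := by
  have hG := Real.Gamma_pos_of_pos hβ₀
  have h := mittagLeffler_eq_add_fracInt hβ₀ (-s) zero_le_one
  rw [Real.one_rpow, mul_one, fracInt] at h
  have h1 : ∫ τ in (0 : ℝ)..1, (1 - τ) ^ (β - 1) • (-s * mittagLeffler β (-s * τ ^ β)) ≤
      ∫ τ in (0 : ℝ)..1, (1 - τ) ^ (β - 1) * (-s * mittagLeffler β (-s)) := by
    refine intervalIntegral.integral_mono_on zero_le_one ?_ ?_ fun τ hτ => ?_
    · exact intervalIntegrable_sub_rpow_smul hβ₀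
        ((continuous_mittagLeffler_mul_rpow hβ₀ _).const_mul _)
    · exact (intervalIntegrable_sub_rpow hβ₀ 1).mul_const _
    · refine mul_le_mul_of_nonneg_left ?_ (Real.rpow_nonneg (by linarith [hτ.2]) _)
      refine mul_le_mul_of_nonpos_left ?_ (by linarith)
      rw [neg_mul]
      exact mittagLeffler_neg_anti hβ₀ hβ₁ (mul_nonneg hs (Real.rpow_nonneg hτ.1 _))
        (mul_le_of_le_one_right hs (Real.rpow_le_one hτ.1 hτ.2 hβ₀.le))
  rw [intervalIntegral.integral_mul_const, integral_sub_rpow hβ₀, Real.one_rpow] at h1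
  have h2 : 0 ≤ mittagLeffler β (-s) := mittagLeffler_neg_nonneg hβ₀ hβ₁ hs
  have h3 := mul_le_mul_of_nonneg_left h1 (inv_nonneg.2 hG.le)
  rw [smul_eq_mul] at h
  have h4 : (Real.Gamma β)⁻¹ * (1 / β * (-s * mittagLeffler β (-s))) =
      -(mittagLeffler β (-s) * s) / Real.Gamma (1 + β) := by
    rw [add_comm, Real.Gamma_add_one hβ₀.ne']
    field_simp
  rw [h4] at h3
  have hG1 : 0 < Real.Gamma (1 + β) := Real.Gamma_pos_of_pos (by linarith)
  have h5 : mittagLeffler β (-s) * s / Real.Gamma (1 + β) ≤ 1 := by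
    rw [neg_div] at h3; linarith
  rwa [div_le_one hG1] at h5

end MittagLeffler

/-! ### Inner-product preserving maps -/

section HilbertSpace

variable {H K : Type*} [NormedAddCommGroup H] [InnerProductSpace ℂ H]
  [NormedAddCommGroup K] [InnerProductSpace ℂ K]

theorem norm_sub_eq_of_inner_eq {a b : H} {a' b' : K} (haa : inner ℂ a' a' = inner ℂ a a)
    (hab : inner ℂ a' b' = inner ℂ a b) (hbb : inner ℂ b' b' = inner ℂ b b) :
    ‖a' - b'‖ = ‖a - b‖ := by
  have h : ‖a' - b'‖ ^ 2 = ‖a - b‖ ^ 2 := by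
    rw [norm_sub_sq (𝕜 := ℂ), norm_sub_sq (𝕜 := ℂ), ← inner_self_eq_norm_sq (𝕜 := ℂ) a',
      ← inner_self_eq_norm_sq (𝕜 := ℂ) b', ← inner_self_eq_norm_sq (𝕜 := ℂ) a,
      ← inner_self_eq_norm_sq (𝕜 := ℂ) b, haa, hab, hbb]
  exact (pow_left_inj₀ (norm_nonneg _) (norm_nonneg _) two_ne_zero).1 h

/-- A map between Hilbert spaces that preserves inner products is linear. -/
theorem exists_linearIsometry_of_inner_eq (J : H → K)
    (hJ : ∀ f g, inner ℂ (J f) (J g) = inner ℂ f g) :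
    ∃ L : H →ₗᵢ[ℂ] K, ∀ f, L f = J f := by
  have hadd : ∀ f g, J (f + g) = J f + J g := by
    intro f g
    rw [← sub_eq_zero, ← norm_eq_zero]
    rw [norm_sub_eq_of_inner_eq (a := f + g) (b := f + g), sub_self, norm_zero]
    · exact hJ _ _
    · simp only [inner_add_right, hJ]
    · simp only [inner_add_right, inner_add_left, hJ]
  have hsmul : ∀ (c : ℂ) (f), J (c • f) = c • J f := by
    intro c f
    rw [← sub_eq_zero, ← norm_eq_zero]
    rw [norm_sub_eq_of_inner_eq (a := c • f) (b := c • f), sub_self, norm_zero]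
    · exact hJ _ _
    · simp only [inner_smul_right, hJ]
    · simp only [inner_smul_right, inner_smul_left, hJ]
  exact ⟨LinearMap.isometryOfInner ⟨⟨J, hadd⟩, hsmul⟩ hJ, fun _ => rfl⟩

end HilbertSpace

/-! ### The stochastic integral as an isometry -/

section StochasticIntegral

variable {Ω : Type*} [MeasurableSpace Ω] {P : Measure Ω} {ν : Measure ℝ} {Z : Set ℝ → Ω → ℂ}

theorem inner_toLp {α : Type*} [MeasurableSpace α] {ρ : Measure α} {X Y : α → ℂ}
    (hX : MemLp X 2 ρ) (hY : MemLp Y 2 ρ) :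
    inner ℂ (hX.toLp X) (hY.toLp Y) = ∫ a, Y a * (starRingEnd ℂ) (X a) ∂ρ := by
  rw [L2.inner_def]
  refine integral_congr_ae ?_
  filter_upwards [hX.coeFn_toLp, hY.coeFn_toLp] with a h1 h2
  rw [h1, h2, RCLike.inner_apply]

/-- The level set of 0 may have infinite control measure, where nothing is known about `Z`; the
coefficient 0 removes that term. -/
theorem simpleIntegral_term_memLp (hZ : IsOrthogonalRandomMeasure P ν Z) {s : SimpleFunc ℝ ℂ}
    (hs : MemLp s 2 ν) (c : ℂ) : MemLp (fun ω => c * Z (s ⁻¹' {c}) ω) 2 P := by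
  by_cases hc : c = 0
  · simp [hc]
  · exact (hZ.memLp _ (s.measurableSet_preimage _) (s.measure_preimage_lt_top_of_memLp two_ne_zero
      ENNReal.ofNat_ne_top hs c hc)).const_mul c

theorem memLp_simpleIntegral (hZ : IsOrthogonalRandomMeasure P ν Z) {s : SimpleFunc ℝ ℂ}
    (hs : MemLp s 2 ν) : MemLp (simpleIntegral Z s) 2 P :=
  memLp_finsetSum _ fun c _ => simpleIntegral_term_memLp hZ hs c

theorem memLp_conj {α : Type*} [MeasurableSpace α] {ρ : Measure α} {X : α → ℂ} {p : ℝ≥0∞}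
    (hX : MemLp X p ρ) : MemLp (fun a => (starRingEnd ℂ) (X a)) p ρ :=
  hX.star

/-- The integral of simple functions is isometric. -/
theorem integral_simpleIntegral_mul_conj (hZ : IsOrthogonalRandomMeasure P ν Z)
    {s s' : SimpleFunc ℝ ℂ} (hs : MemLp s 2 ν) (hs' : MemLp s' 2 ν) :
    ∫ ω, simpleIntegral Z s ω * (starRingEnd ℂ) (simpleIntegral Z s' ω) ∂P =
      ∫ l, s l * (starRingEnd ℂ) (s' l) ∂ν := by
  -- Decompose over the joint level sets of the two functions; orthogonality gives the same double
  -- sum on the probability side.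
  have hpt : ∀ l, s l * (starRingEnd ℂ) (s' l) = ∑ c ∈ s.range, ∑ c' ∈ s'.range,
      (s ⁻¹' {c} ∩ s' ⁻¹' {c'}).indicator (fun _ => c * (starRingEnd ℂ) c') l := by
    intro l
    rw [Finset.sum_eq_single (s l), Finset.sum_eq_single (s' l)]
    · rw [Set.indicator_of_mem]
      exact ⟨rfl, rfl⟩
    · intro c' _ hc'
      exact Set.indicator_of_notMem (fun h => hc' h.2.symm) _
    · intro h; exact absurd (s'.mem_range_self l) h
    · intro c _ hc
      exact Finset.sum_eq_zero fun c' _ => Set.indicator_of_notMem (fun h => hc h.1.symm) _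
    · intro h; exact absurd (s.mem_range_self l) h
  have hlt := fun c hc => s.measure_preimage_lt_top_of_memLp two_ne_zero
      ENNReal.ofNat_ne_top hs c hc
  have hlt' := fun c hc => s'.measure_preimage_lt_top_of_memLp two_ne_zero
      ENNReal.ofNat_ne_top hs' c hc
  have hms : ∀ c c', MeasurableSet (s ⁻¹' {c} ∩ s' ⁻¹' {c'}) := fun c c' =>
    (s.measurableSet_preimage _).inter (s'.measurableSet_preimage _)
  have hint : ∀ c c', Integrable ((s ⁻¹' {c} ∩ s' ⁻¹' {c'}).indicator
      (fun _ => c * (starRingEnd ℂ) c')) ν := by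
    intro c c'
    by_cases hc : c = 0
    · simp [hc]
    · rw [integrable_indicator_iff (hms c c')]
      exact integrableOn_const ((measure_mono Set.inter_subset_left).trans_lt (hlt c hc)).ne
  simp_rw [hpt]
  rw [integral_finsetSum _ fun c _ => integrable_finsetSum _ fun c' _ => hint c c']
  simp_rw [integral_finsetSum _ fun c' _ => hint _ c', simpleIntegral, map_sum,
    Finset.sum_mul_sum]
  have hint2 : ∀ c c', Integrable (fun ω => c * Z (s ⁻¹' {c}) ω *
      (starRingEnd ℂ) (c' * Z (s' ⁻¹' {c'}) ω)) P := fun c c' =>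
    (simpleIntegral_term_memLp hZ hs c).integrable_mul
      (memLp_conj (simpleIntegral_term_memLp hZ hs' c'))
  rw [integral_finsetSum _ fun c _ => integrable_finsetSum _ fun c' _ => hint2 c c']
  refine Finset.sum_congr rfl fun c _ => ?_
  rw [integral_finsetSum _ fun c' _ => hint2 c c']
  refine Finset.sum_congr rfl fun c' _ => ?_
  rw [integral_indicator_const _ (hms c c')]
  by_cases hc : c = 0
  · simp [hc]
  by_cases hc' : c' = 0
  · simp [hc']
  have h1 : ∀ ω, c * Z (s ⁻¹' {c}) ω * (starRingEnd ℂ) (c' * Z (s' ⁻¹' {c'}) ω) =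
      c * (starRingEnd ℂ) c' * (Z (s ⁻¹' {c}) ω * (starRingEnd ℂ) (Z (s' ⁻¹' {c'}) ω)) := by
    intro ω
    rw [map_mul]
    ring
  simp_rw [h1]
  rw [integral_const_mul, hZ.inner_eq _ _ (s.measurableSet_preimage _) (hlt c hc)
    (s'.measurableSet_preimage _) (hlt' c' hc'), Complex.real_smul, mul_comm]
  rfl

theorem inner_toLp_simpleIntegral (hZ : IsOrthogonalRandomMeasure P ν Z)
    {s s' : SimpleFunc ℝ ℂ} (hs : MemLp s 2 ν) (hs' : MemLp s' 2 ν) :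
    inner ℂ ((memLp_simpleIntegral hZ hs).toLp _) ((memLp_simpleIntegral hZ hs').toLp _) =
      inner ℂ (hs.toLp s) (hs'.toLp s') := by
  rw [inner_toLp, inner_toLp, integral_simpleIntegral_mul_conj hZ hs' hs]

theorem IsStochIntegral.memLp_integrand {g : ℝ → ℂ} {X : Ω → ℂ}
    (h : IsStochIntegral P ν Z g X) : MemLp g 2 ν := h.1

theorem IsStochIntegral.memLp {g : ℝ → ℂ} {X : Ω → ℂ}
    (h : IsStochIntegral P ν Z g X) : MemLp X 2 P := h.2.1

theorem IsStochIntegral.exists_tendsto (hZ : IsOrthogonalRandomMeasure P ν Z) {g : ℝ → ℂ}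
    {X : Ω → ℂ} (h : IsStochIntegral P ν Z g X) :
    ∃ (s : ℕ → SimpleFunc ℝ ℂ) (hs : ∀ k, MemLp (s k) 2 ν),
      Tendsto (fun k => (hs k).toLp (s k)) atTop (𝓝 (h.memLp_integrand.toLp g)) ∧
      Tendsto (fun k => (memLp_simpleIntegral hZ (hs k)).toLp _) atTop (𝓝 (h.memLp.toLp X)) := by
  obtain ⟨hg, hX, s, hs, h1, h2⟩ := h
  refine ⟨s, hs, ?_, ?_⟩
  · exact (Lp.tendsto_Lp_iff_tendsto_eLpNorm'' (fun k => ⇑(s k)) hs g hg).2 h1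
  · exact (Lp.tendsto_Lp_iff_tendsto_eLpNorm'' (fun k => simpleIntegral Z (s k))
      (fun k => memLp_simpleIntegral hZ (hs k)) X hX).2 h2

/-- The isometry on simple functions passes to limits. The two approximating sequences may be
unrelated, which is why the integral does not depend on the sequence. -/
theorem IsStochIntegral.inner_eq (hZ : IsOrthogonalRandomMeasure P ν Z) {g g' : ℝ → ℂ}
    {X X' : Ω → ℂ} (h : IsStochIntegral P ν Z g X) (h' : IsStochIntegral P ν Z g' X') :
    inner ℂ (h.memLp.toLp X) (h'.memLp.toLp X') = inner ℂ (h.memLp_integrand.toLp g) (h'.memLp_integrand.toLp g') := by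
  obtain ⟨s, hs, h1, h2⟩ := h.exists_tendsto hZ
  obtain ⟨s', hs', h1', h2'⟩ := h'.exists_tendsto hZ
  have e1 := h1.inner (𝕜 := ℂ) h1'
  have e2 := h2.inner (𝕜 := ℂ) h2'
  refine tendsto_nhds_unique e2 (e1.congr fun k => ?_)
  exact (inner_toLp_simpleIntegral hZ (hs k) (hs' k)).symm

/-- Approximating simple functions are Cauchy in L²(ν), so by isometry their integrals are Cauchy in
L²(P), which is complete. -/
theorem exists_isStochIntegral (hZ : IsOrthogonalRandomMeasure P ν Z) {g : ℝ → ℂ}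
    (hg : MemLp g 2 ν) : ∃ X, IsStochIntegral P ν Z g X := by
  have h1 : ∀ k : ℕ, ∃ s : SimpleFunc ℝ ℂ, eLpNorm (g - ⇑s) 2 ν < ((k : ℝ≥0∞) + 1)⁻¹ ∧ MemLp s 2 ν :=
    fun k => hg.exists_simpleFunc_eLpNorm_sub_lt ENNReal.ofNat_ne_top (by simp)
  choose s hs hs' using h1
  have h2 : Tendsto (fun k => eLpNorm (fun l => s k l - g l) 2 ν) atTop (𝓝 0) := by
    have h3 : Tendsto (fun k : ℕ => ((k : ℝ≥0∞) + 1)⁻¹) atTop (𝓝 0) := by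
      have := ENNReal.tendsto_inv_nat_nhds_zero.comp (tendsto_add_atTop_nat 1)
      refine this.congr fun k => ?_
      simp
    refine tendsto_of_tendsto_of_tendsto_of_le_of_le tendsto_const_nhds h3 (fun _ => zero_le)
      fun k => ?_
    have h4 : eLpNorm (fun l => s k l - g l) 2 ν = eLpNorm (g - ⇑(s k)) 2 ν :=
      eLpNorm_sub_comm _ _ _ _
    rw [h4]
    exact (hs k).le
  have h3 : Tendsto (fun k => (hs' k).toLp (s k)) atTop (𝓝 (hg.toLp g)) :=
    (Lp.tendsto_Lp_iff_tendsto_eLpNorm'' (fun k => ⇑(s k)) hs' g hg).2 h2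
  have h4 : CauchySeq fun k => (memLp_simpleIntegral hZ (hs' k)).toLp (simpleIntegral Z (s k)) := by
    rw [Metric.cauchySeq_iff]
    have h5 := Metric.cauchySeq_iff.1 h3.cauchySeq
    intro ε hε
    obtain ⟨N, hN⟩ := h5 ε hε
    refine ⟨N, fun m hm n hn => ?_⟩
    have h6 := hN m hm n hn
    rw [dist_eq_norm] at h6 ⊢
    rwa [norm_sub_eq_of_inner_eq (inner_toLp_simpleIntegral hZ (hs' m) (hs' m))
      (inner_toLp_simpleIntegral hZ (hs' m) (hs' n)) (inner_toLp_simpleIntegral hZ (hs' n) (hs' n))]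
  obtain ⟨X, hX⟩ := cauchySeq_tendsto_of_complete h4
  refine ⟨X, hg, Lp.memLp X, s, hs', h2, ?_⟩
  refine (Lp.tendsto_Lp_iff_tendsto_eLpNorm'' (fun k => simpleIntegral Z (s k))
    (fun k => memLp_simpleIntegral hZ (hs' k)) X (Lp.memLp X)).1 ?_
  rwa [Lp.toLp_coeFn]

/-- The stochastic integral as a linear isometry. -/
theorem exists_linearIsometry_stochIntegral (hZ : IsOrthogonalRandomMeasure P ν Z) :
    ∃ J : Lp ℂ 2 ν →ₗᵢ[ℂ] Lp ℂ 2 P, ∀ (g : ℝ → ℂ) (X : Ω → ℂ)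
      (h : IsStochIntegral P ν Z g X), J (h.memLp_integrand.toLp g) = h.memLp.toLp X := by
  have h1 : ∀ f : Lp ℂ 2 ν, ∃ X, IsStochIntegral P ν Z f X := fun f =>
    exists_isStochIntegral hZ (Lp.memLp f)
  choose X hX using h1
  -- One integral is chosen for each class, with no linearity in the choice; preserving inner
  -- products forces it.
  obtain ⟨J, hJ⟩ := exists_linearIsometry_of_inner_eq (fun f => (hX f).memLp.toLp (X f)) fun f g => by
    rw [(hX f).inner_eq hZ (hX g), Lp.toLp_coeFn, Lp.toLp_coeFn]
  refine ⟨J, fun g Y h => ?_⟩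
  rw [hJ, ← sub_eq_zero, ← norm_eq_zero]
  rw [norm_sub_eq_of_inner_eq (a := h.memLp_integrand.toLp g) (b := h.memLp_integrand.toLp g), sub_self, norm_zero]
  · rw [(hX _).inner_eq hZ (hX _), Lp.toLp_coeFn]
  · rw [(hX _).inner_eq hZ h, Lp.toLp_coeFn]
  · exact h.inner_eq hZ h

theorem IsStochIntegral.unique (hZ : IsOrthogonalRandomMeasure P ν Z) {g : ℝ → ℂ}
    {X Y : Ω → ℂ} (hX : IsStochIntegral P ν Z g X) (hY : IsStochIntegral P ν Z g Y) : X =ᵐ[P] Y := by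
  obtain ⟨J, hJ⟩ := exists_linearIsometry_stochIntegral hZ
  have h1 := (hJ g X hX).symm.trans (hJ g Y hY)
  exact (MemLp.toLp_eq_toLp_iff _ _).1 h1

theorem IsStochIntegral.congr {g : ℝ → ℂ} {X Y : Ω → ℂ} (hX : IsStochIntegral P ν Z g X)
    (h : X =ᵐ[P] Y) : IsStochIntegral P ν Z g Y := by
  obtain ⟨hg, hX, s, hs, h1, h2⟩ := hX
  refine ⟨hg, hX.ae_eq h, s, hs, h1, h2.congr fun k => eLpNorm_congr_ae ?_⟩
  filter_upwards [h] with ω hω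
  rw [hω]

theorem IsStochIntegral.integral_mul_conj (hZ : IsOrthogonalRandomMeasure P ν Z) {g g' : ℝ → ℂ}
    {X X' : Ω → ℂ} (h : IsStochIntegral P ν Z g X) (h' : IsStochIntegral P ν Z g' X') :
    ∫ ω, X ω * (starRingEnd ℂ) (X' ω) ∂P = ∫ l, g l * (starRingEnd ℂ) (g' l) ∂ν := by
  have := h'.inner_eq hZ h
  rwa [inner_toLp, inner_toLp] at this

/-- The mean is the inner product with the constant 1, hence continuous in mean square, and it
vanishes on simple integrals. -/
theorem IsStochIntegral.integral_eq_zero [IsFiniteMeasure P] (hZ : IsOrthogonalRandomMeasure P ν Z)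
    {g : ℝ → ℂ} {X : Ω → ℂ} (h : IsStochIntegral P ν Z g X) : ∫ ω, X ω ∂P = 0 := by
  obtain ⟨s, hs, -, h2⟩ := h.exists_tendsto hZ
  have h1 : MemLp (fun _ : Ω => (1 : ℂ)) 2 P := memLp_const 1
  have e := (tendsto_const_nhds (x := h1.toLp _)).inner (𝕜 := ℂ) h2
  simp_rw [inner_toLp] at e
  simp only [map_one, mul_one] at e
  refine tendsto_nhds_unique e ?_
  have h0 : ∀ k, ∫ ω, simpleIntegral Z (s k) ω ∂P = 0 := by
    intro k
    simp only [simpleIntegral]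
    rw [integral_finsetSum _ fun c _ =>
      (simpleIntegral_term_memLp hZ (hs k) c).integrable one_le_two]
    refine Finset.sum_eq_zero fun c _ => ?_
    by_cases hc : c = 0
    · simp [hc]
    rw [integral_const_mul, hZ.mean_zero _ ((s k).measurableSet_preimage _)
      ((s k).measure_preimage_lt_top_of_memLp two_ne_zero ENNReal.ofNat_ne_top (hs k) c hc),
      mul_zero]
  simp [h0]

/-- The integral of a Hermitian function against a white noise is real. -/
theorem IsGaussianWhiteNoise.conj_ae_eq {W : Set ℝ → Ω → ℂ} (hW : IsGaussianWhiteNoise P W)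
    {g : ℝ → ℂ} (hg : ∀ l, g (-l) = (starRingEnd ℂ) (g l)) {X : Ω → ℂ}
    (h : IsStochIntegral P volume W g X) : (fun ω => (starRingEnd ℂ) (X ω)) =ᵐ[P] X := by
  have hZ := hW.toIsOrthogonalRandomMeasure
  refine IsStochIntegral.unique hZ (g := g) ?_ h
  obtain ⟨hgm, hX, s, hs, h1, h2⟩ := h
  -- The reflected conjugates approximate the same g, since g is Hermitian, and their integrals are
  -- the conjugates of the original ones, since W(-S) = conj W(S). Thus conj X is also an integral
  -- of g, and uniqueness applies.
  set r : ℕ → SimpleFunc ℝ ℂ := fun k =>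
    ((s k).comp Neg.neg measurable_neg).map (starRingEnd ℂ) with hr
  have hrl : ∀ k l, r k l = (starRingEnd ℂ) (s k (-l)) := fun k l => rfl
  have hmp : MeasurePreserving (Neg.neg : ℝ → ℝ) volume volume :=
    Measure.measurePreserving_neg volume
  have hrm : ∀ k, MemLp (r k) 2 volume := fun k =>
    memLp_conj ((hs k).comp_measurePreserving hmp)
  refine ⟨hgm, memLp_conj hX, r, hrm, ?_, ?_⟩
  · refine h1.congr fun k => ?_
    have e1 : eLpNorm (fun l => r k l - g l) 2 volume =
        eLpNorm ((fun l => s k l - g l) ∘ Neg.neg) 2 volume := by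
      refine eLpNorm_congr_norm_ae (Eventually.of_forall fun l => ?_)
      have : r k l - g l = (starRingEnd ℂ) (s k (-l) - g (-l)) := by
        rw [hrl, map_sub, hg, Complex.conj_conj]
      rw [this, RCLike.norm_conj]
      rfl
    rw [e1, eLpNorm_comp_measurePreserving ?_ hmp]
    exact ((hs k).sub hgm).1
  · refine h2.congr fun k => ?_
    have e2 : ∀ᵐ ω ∂P, simpleIntegral W (r k) ω = (starRingEnd ℂ) (simpleIntegral W (s k) ω) := by
      have e3 : ∀ c ∈ (s k).range, ∀ᵐ ω ∂P,
          (starRingEnd ℂ) c * W (Neg.neg ⁻¹' (s k ⁻¹' {c})) ω =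
          (starRingEnd ℂ) (c * W (s k ⁻¹' {c}) ω) := by
        intro c _
        by_cases hc : c = 0
        · simp [hc]
        filter_upwards [hW.symm _ ((s k).measurableSet_preimage _)
          ((s k).measure_preimage_lt_top_of_memLp two_ne_zero ENNReal.ofNat_ne_top (hs k) c hc)]
          with ω hω
        rw [hω, map_mul]
      have e4 : ∀ᵐ ω ∂P, ∀ c ∈ (s k).range,
          (starRingEnd ℂ) c * W (Neg.neg ⁻¹' (s k ⁻¹' {c})) ω =
          (starRingEnd ℂ) (c * W (s k ⁻¹' {c}) ω) := by
        rw [Finset.eventually_all]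
        exact e3
      have hrange : (r k).range = (s k).range.image (starRingEnd ℂ) := by
        ext c
        simp only [SimpleFunc.mem_range, Finset.mem_image, Set.mem_range]
        constructor
        · rintro ⟨l, rfl⟩
          exact ⟨s k (-l), ⟨-l, rfl⟩, rfl⟩
        · rintro ⟨_, ⟨l, rfl⟩, rfl⟩
          exact ⟨-l, by rw [hrl, neg_neg]⟩
      filter_upwards [e4] with ω hω
      rw [simpleIntegral, simpleIntegral, map_sum, hrange,
        Finset.sum_image (fun a _ b _ hab => (starRingEnd ℂ).injective hab)]
      refine Finset.sum_congr rfl fun c hc => ?_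
      rw [← hω c hc]
      congr 2
      ext l
      simp only [Set.mem_preimage, Set.mem_singleton_iff, hrl]
      exact ⟨fun h => (starRingEnd ℂ).injective h, fun h => by rw [h]⟩
    refine eLpNorm_congr_norm_ae ?_
    filter_upwards [e2] with ω hω
    rw [hω, ← map_sub, RCLike.norm_conj]

end StochasticIntegral

/-! ### Gaussian processes under linear maps and mean-square limits -/

section Gaussian

variable {Ω : Type*} [MeasurableSpace Ω] {P : Measure Ω}

theorem tendsto_integral_of_tendsto_eLpNorm_two [IsProbabilityMeasure P] {X : ℕ → Ω → ℝ} {Y : Ω → ℝ}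
    (hX : ∀ k, MemLp (X k) 2 P) (hY : MemLp Y 2 P)
    (h : Tendsto (fun k => eLpNorm (X k - Y) 2 P) atTop (𝓝 0)) :
    Tendsto (fun k => ∫ ω, X k ω ∂P) atTop (𝓝 (∫ ω, Y ω ∂P)) := by
  refine tendsto_integral_of_L1' Y hY.1 (Eventually.of_forall fun k => (hX k).integrable one_le_two) ?_
  refine tendsto_of_tendsto_of_tendsto_of_le_of_le tendsto_const_nhds h (fun _ => zero_le)
    fun k => ?_
  exact eLpNorm_le_eLpNorm_of_exponent_le one_le_two ((hX k).sub hY).1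

theorem tendsto_variance_of_tendsto_eLpNorm_two [IsProbabilityMeasure P] {X : ℕ → Ω → ℝ} {Y : Ω → ℝ}
    (hX : ∀ k, MemLp (X k) 2 P) (hY : MemLp Y 2 P)
    (h : Tendsto (fun k => eLpNorm (X k - Y) 2 P) atTop (𝓝 0)) :
    Tendsto (fun k => Var[X k; P]) atTop (𝓝 Var[Y; P]) := by
  have h1 := tendsto_integral_of_tendsto_eLpNorm_two hX hY h
  have h2 := (Lp.tendsto_Lp_iff_tendsto_eLpNorm'' X hX Y hY).2 h
  have hin : ∀ {f : Ω → ℝ} (hf : MemLp f 2 P), ∫ ω, (f ^ 2) ω ∂P = ‖hf.toLp f‖ ^ 2 := by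
    intro f hf
    rw [← real_inner_self_eq_norm_sq, L2.inner_def]
    refine integral_congr_ae ?_
    filter_upwards [hf.coeFn_toLp] with ω hω
    rw [hω, RCLike.inner_apply, Pi.pow_apply, pow_two]
    rfl
  rw [variance_eq_sub hY, hin hY]
  refine ((h2.norm.pow 2).sub (h1.pow 2)).congr fun k => ?_
  rw [variance_eq_sub (hX k), hin (hX k)]

/-- A mean-square limit of Gaussian random variables is Gaussian. -/
theorem hasGaussianLaw_of_tendsto_eLpNorm [IsProbabilityMeasure P] {X : ℕ → Ω → ℝ} {Y : Ω → ℝ}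
    (hX : ∀ k, HasGaussianLaw (X k) P) (hY : MemLp Y 2 P)
    (h : Tendsto (fun k => eLpNorm (X k - Y) 2 P) atTop (𝓝 0)) : HasGaussianLaw Y P := by
  have hX2 : ∀ k, MemLp (X k) 2 P := fun k => (hX k).memLp_two
  -- Mean-square convergence gives weak convergence and convergence of mean and variance, on which a
  -- Gaussian characteristic function depends continuously; the two limits of characteristic
  -- functions must agree.
  rw [hasGaussianLaw_iff_charFun_map_eq hY.1.aemeasurable]
  intro t
  have hd := (tendstoInMeasure_of_tendsto_eLpNorm two_ne_zero (fun k => (hX2 k).1) hY.1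
    h).tendstoInDistribution_of_aemeasurable (fun k => (hX k).aemeasurable) hY.1.aemeasurable
  have h1 := ProbabilityMeasure.tendsto_iff_tendsto_charFun.1 hd.tendsto t
  have hX3 : ∀ k, MemLp (fun ω => inner ℝ t (X k ω)) 2 P := fun k => (hX2 k).const_inner t
  have hY3 : MemLp (fun ω => inner ℝ t (Y ω)) 2 P := hY.const_inner t
  have h3 : Tendsto (fun k => eLpNorm ((fun ω => inner ℝ t (X k ω)) - fun ω => inner ℝ t (Y ω)) 2 P)
      atTop (𝓝 0) := by
    have h4 : ∀ k, eLpNorm ((fun ω => inner ℝ t (X k ω)) - fun ω => inner ℝ t (Y ω)) 2 P =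
        ‖t‖ₑ * eLpNorm (X k - Y) 2 P := by
      intro k
      rw [← eLpNorm_const_smul]
      refine eLpNorm_congr_ae (Eventually.of_forall fun ω => ?_)
      simp only [Pi.sub_apply, Pi.smul_apply, smul_eq_mul, RCLike.inner_apply, conj_trivial]
      ring
    simp_rw [h4]
    have := ENNReal.Tendsto.const_mul h (a := ‖t‖ₑ) (Or.inr enorm_ne_top)
    simpa using this
  have hm := tendsto_integral_of_tendsto_eLpNorm_two hX3 hY3 h3
  have hv := tendsto_variance_of_tendsto_eLpNorm_two hX3 hY3 h3
  refine tendsto_nhds_unique h1 ?_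
  have h5 : ∀ k, charFun (P.map (X k)) t = _ := fun k => (hX k).charFun_map_eq t
  simp only [ProbabilityMeasure.coe_mk, h5]
  refine (Complex.continuous_exp.tendsto _).comp ?_
  refine Tendsto.sub (Tendsto.mul_const _ ?_) (Tendsto.div_const ?_ _)
  · exact (Complex.continuous_ofReal.tendsto _).comp hm
  · exact (Complex.continuous_ofReal.tendsto _).comp hv

variable {T : Type*}

theorem exists_continuousLinearMap_pi_apply {ι : Type*} [Fintype ι] (L : (ι → ℝ) →L[ℝ] ℝ) :
    ∃ c : ι → ℝ, ∀ x, L x = ∑ i, x i * c i := by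
  classical
  refine ⟨fun i => L (fun j => if i = j then 1 else 0), fun x => ?_⟩
  conv_lhs => rw [pi_eq_sum_univ x]
  rw [map_sum]
  exact Finset.sum_congr rfl fun i _ => by rw [map_smul, smul_eq_mul]

/-- A mean-square limit of Gaussian processes is Gaussian. -/
theorem isGaussianProcess_of_tendsto_eLpNorm [IsProbabilityMeasure P] {X : ℕ → T → Ω → ℝ}
    {Y : T → Ω → ℝ} (hX : ∀ k, IsGaussianProcess (X k) P) (hY : ∀ τ, MemLp (Y τ) 2 P)
    (h : ∀ τ, Tendsto (fun k => eLpNorm (X k τ - Y τ) 2 P) atTop (𝓝 0)) :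
    IsGaussianProcess Y P where
  hasGaussianLaw I := by
    have hm : AEMeasurable (fun ω => I.restrict (Y · ω)) P :=
      aemeasurable_pi_lambda _ fun i => (hY i).1.aemeasurable
    -- A vector is Gaussian once all its linear functionals are, which reduces the claim to real
    -- random variables.
    refine ⟨isGaussian_of_map_eq_gaussianReal fun L => ?_⟩
    obtain ⟨a, ha⟩ := exists_continuousLinearMap_pi_apply L
    have hg : HasGaussianLaw (fun ω => L (I.restrict (Y · ω))) P := by
      refine hasGaussianLaw_of_tendsto_eLpNorm (X := fun k ω => L (I.restrict (X k · ω)))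
        (fun k => ((hX k).hasGaussianLaw I).map_fun L) ?_ ?_
      · simp_rw [ha]
        exact memLp_finsetSum _ fun i _ => (hY i).mul_const _
      · have hb : ∀ k, eLpNorm ((fun ω => L (I.restrict (X k · ω))) - fun ω => L (I.restrict (Y · ω)))
            2 P ≤ ∑ i : I, ‖a i‖ₑ * eLpNorm (X k i - Y i) 2 P := by
          intro k
          have e1 : ((fun ω => L (I.restrict (X k · ω))) - fun ω => L (I.restrict (Y · ω))) =
              ∑ i : I, a i • (X k i - Y i) := by
            ext ω
            simp only [Pi.sub_apply, Finset.sum_apply, Pi.smul_apply, smul_eq_mul]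
            rw [← map_sub, ha]
            refine Finset.sum_congr rfl fun i _ => ?_
            simp [mul_comm]
          rw [e1]
          refine (eLpNorm_sum_le (fun i _ => ?_) one_le_two).trans
            (Finset.sum_le_sum fun i _ => ?_)
          · exact ((((hX k).hasGaussianLaw_eval i).memLp_two.sub (hY i)).1).const_smul _
          · rw [eLpNorm_const_smul]
        refine tendsto_of_tendsto_of_tendsto_of_le_of_le tendsto_const_nhds ?_
          (fun _ => zero_le) hb
        have h0 : (0 : ℝ≥0∞) = ∑ i : I, ‖a i‖ₑ * 0 := by simp
        rw [h0]
        exact tendsto_finsetSum _ fun i _ => ENNReal.Tendsto.const_mul (h i) (Or.inr enorm_ne_top)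
    have h1 := hg.map_eq_gaussianReal
    exact ⟨_, _, (AEMeasurable.map_map_of_aemeasurable L.continuous.aemeasurable hm).trans h1⟩

/-- The number of summands may depend on the index, as it does for real parts of simple integrals
and for trigonometric approximations. -/
theorem isGaussianProcess_finsetSum {S : Type*} {E : Type*} [NormedAddCommGroup E] [NormedSpace ℝ E]
    [MeasurableSpace E] [BorelSpace E] [SecondCountableTopology E] {X : T → Ω → E}
    (hX : IsGaussianProcess X P) (ι : S → Type*) [∀ s, Fintype (ι s)] (τ : ∀ s, ι s → T)
    (L : ∀ s, ι s → E →L[ℝ] ℝ) :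
    IsGaussianProcess (fun s ω => ∑ i, L s i (X (τ s i) ω)) P := by
  classical
  refine hX.of_isGaussianProcess fun s => ⟨Finset.univ.image (τ s),
    ∑ i : ι s, (L s i).comp (ContinuousLinearMap.proj
      (⟨τ s i, Finset.mem_image_of_mem _ (Finset.mem_univ i)⟩ : Finset.univ.image (τ s))),
    fun ω => ?_⟩
  simp

theorem IsStochIntegral.memLp_real {ν : Measure ℝ} {Z : Set ℝ → Ω → ℂ} {g : ℝ → ℂ} {Y : Ω → ℝ}
    (h : IsStochIntegral P ν Z g (fun ω => (Y ω : ℂ))) : MemLp Y 2 P := by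
  simpa using h.memLp.re

theorem eLpNorm_re_sub_le {X : Ω → ℂ} {Y : Ω → ℝ} :
    eLpNorm ((fun ω => (X ω).re) - Y) 2 P ≤ eLpNorm (fun ω => X ω - (Y ω : ℂ)) 2 P := by
  refine eLpNorm_mono fun ω => ?_
  have : ((fun ω => (X ω).re) - Y) ω = (X ω - (Y ω : ℂ)).re := by simp
  rw [this, Real.norm_eq_abs]
  exact Complex.abs_re_le_norm _

/-- Real parts of simple integrals are real-linear images of finitely many values of the noise, and
they converge in mean square to `Y`. -/
theorem IsGaussianWhiteNoise.isGaussianProcess [IsProbabilityMeasure P] {W : Set ℝ → Ω → ℂ}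
    (hW : IsGaussianWhiteNoise P W) {g : T → ℝ → ℂ} {Y : T → Ω → ℝ}
    (h : ∀ τ, IsStochIntegral P volume W (g τ) (fun ω => (Y τ ω : ℂ))) :
    IsGaussianProcess Y P := by
  choose s hs h1 h2 using fun τ => (h τ).2.2
  refine isGaussianProcess_of_tendsto_eLpNorm (X := fun k τ ω => (simpleIntegral W (s τ k) ω).re)
    (fun k => ?_) (fun τ => (h τ).memLp_real) fun τ => ?_
  -- The value 0 is discarded: its level set can have infinite measure and then is no index of the
  -- Gaussian process.
  · have hlt : ∀ τ (c : {c // c ∈ (s τ k).range ∧ c ≠ 0}), volume (s τ k ⁻¹' {c.1}) < ∞ :=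
      fun τ c => (s τ k).measure_preimage_lt_top_of_memLp two_ne_zero
        ENNReal.ofNat_ne_top (hs τ k) c.1 c.2.2
    have hfin : ∀ τ, Fintype {c // c ∈ (s τ k).range ∧ c ≠ 0} := fun τ =>
      @Fintype.ofFinite _ (((s τ k).range.finite_toSet.subset fun c hc => hc.1).to_subtype)
    have hG := isGaussianProcess_finsetSum hW.gaussian
      (fun τ => {c // c ∈ (s τ k).range ∧ c ≠ 0})
      (fun τ c => ⟨s τ k ⁻¹' {c.1}, (s τ k).measurableSet_preimage _, hlt τ c⟩)
      (fun τ c => Complex.reCLM.comp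
        ((ContinuousLinearMap.mul ℂ ℂ c.1).restrictScalars ℝ))
    convert! hG using 3 with τ ω
    simp only [simpleIntegral, ContinuousLinearMap.comp_apply, Complex.reCLM_apply,
      ContinuousLinearMap.coe_restrictScalars', ContinuousLinearMap.mul_apply']
    rw [← Complex.re_sum]
    congr 1
    rw [← Finset.sum_filter_add_sum_filter_not (s τ k).range (fun c => c ≠ 0)]
    have hz : ∑ c ∈ (s τ k).range with ¬ c ≠ 0, c * W (s τ k ⁻¹' {c}) ω = 0 := by
      refine Finset.sum_eq_zero fun c hc => ?_
      have := (Finset.mem_filter.1 hc).2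
      push Not at this
      rw [this, zero_mul]
    rw [hz, add_zero]
    exact Finset.sum_subtype _ (fun c => by simp [Finset.mem_filter])
      (fun c => c * W (s τ k ⁻¹' {c}) ω)
  · exact tendsto_of_tendsto_of_tendsto_of_le_of_le tendsto_const_nhds (h2 τ)
      (fun _ => zero_le) fun k => eLpNorm_re_sub_le

end Gaussian

/-! ### Density of trigonometric polynomials and Gaussianity of linear filters -/

section Density

/-- The finite measures f⁺ dF and f⁻ dF have the same characteristic function, so they coincide. -/
theorem ae_eq_zero_of_integral_exp_eq_zero {F : Measure ℝ} {f : ℝ → ℝ}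
    (hf : Integrable f F)
    (h : ∀ x : ℝ, ∫ l, Complex.exp (x * l * Complex.I) * (f l : ℂ) ∂F = 0) : f =ᵐ[F] 0 := by
  have hfin1 : IsFiniteMeasure (F.withDensity fun l => ENNReal.ofReal (f l)) :=
    isFiniteMeasure_withDensity_ofReal hf.2
  have hfin2 : IsFiniteMeasure (F.withDensity fun l => ENNReal.ofReal (-f l)) :=
    isFiniteMeasure_withDensity_ofReal hf.neg.2
  have hexp : ∀ x l : ℝ, ‖Complex.exp (x * l * Complex.I)‖ = 1 := fun x l => by
    rw [← Complex.ofReal_mul]; exact Complex.norm_exp_ofReal_mul_I _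
  have hsm : ∀ (x : ℝ) {p : ℝ → ℝ}, Integrable p F →
      Integrable (fun l : ℝ => p l • Complex.exp (x * l * Complex.I)) F := by
    intro x p hp
    refine hp.smul_bdd 1 (Continuous.aestronglyMeasurable (by fun_prop))
      (Eventually.of_forall fun l => (hexp x l).le)
  have hm1 := hf.1.aemeasurable.ennreal_ofReal
  have hm2 : AEMeasurable (fun l => ENNReal.ofReal (-f l)) F :=
    hf.neg.1.aemeasurable.ennreal_ofReal
  have heq : F.withDensity (fun l => ENNReal.ofReal (f l)) =
      F.withDensity (fun l => ENNReal.ofReal (-f l)) := by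
    refine Measure.ext_of_charFun (funext fun x => ?_)
    rw [charFun_apply_real, charFun_apply_real,
      integral_withDensity_eq_integral_toReal_smul₀ hm1 (by simp),
      integral_withDensity_eq_integral_toReal_smul₀ hm2 (by simp), ← sub_eq_zero,
      ← integral_sub]
    · rw [← h x]
      congr 1
      ext l
      rw [ENNReal.toReal_ofReal', ENNReal.toReal_ofReal', ← sub_smul, max_zero_sub_eq_self,
        Complex.real_smul, mul_comm]
    · simp_rw [ENNReal.toReal_ofReal']
      exact hsm x hf.pos_part
    · simp_rw [ENNReal.toReal_ofReal']
      exact hsm x hf.neg_part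
  have h2 := (withDensity_eq_iff hm1 hm2 hf.lintegral_lt_top.ne).1 heq
  filter_upwards [h2] with l hl
  rcases le_total 0 (f l) with h0 | h0
  · rw [ENNReal.ofReal_of_nonpos (by linarith : -f l ≤ 0), ENNReal.ofReal_eq_zero] at hl
    exact le_antisymm hl h0
  · rw [ENNReal.ofReal_of_nonpos h0, eq_comm, ENNReal.ofReal_eq_zero] at hl
    exact le_antisymm h0 (neg_nonpos.1 hl)

theorem memLp_exp_two {F : Measure ℝ} [IsFiniteMeasure F] (x : ℝ) :
    MemLp (fun l : ℝ => Complex.exp (Complex.I * (l * x : ℝ))) 2 F := by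
  refine MemLp.of_bound (Continuous.aestronglyMeasurable (by fun_prop)) 1
    (Eventually.of_forall fun l => ?_)
  rw [mul_comm, Complex.norm_exp_ofReal_mul_I]

/-- Trigonometric polynomials are dense in the square-integrable functions. -/
theorem topologicalClosure_span_exp_eq_top (F : Measure ℝ) [IsFiniteMeasure F] :
    (Submodule.span ℂ (Set.range fun x : ℝ =>
      (memLp_exp_two (F := F) x).toLp _)).topologicalClosure = ⊤ := by
  rw [Submodule.topologicalClosure_eq_top_iff, Submodule.eq_bot_iff]
  intro h hh
  have hmem := Lp.memLp h
  have hint : Integrable (h : ℝ → ℂ) F := hmem.integrable one_le_two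
  have h1 : ∀ x : ℝ, ∫ l, Complex.exp (x * l * Complex.I) * h l ∂F = 0 := by
    intro x
    have h2 := (Submodule.mem_orthogonal _ _).1 hh _ (Submodule.subset_span ⟨-x, rfl⟩)
    have h3 := inner_toLp (memLp_exp_two (F := F) (-x)) hmem
    rw [Lp.toLp_coeFn, h2] at h3
    rw [h3]
    congr 1
    ext l
    rw [← Complex.exp_conj, mul_comm]
    congr 2
    simp
    ring
  -- The set of frequencies is symmetric, so conj h is also orthogonal to all exponentials; hence so
  -- are the real and imaginary parts, to which the real-valued lemma applies.
  have h4 : ∀ x : ℝ, ∫ l, Complex.exp (x * l * Complex.I) * (starRingEnd ℂ) (h l) ∂F = 0 := by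
    intro x
    have h5 := congrArg (starRingEnd ℂ) (h1 (-x))
    rw [← integral_conj, map_zero] at h5
    rw [← h5]
    congr 1
    ext l
    rw [map_mul, ← Complex.exp_conj]
    congr 2
    simp
  have hexpm : ∀ (x : ℝ) {f : ℝ → ℂ}, Integrable f F →
      Integrable (fun l : ℝ => Complex.exp (x * l * Complex.I) * f l) F := by
    intro x f hf
    refine hf.bdd_mul (c := 1) (Continuous.aestronglyMeasurable (by fun_prop))
      (Eventually.of_forall fun l => ?_)
    rw [← Complex.ofReal_mul, Complex.norm_exp_ofReal_mul_I]
  have hconj : Integrable (fun l => (starRingEnd ℂ) (h l)) F :=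
    (memLp_conj hmem).integrable one_le_two
  have hre := ae_eq_zero_of_integral_exp_eq_zero (f := fun l => (h l).re) hint.re fun x => by
    have e1 : ∀ l : ℝ, Complex.exp (x * l * Complex.I) * ((h l).re : ℂ) = (2 : ℂ)⁻¹ *
        (Complex.exp (x * l * Complex.I) * h l +
          Complex.exp (x * l * Complex.I) * (starRingEnd ℂ) (h l)) := by
      intro l
      rw [Complex.re_eq_add_conj]
      ring
    simp_rw [e1]
    rw [integral_const_mul, integral_add (hexpm x hint) (hexpm x hconj), h1, h4]
    simp
  have him := ae_eq_zero_of_integral_exp_eq_zero (f := fun l => (h l).im) hint.im fun x => by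
    have e1 : ∀ l : ℝ, Complex.exp (x * l * Complex.I) * ((h l).im : ℂ) = (2 * Complex.I)⁻¹ *
        (Complex.exp (x * l * Complex.I) * h l -
          Complex.exp (x * l * Complex.I) * (starRingEnd ℂ) (h l)) := by
      intro l
      rw [Complex.im_eq_sub_conj]
      field_simp
    simp_rw [e1]
    rw [integral_const_mul, integral_sub (hexpm x hint) (hexpm x hconj), h1, h4]
    simp
  rw [Lp.eq_zero_iff_ae_eq_zero]
  filter_upwards [hre, him] with l h5 h6
  exact Complex.ext h5 h6

variable {Ω : Type*} [MeasurableSpace Ω] {P : Measure Ω} {T : Type*}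

/-- Linear filters of a Gaussian process form a Gaussian process. -/
theorem isGaussianProcess_of_hasSpectralRep [IsProbabilityMeasure P] {F : Measure ℝ}
    [IsFiniteMeasure F] {Z : Set ℝ → Ω → ℂ} (hZ : IsOrthogonalRandomMeasure P F Z)
    {ξ : ℝ → Ω → ℝ} (hξ : IsGaussianProcess ξ P) (hrep : HasSpectralRep P F Z (fun _ => 1) ξ)
    {g : T → ℝ → ℂ} {Y : T → Ω → ℝ}
    (h : ∀ τ, IsStochIntegral P F Z (g τ) (fun ω => (Y τ ω : ℂ))) :
    IsGaussianProcess Y P := by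
  obtain ⟨J, hJ⟩ := exists_linearIsometry_stochIntegral hZ
  have hrep' : ∀ x, IsStochIntegral P F Z (fun l => Complex.exp (Complex.I * (l * x : ℝ)))
      (fun ω => (ξ x ω : ℂ)) := fun x => by simpa using hrep x
  -- The isometry sends the exponential of frequency x to ξ(x), so a trigonometric polynomial near
  -- the transfer function becomes a combination of values of ξ near `Y τ`.
  have happ : ∀ τ (k : ℕ), ∃ c : ℝ →₀ ℂ, ‖(c.sum fun x a => a • (hrep' x).memLp.toLp _) -
      (h τ).memLp.toLp _‖ < 1 / ((k : ℝ) + 1) := by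
    intro τ k
    have h1 : (h τ).memLp_integrand.toLp _ ∈ (Submodule.span ℂ (Set.range fun x : ℝ =>
      (memLp_exp_two (F := F) x).toLp _)).topologicalClosure := by
      rw [topologicalClosure_span_exp_eq_top]; trivial
    obtain ⟨p, hp, hd⟩ := Metric.mem_closure_iff.1 h1 (1 / ((k : ℝ) + 1)) (by positivity)
    obtain ⟨c, rfl⟩ := Finsupp.mem_span_range_iff_exists_finsupp.1 hp
    refine ⟨c, ?_⟩
    rw [dist_comm, dist_eq_norm, ← J.norm_map, map_sub, hJ _ _ (h τ), Finsupp.sum, map_sum] at hd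
    convert! hd using 3
    refine Finset.sum_congr rfl fun x _ => ?_
    rw [map_smul]
    refine congrArg (c x • ·) ?_
    exact (hJ _ _ (hrep' x)).symm
  choose c hc using happ
  -- The coefficients are complex, but ξ and `Y` are real: taking real parts keeps a linear
  -- combination of ξ and does not increase the error.
  refine isGaussianProcess_of_tendsto_eLpNorm
    (X := fun k τ ω => ∑ x : (c τ k).support, ((c τ k) x).re * ξ x ω)
    (fun k => ?_) (fun τ => (h τ).memLp_real) fun τ => ?_
  · exact isGaussianProcess_finsetSum hξ (fun τ => (c τ k).support) (fun τ x => x)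
      (fun τ x => ContinuousLinearMap.mul ℝ ℝ ((c τ k) x).re)
  · have h3 : Tendsto (fun k : ℕ => ENNReal.ofReal (1 / ((k : ℝ) + 1))) atTop (𝓝 0) := by
      rw [← ENNReal.ofReal_zero]
      exact ENNReal.tendsto_ofReal tendsto_one_div_add_atTop_nhds_zero_nat
    refine tendsto_of_tendsto_of_tendsto_of_le_of_le tendsto_const_nhds h3
      (fun _ => zero_le) fun k => ?_
    have hml : ∀ x, MemLp (fun ω => (c τ k) x * (ξ x ω : ℂ)) 2 P := fun x =>
      (hrep' x).memLp.const_mul _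
    have hsum : MemLp (fun ω => ∑ x ∈ (c τ k).support, (c τ k) x * (ξ x ω : ℂ)) 2 P :=
      memLp_finsetSum _ fun x _ => hml x
    have e1 : (fun ω => ∑ x : (c τ k).support, ((c τ k) x).re * ξ x ω) =
        fun ω => (∑ x ∈ (c τ k).support, (c τ k) x * (ξ x ω : ℂ)).re := by
      ext ω
      rw [Complex.re_sum, ← Finset.sum_coe_sort (c τ k).support]
      refine Finset.sum_congr rfl fun x _ => ?_
      simp
    simp only [e1]
    refine eLpNorm_re_sub_le.trans ?_
    have e2 : ‖hsum.toLp _ - (h τ).memLp.toLp _‖ < 1 / ((k : ℝ) + 1) := by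
      convert! hc τ k using 3
      rw [Finsupp.sum]
      refine Lp.ext ?_
      have e3 := Lp.coeFn_finsetSum (c τ k).support
        (fun x => (c τ k) x • (hrep' x).memLp.toLp _)
      have e4 : ∀ᵐ ω ∂P, ∀ x ∈ (c τ k).support,
          ((c τ k) x • (hrep' x).memLp.toLp _ : Lp ℂ 2 P) ω = (c τ k) x * (ξ x ω : ℂ) := by
        rw [Finset.eventually_all]
        intro x _
        filter_upwards [Lp.coeFn_smul ((c τ k) x) ((hrep' x).memLp.toLp _),
          (hrep' x).memLp.coeFn_toLp] with ω h5 h6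
        rw [h5, Pi.smul_apply, h6, smul_eq_mul]
      filter_upwards [e3, e4, hsum.coeFn_toLp] with ω h5 h6 h7
      rw [h7, h5, Finset.sum_apply]
      exact Finset.sum_congr rfl fun x hx => (h6 x hx).symm
    rw [← MemLp.toLp_sub, Lp.norm_toLp] at e2
    have hfin : eLpNorm (fun ω => (∑ x ∈ (c τ k).support, (c τ k) x * (ξ x ω : ℂ)) -
      (Y τ ω : ℂ)) 2 P ≠ ∞ := (hsum.sub (h τ).memLp).2.ne
    rw [← ENNReal.ofReal_toReal hfin]
    exact ENNReal.ofReal_le_ofReal e2.le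

end Density

/-! ### Weak convergence of Gaussian vectors from their covariances -/

section GaussianConvergence

variable {Ω Ω' : Type*} [MeasurableSpace Ω] [MeasurableSpace Ω'] {P : Measure Ω} {P' : Measure Ω'}
  [IsProbabilityMeasure P] [IsProbabilityMeasure P']

/-- The characteristic function of a centred Gaussian vector. -/
theorem charFun_toLp_map_eq {k : ℕ} {X : Fin k → Ω → ℝ}
    (hX : HasGaussianLaw (fun ω j => X j ω) P) (hX0 : ∀ j, ∫ ω, X j ω ∂P = 0)
    (t : EuclideanSpace ℝ (Fin k)) :
    charFun (P.map (fun ω => (EuclideanSpace.equiv (Fin k) ℝ).symm (fun j => X j ω))) t =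
      Complex.exp (-((∑ a, ∑ b, t a * (t b * cov[X a, X b; P]) : ℝ) : ℂ) / 2) := by
  have hXm : ∀ j, MemLp (X j) 2 P := fun j =>
    (hX.map_fun (ContinuousLinearMap.proj (R := ℝ) (φ := fun _ : Fin k => ℝ) j)).memLp_two
  have hG := hX.map_equiv_fun (EuclideanSpace.equiv (Fin k) ℝ).symm
  rw [hG.charFun_map_eq t]
  have h0 : ∀ ω, inner ℝ t ((EuclideanSpace.equiv (Fin k) ℝ).symm (fun j => X j ω)) =
      ∑ j, t j * X j ω := by
    intro ω
    rw [PiLp.inner_apply]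
    exact Finset.sum_congr rfl fun j _ => by simp [mul_comm]
  have h1 : (fun ω => inner ℝ t ((EuclideanSpace.equiv (Fin k) ℝ).symm (fun j => X j ω))) =
      ∑ j, fun ω => t j * X j ω := by
    ext ω
    rw [h0, Finset.sum_apply]
  have h2 : ∫ ω, inner ℝ t ((EuclideanSpace.equiv (Fin k) ℝ).symm (fun j => X j ω)) ∂P = 0 := by
    simp_rw [h0]
    rw [integral_finsetSum _ fun j _ => ((hXm j).const_mul _).integrable one_le_two]
    simp [integral_const_mul, hX0]
  rw [h2, h1, variance_sum' fun j _ => (hXm j).const_mul _]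
  simp_rw [covariance_const_mul_left, covariance_const_mul_right]
  simp [neg_div]

/-- Centred Gaussian vectors converge in distribution when their covariances converge. -/
theorem tendstoInDistribution_of_tendsto_covariance {ι : Type*} {l : Filter ι}
    [l.IsCountablyGenerated] {k : ℕ} {X : ι → Fin k → Ω → ℝ} {U : Fin k → Ω' → ℝ}
    (hX : ∀ i, HasGaussianLaw (fun ω j => X i j ω) P) (hU : HasGaussianLaw (fun ω j => U j ω) P')
    (hX0 : ∀ i j, ∫ ω, X i j ω ∂P = 0) (hU0 : ∀ j, ∫ ω, U j ω ∂P' = 0)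
    (hcov : ∀ a b, Tendsto (fun i => cov[X i a, X i b; P]) l (𝓝 cov[U a, U b; P'])) :
    TendstoInDistribution (fun i ω j => X i j ω) l (fun ω j => U j ω) (fun _ => P) P' := by
  -- Characteristic functions need the Euclidean inner product, so the vectors are moved to
  -- `EuclideanSpace` and brought back by a continuous map.
  have key : TendstoInDistribution
      (fun i ω => (EuclideanSpace.equiv (Fin k) ℝ).symm (fun j => X i j ω)) l
      (fun ω => (EuclideanSpace.equiv (Fin k) ℝ).symm (fun j => U j ω)) (fun _ => P) P' := by
    refine ⟨fun i => ((hX i).map_equiv_fun _).aemeasurable, (hU.map_equiv_fun _).aemeasurable, ?_⟩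
    -- Lévy's continuity theorem is used along sequences, which suffices for a countably generated
    -- filter.
    refine tendsto_iff_seq_tendsto.2 fun x hx => ?_
    refine ProbabilityMeasure.tendsto_iff_tendsto_charFun.2 fun t => ?_
    change Tendsto (fun n => charFun (P.map (fun ω =>
      (EuclideanSpace.equiv (Fin k) ℝ).symm (fun j => X (x n) j ω))) t) atTop
      (𝓝 (charFun (P'.map (fun ω => (EuclideanSpace.equiv (Fin k) ℝ).symm (fun j => U j ω))) t))
    rw [charFun_toLp_map_eq hU hU0]
    simp_rw [fun n => charFun_toLp_map_eq (hX (x n)) (hX0 (x n))]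
    refine (Complex.continuous_exp.tendsto _).comp (Tendsto.div_const (Tendsto.neg ?_) _)
    refine (Complex.continuous_ofReal.tendsto _).comp ?_
    exact tendsto_finsetSum _ fun a _ => tendsto_finsetSum _ fun b _ =>
      (((hcov a b).comp hx).const_mul _).const_mul _
  exact key.continuous_comp (EuclideanSpace.equiv (Fin k) ℝ).continuous

end GaussianConvergence

/-! ### Signed combinations of spectral measures -/

section SignedMixture

/-- The weights may be negative. Moving the negative parts to the left gives F + ∑ A⁻ M and ∑ A⁺ M,
two positive finite measures with the same characteristic function, hence equal. -/
theorem integral_eq_sum_of_charFun_eq_sum {F : Measure ℝ} [IsFiniteMeasure F] {ι : Type*} [Fintype ι]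
    {M : ι → Measure ℝ} [∀ j, IsFiniteMeasure (M j)] {A : ι → ℝ}
    (h : ∀ x, charFun F x = ∑ j, (A j : ℂ) * charFun (M j) x) {φ : ℝ → ℂ} (hφ : Measurable φ)
    {C : ℝ} (hC : ∀ l, ‖φ l‖ ≤ C) :
    ∫ l, φ l ∂F = ∑ j, (A j : ℂ) * ∫ l, φ l ∂(M j) := by
  have hint : ∀ (ρ : Measure ℝ) [IsFiniteMeasure ρ] {ψ : ℝ → ℂ}, Measurable ψ → ∀ {C : ℝ},
      (∀ l, ‖ψ l‖ ≤ C) → Integrable ψ ρ := fun ρ _ ψ hψ C hC =>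
    Integrable.of_bound hψ.aestronglyMeasurable C (Eventually.of_forall hC)
  have hsum : ∀ (B : ι → NNReal) {ψ : ℝ → ℂ}, Measurable ψ → ∀ {C : ℝ}, (∀ l, ‖ψ l‖ ≤ C) →
      ∫ l, ψ l ∂(∑ j, B j • M j) = ∑ j, ((B j : ℝ) : ℂ) * ∫ l, ψ l ∂(M j) := by
    intro B ψ hψ C hC
    rw [integral_finsetSum_measure fun j _ => hint _ hψ hC]
    refine Finset.sum_congr rfl fun j _ => ?_
    rw [integral_smul_nnreal_measure]
    rfl
  set Ap : ι → NNReal := fun j => (A j).toNNReal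
  set An : ι → NNReal := fun j => (-A j).toNNReal
  have hA : ∀ j, (A j : ℂ) = ((Ap j : ℝ) : ℂ) - ((An j : ℝ) : ℂ) := by
    intro j
    rw [← Complex.ofReal_sub]
    congr 1
    simp only [Ap, An, Real.coe_toNNReal']
    exact (max_zero_sub_eq_self _).symm
  have hall : ∀ {ψ : ℝ → ℂ}, Measurable ψ → ∀ {C : ℝ}, (∀ l, ‖ψ l‖ ≤ C) →
      ∫ l, ψ l ∂(F + ∑ j, An j • M j) =
        ∫ l, ψ l ∂F + ∑ j, ((An j : ℝ) : ℂ) * ∫ l, ψ l ∂(M j) := by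
    intro ψ hψ C hC
    rw [integral_add_measure (hint _ hψ hC) (hint _ hψ hC), hsum An hψ hC]
  have hmeas : F + ∑ j, An j • M j = ∑ j, Ap j • M j := by
    refine Measure.ext_of_charFun (funext fun x => ?_)
    have hm : Measurable fun l : ℝ => Complex.exp (x * l * Complex.I) := by fun_prop
    have hb : ∀ l : ℝ, ‖Complex.exp (x * l * Complex.I)‖ ≤ 1 := fun l => by
      rw [← Complex.ofReal_mul, Complex.norm_exp_ofReal_mul_I]
    have hx := h x
    simp only [charFun_apply_real] at hx ⊢
    rw [hall hm hb, hsum Ap hm hb, hx, ← Finset.sum_add_distrib]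
    refine Finset.sum_congr rfl fun j _ => ?_
    rw [hA]
    ring
  have h1 := hall hφ hC
  rw [hmeas, hsum Ap hφ hC] at h1
  rw [← sub_eq_iff_eq_add.2 h1, ← Finset.sum_sub_distrib]
  refine Finset.sum_congr rfl fun j _ => ?_
  rw [hA]
  ring

end SignedMixture

/-! ### The spectral density of (1 + x²)^(-κ/2) and its singularity -/

section BesselDensity

/-- The integrand of the heat-kernel representation of the spectral density of
`(1 + x²) ^ (-κ/2)`. -/
noncomputable def besselKernel (κ s l : ℝ) : ℝ :=
  s ^ (κ / 2 - 1) * Real.exp (-s) * ((√(4 * Real.pi * s))⁻¹ * Real.exp (-l ^ 2 / (4 * s)))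

/-- The spectral density of the covariance function `(1 + x²) ^ (-κ/2)`. -/
noncomputable def besselDensity (κ l : ℝ) : ℝ :=
  (Real.Gamma (κ / 2))⁻¹ * ∫ s in Set.Ioi (0 : ℝ), besselKernel κ s l

theorem heatKernel_eq_gaussianPDFReal {s : ℝ} (hs : 0 < s) (l : ℝ) :
    (√(4 * Real.pi * s))⁻¹ * Real.exp (-l ^ 2 / (4 * s)) = gaussianPDFReal 0 (2 * s).toNNReal l := by
  rw [gaussianPDFReal, Real.coe_toNNReal _ (by positivity), sub_zero,
    show 2 * Real.pi * (2 * s) = 4 * Real.pi * s by ring, show 2 * (2 * s) = 4 * s by ring]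

theorem besselKernel_nonneg (κ : ℝ) {s : ℝ} (hs : 0 < s) (l : ℝ) : 0 ≤ besselKernel κ s l := by
  unfold besselKernel
  positivity

theorem measurable_besselKernel (κ : ℝ) :
    Measurable (Function.uncurry (besselKernel κ)) := by
  unfold besselKernel Function.uncurry
  fun_prop

theorem measurable_besselDensity (κ : ℝ) : Measurable (besselDensity κ) := by
  unfold besselDensity
  refine Measurable.const_mul ?_ _
  have h : StronglyMeasurable fun p : ℝ × ℝ => besselKernel κ p.2 p.1 :=
    ((measurable_besselKernel κ).comp measurable_swap).stronglyMeasurable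
  exact h.integral_prod_right.measurable

theorem besselDensity_nonneg {κ : ℝ} (hκ : 0 < κ) (l : ℝ) : 0 ≤ besselDensity κ l := by
  have := Real.Gamma_pos_of_pos (half_pos hκ)
  refine mul_nonneg (by positivity) ?_
  exact setIntegral_nonneg measurableSet_Ioi fun s hs => besselKernel_nonneg κ hs l

theorem integrable_besselKernel {κ : ℝ} (hκ : 0 < κ) :
    Integrable (Function.uncurry (besselKernel κ)) ((volume.restrict (Set.Ioi 0)).prod volume) := by
  rw [integrable_prod_iff (measurable_besselKernel κ).aestronglyMeasurable]
  have hpos : ∀ᵐ s ∂(volume.restrict (Set.Ioi (0 : ℝ))), 0 < s := ae_restrict_mem measurableSet_Ioi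
  constructor
  · filter_upwards [hpos] with s hs
    have h := (integrable_gaussianPDFReal 0 (2 * s).toNNReal).const_mul
      (s ^ (κ / 2 - 1) * Real.exp (-s))
    refine h.congr (Eventually.of_forall fun l => ?_)
    simp only [Function.uncurry, besselKernel]
    rw [heatKernel_eq_gaussianPDFReal hs]
  · have h : IntegrableOn (fun s => Real.exp (-s) * s ^ (κ / 2 - 1)) (Set.Ioi 0) :=
      Real.GammaIntegral_convergent (half_pos hκ)
    refine h.congr ?_
    filter_upwards [hpos] with s hs
    have h1 : ∀ l, ‖Function.uncurry (besselKernel κ) (s, l)‖ =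
        s ^ (κ / 2 - 1) * Real.exp (-s) * gaussianPDFReal 0 (2 * s).toNNReal l := by
      intro l
      rw [Function.uncurry_apply_pair, Real.norm_of_nonneg (besselKernel_nonneg κ hs l), ← heatKernel_eq_gaussianPDFReal hs]
      rfl
    simp_rw [h1]
    rw [integral_const_mul, integral_gaussianPDFReal_eq_one, mul_one, mul_comm]
    simpa using hs

theorem integrable_besselDensity {κ : ℝ} (hκ : 0 < κ) : Integrable (besselDensity κ) :=
  (integrable_besselKernel hκ).swap.integral_prod_left.const_mul _

/-- Subordination: the heat kernel at time s has Fourier transform e^(-s x²), and ∫ s^(κ/2-1)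
e^(-(1+x²)s) ds is a Gamma integral. -/
theorem integral_exp_mul_besselDensity {κ : ℝ} (hκ : 0 < κ) (x : ℝ) :
    ∫ l : ℝ, Complex.exp (x * l * Complex.I) * (besselDensity κ l : ℂ) =
      (((1 + x ^ 2) ^ (-(κ / 2)) : ℝ) : ℂ) := by
  have hG := Real.Gamma_pos_of_pos (half_pos hκ)
  have hint : Integrable (Function.uncurry fun (s l : ℝ) =>
      Complex.exp (x * l * Complex.I) * (besselKernel κ s l : ℂ))
      ((volume.restrict (Set.Ioi (0 : ℝ))).prod volume) := by
    refine (integrable_besselKernel hκ).ofReal.bdd_mul (c := 1)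
      (f := fun p : ℝ × ℝ => Complex.exp (x * p.2 * Complex.I))
      (Continuous.aestronglyMeasurable (by fun_prop)) (Eventually.of_forall fun p => ?_)
    rw [← Complex.ofReal_mul, Complex.norm_exp_ofReal_mul_I]
  have hswap := integral_integral_swap hint
  have h1 : ∀ l : ℝ, Complex.exp (x * l * Complex.I) * (besselDensity κ l : ℂ) =
      ((Real.Gamma (κ / 2))⁻¹ : ℝ) *
        ∫ s in Set.Ioi (0 : ℝ), Complex.exp (x * l * Complex.I) * (besselKernel κ s l : ℂ) := by
    intro l
    rw [integral_const_mul, integral_complex_ofReal, besselDensity, Complex.ofReal_mul]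
    ring
  simp_rw [h1]
  rw [integral_const_mul, ← hswap]
  have h2 : ∫ s in Set.Ioi (0 : ℝ), ∫ l : ℝ,
      Complex.exp (x * l * Complex.I) * (besselKernel κ s l : ℂ) =
      ∫ s in Set.Ioi (0 : ℝ), ((s ^ (κ / 2 - 1) * Real.exp (-((1 + x ^ 2) * s)) : ℝ) : ℂ) := by
    refine setIntegral_congr_fun measurableSet_Ioi fun s hs => ?_
    have hs0 : 0 < s := hs
    have hv : (2 * s).toNNReal ≠ 0 := by simpa using hs0
    have h3 := charFun_gaussianReal (μ := 0) (v := (2 * s).toNNReal) x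
    rw [charFun_apply_real, integral_gaussianReal_eq_integral_smul hv] at h3
    have h4 : ∀ l : ℝ, Complex.exp (x * l * Complex.I) * (besselKernel κ s l : ℂ) =
        ((s ^ (κ / 2 - 1) * Real.exp (-s) : ℝ) : ℂ) *
          (gaussianPDFReal 0 (2 * s).toNNReal l • Complex.exp (x * l * Complex.I)) := by
      intro l
      rw [besselKernel, heatKernel_eq_gaussianPDFReal hs0, Complex.real_smul, Complex.ofReal_mul]
      ring
    simp_rw [h4]
    rw [integral_const_mul, h3, Real.coe_toNNReal _ (by positivity),
      Complex.ofReal_mul (s ^ (κ / 2 - 1)), Complex.ofReal_mul (s ^ (κ / 2 - 1)), mul_assoc,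
      Complex.ofReal_exp, Complex.ofReal_exp, ← Complex.exp_add]
    congr 2
    push_cast
    ring
  rw [h2, integral_complex_ofReal, Real.integral_rpow_mul_exp_neg_mul_Ioi (half_pos hκ)
    (by positivity), ← Complex.ofReal_mul]
  congr 1
  rw [one_div, Real.inv_rpow (by positivity), Real.rpow_neg (by positivity)]
  field_simp

/-- The factor `I(l)` in `f(l) = C |l| ^ (κ - 1) I(l)`. -/
noncomputable def besselFactor (κ l : ℝ) : ℝ :=
  ∫ v in Set.Ioi (0 : ℝ), v ^ ((κ - 1) / 2 - 1) * Real.exp (-(4 * v)⁻¹) * Real.exp (-(l ^ 2 * v))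

/-- This is the value I(0). The inversion y = 1/v turns it into a Gamma integral of order (1-κ)/2,
positive because κ < 1. -/
theorem besselFactor_integrableOn_and_eq {κ : ℝ} (hκ : κ < 1) :
    IntegrableOn (fun v : ℝ => v ^ ((κ - 1) / 2 - 1) * Real.exp (-(4 * v)⁻¹)) (Set.Ioi 0) ∧
    ∫ v in Set.Ioi (0 : ℝ), v ^ ((κ - 1) / 2 - 1) * Real.exp (-(4 * v)⁻¹) =
      2 ^ (1 - κ) * Real.Gamma ((1 - κ) / 2) := by
  have ha : 0 < (1 - κ) / 2 := by linarith
  have h1 := integral_comp_rpow_Ioi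
    (fun y : ℝ => y ^ ((1 - κ) / 2 - 1) * Real.exp (-(1 / 4 * y))) (p := -1) (by norm_num)
  have h2 := integrableOn_Ioi_comp_rpow_iff
    (fun y : ℝ => y ^ ((1 - κ) / 2 - 1) * Real.exp (-(1 / 4 * y))) (p := -1) (by norm_num)
  rw [Real.integral_rpow_mul_exp_neg_mul_Ioi ha (by norm_num)] at h1
  have h3 : ∀ v ∈ Set.Ioi (0 : ℝ), (|(-1 : ℝ)| * v ^ ((-1 : ℝ) - 1)) •
      ((v ^ (-1 : ℝ)) ^ ((1 - κ) / 2 - 1) * Real.exp (-(1 / 4 * v ^ (-1 : ℝ)))) =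
      v ^ ((κ - 1) / 2 - 1) * Real.exp (-(4 * v)⁻¹) := by
    intro v hv
    have hv0 : 0 < v := hv
    rw [abs_neg, abs_one, one_mul, smul_eq_mul, ← mul_assoc, ← Real.rpow_mul hv0.le,
      ← Real.rpow_add hv0, Real.rpow_neg_one]
    congr 2
    · ring
    · rw [mul_inv]; ring
  rw [setIntegral_congr_fun measurableSet_Ioi h3] at h1
  rw [integrableOn_congr_fun h3 measurableSet_Ioi] at h2
  have h4 : (1 / (1 / 4) : ℝ) ^ ((1 - κ) / 2) = 2 ^ (1 - κ) := by
    rw [show (1 / (1 / 4) : ℝ) = 2 ^ (2 : ℝ) by norm_num, ← Real.rpow_mul (by norm_num)]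
    congr 1
    ring
  rw [h4] at h1
  refine ⟨h2.2 ?_, h1⟩
  by_contra hn
  have h5 := Real.integral_rpow_mul_exp_neg_mul_Ioi ha (r := 1 / 4) (by norm_num)
  rw [integral_undef hn] at h5
  have := Real.Gamma_pos_of_pos ha
  have h6 : 0 < (1 / (1 / 4) : ℝ) ^ ((1 - κ) / 2) * Real.Gamma ((1 - κ) / 2) := by positivity
  linarith

theorem c₂_pos {κ : ℝ} (h0 : 0 < κ) (h1 : κ < 1) : 0 < c₂ κ := by
  have hG := Real.Gamma_pos_of_pos h0
  have hc : 0 < Real.cos (κ * Real.pi / 2) := by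
    refine Real.cos_pos_of_mem_Ioo ⟨?_, ?_⟩ <;> nlinarith [Real.pi_pos]
  rw [c₂]
  positivity

/-- Legendre duplication at κ/2 combined with the reflection formula at κ/2 + 1/2. -/
theorem c₂_eq {κ : ℝ} (h0 : 0 < κ) (h1 : κ < 1) :
    c₂ κ = (Real.Gamma (κ / 2))⁻¹ * ((√(4 * Real.pi))⁻¹ *
      (2 ^ (1 - κ) * Real.Gamma ((1 - κ) / 2))) := by
  have hG := (Real.Gamma_pos_of_pos h0).ne'
  have hG2 := (Real.Gamma_pos_of_pos (half_pos h0)).ne'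
  have hG3 := (Real.Gamma_pos_of_pos (show 0 < κ / 2 + 1 / 2 by linarith)).ne'
  have hc : Real.cos (κ * Real.pi / 2) ≠ 0 := by
    refine (Real.cos_pos_of_mem_Ioo ⟨?_, ?_⟩).ne' <;> nlinarith [Real.pi_pos]
  have e1 := Real.Gamma_mul_Gamma_add_half (κ / 2)
  have e2 := Real.Gamma_mul_Gamma_one_sub (κ / 2 + 1 / 2)
  have e3 : Real.sin (Real.pi * (κ / 2 + 1 / 2)) = Real.cos (κ * Real.pi / 2) := by
    rw [show Real.pi * (κ / 2 + 1 / 2) = κ * Real.pi / 2 + Real.pi / 2 by ring, Real.sin_add_pi_div_two]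
  rw [e3, show 1 - (κ / 2 + 1 / 2) = (1 - κ) / 2 by ring] at e2
  rw [show 2 * (κ / 2) = κ by ring] at e1
  have hs4 : √(4 * Real.pi) = 2 * √Real.pi := by
    rw [Real.sqrt_mul (by norm_num), show (4 : ℝ) = 2 ^ 2 by norm_num,
      Real.sqrt_sq (by norm_num)]
  have hpi : √Real.pi * √Real.pi = Real.pi := Real.mul_self_sqrt Real.pi_pos.le
  have hsp : √Real.pi ≠ 0 := (Real.sqrt_pos.2 Real.pi_pos).ne'
  have e4 : Real.Gamma ((1 - κ) / 2) = Real.pi / Real.cos (κ * Real.pi / 2) /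
      Real.Gamma (κ / 2 + 1 / 2) := by
    rw [eq_div_iff hG3, mul_comm]; exact e2
  have e5 : (2 : ℝ) ^ (1 - κ) = Real.Gamma (κ / 2) * Real.Gamma (κ / 2 + 1 / 2) /
      (Real.Gamma κ * √Real.pi) := by
    rw [eq_div_iff (mul_ne_zero hG hsp), e1]; ring
  rw [c₂, hs4, e4, e5]
  field_simp
  rw [pow_two, hpi]

/-- The substitution s = l² v frees the heat kernel's exponential from l; the powers of l collect to
|l|^(κ-1), and l survives only in the harmless factor e^(-l² v). -/
theorem besselDensity_eq {κ l : ℝ} (hl : l ≠ 0) :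
    besselDensity κ l = (Real.Gamma (κ / 2))⁻¹ * ((√(4 * Real.pi))⁻¹ * besselFactor κ l) *
      |l| ^ (κ - 1) := by
  have hl2 : 0 < l ^ 2 := by positivity
  have h1 := integral_comp_mul_left_Ioi (besselKernel κ · l) 0 hl2
  rw [mul_zero, smul_eq_mul, eq_inv_mul_iff_mul_eq₀ hl2.ne'] at h1
  rw [besselDensity, ← h1, mul_assoc]
  congr 1
  rw [besselFactor, ← integral_const_mul, ← integral_const_mul, ← integral_mul_const]
  refine setIntegral_congr_fun measurableSet_Ioi fun v hv => ?_
  have hv0 : 0 < v := hv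
  have e1 : |l| ^ (κ - 1) = (l ^ 2) ^ ((κ - 1) / 2) := by
    rw [← sq_abs, ← Real.rpow_natCast, ← Real.rpow_mul (abs_nonneg l)]
    congr 1
    push_cast
    ring
  have e2 : √(4 * Real.pi * (l ^ 2 * v)) = √(4 * Real.pi) * (l ^ 2 * v) ^ (1 / 2 : ℝ) := by
    rw [Real.sqrt_mul (by positivity), Real.sqrt_eq_rpow (l ^ 2 * v)]
  have e3 : (l ^ 2 * v) ^ (κ / 2 - 1) = (l ^ 2 * v) ^ ((κ - 1) / 2 - 1) * (l ^ 2 * v) ^ (1 / 2 : ℝ) := by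
    rw [← Real.rpow_add (by positivity)]
    congr 1
    ring
  have e4 : l ^ 2 * (l ^ 2 * v) ^ ((κ - 1) / 2 - 1) =
      (l ^ 2) ^ ((κ - 1) / 2) * v ^ ((κ - 1) / 2 - 1) := by
    rw [Real.mul_rpow hl2.le hv0.le, Real.rpow_sub_one hl2.ne']
    field_simp
  have e5 : -l ^ 2 / (4 * (l ^ 2 * v)) = -(4 * v)⁻¹ := by
    field_simp
  have hne : (l ^ 2 * v) ^ (1 / 2 : ℝ) ≠ 0 := by positivity
  simp only [besselKernel]
  rw [e1, e2, e3, e5]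
  have h5 : l ^ 2 * ((l ^ 2 * v) ^ ((κ - 1) / 2 - 1) * (l ^ 2 * v) ^ (1 / 2 : ℝ) *
      Real.exp (-(l ^ 2 * v)) * ((√(4 * Real.pi) * (l ^ 2 * v) ^ (1 / 2 : ℝ))⁻¹ *
        Real.exp (-(4 * v)⁻¹))) = (l ^ 2 * (l ^ 2 * v) ^ ((κ - 1) / 2 - 1)) *
      (Real.exp (-(l ^ 2 * v)) * ((√(4 * Real.pi))⁻¹ * Real.exp (-(4 * v)⁻¹))) := by
    rw [mul_inv]
    field_simp
  rw [h5, e4]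
  ring

theorem besselFactor_term_le {κ v : ℝ} (hv : 0 < v) (l : ℝ) :
    ‖v ^ ((κ - 1) / 2 - 1) * Real.exp (-(4 * v)⁻¹) * Real.exp (-(l ^ 2 * v))‖ ≤
      v ^ ((κ - 1) / 2 - 1) * Real.exp (-(4 * v)⁻¹) := by
  rw [Real.norm_of_nonneg (by positivity)]
  refine mul_le_of_le_one_right (by positivity) (Real.exp_le_one_iff.2 ?_)
  have : 0 ≤ l ^ 2 * v := by positivity
  linarith

/-- I(l) ≤ I(0). The bound holds at every l ≠ 0 and thus also dominates after rescaling. -/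
theorem besselDensity_le {κ l : ℝ} (h0 : 0 < κ) (h1 : κ < 1) (hl : l ≠ 0) :
    besselDensity κ l ≤ c₂ κ * |l| ^ (κ - 1) := by
  have hG := Real.Gamma_pos_of_pos (half_pos h0)
  rw [besselDensity_eq hl, c₂_eq h0 h1]
  obtain ⟨hi, he⟩ := besselFactor_integrableOn_and_eq h1
  have hpos : ∀ᵐ s ∂(volume.restrict (Set.Ioi (0 : ℝ))), 0 < s := ae_restrict_mem measurableSet_Ioi
  have h2 : besselFactor κ l ≤ 2 ^ (1 - κ) * Real.Gamma ((1 - κ) / 2) := by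
    rw [← he]
    refine le_trans (le_abs_self (besselFactor κ l)) ?_
    rw [besselFactor, ← Real.norm_eq_abs]
    refine norm_integral_le_of_norm_le hi ?_
    filter_upwards [hpos] with v hv using besselFactor_term_le hv l
  gcongr

/-- I(l) → I(0) by dominated convergence, with the integrand of I(0) as majorant. -/
theorem tendsto_besselDensity_div {κ : ℝ} (h0 : 0 < κ) (h1 : κ < 1) :
    Tendsto (fun l => besselDensity κ l * |l| ^ (1 - κ)) (𝓝[≠] 0) (𝓝 (c₂ κ)) := by
  obtain ⟨hi, he⟩ := besselFactor_integrableOn_and_eq h1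
  have hpos : ∀ᵐ s ∂(volume.restrict (Set.Ioi (0 : ℝ))), 0 < s := ae_restrict_mem measurableSet_Ioi
  have h2 : Tendsto (besselFactor κ) (𝓝[≠] 0) (𝓝 (2 ^ (1 - κ) * Real.Gamma ((1 - κ) / 2))) := by
    rw [← he]
    refine tendsto_integral_filter_of_dominated_convergence _ ?_ ?_ hi ?_
    · exact Eventually.of_forall fun l => Measurable.aestronglyMeasurable (by fun_prop)
    · refine Eventually.of_forall fun l => ?_
      filter_upwards [hpos] with v hv using besselFactor_term_le hv l
    · refine Eventually.of_forall fun v => ?_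
      have hc : Continuous fun l : ℝ => v ^ ((κ - 1) / 2 - 1) * Real.exp (-(4 * v)⁻¹) *
        Real.exp (-(l ^ 2 * v)) := by fun_prop
      have := (hc.tendsto 0).mono_left (nhdsWithin_le_nhds (s := {0}ᶜ))
      simpa using this
  rw [c₂_eq h0 h1]
  refine ((h2.const_mul _).const_mul _).congr' ?_
  filter_upwards [self_mem_nhdsWithin] with l hl
  have hl' : l ≠ 0 := hl
  have hp : |l| ^ (κ - 1) * |l| ^ (1 - κ) = 1 := by
    rw [← Real.rpow_add (abs_pos.2 hl')]
    simp
  rw [besselDensity_eq hl', mul_assoc _ _ (|l| ^ (1 - κ)), hp, mul_one]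

/-- The spectral measure of `cos(w x) (1 + x²) ^ (-κ/2)`. -/
noncomputable def besselMeasure (κ w : ℝ) : Measure ℝ :=
  (2⁻¹ : NNReal) • ((volume.withDensity fun l => ENNReal.ofReal (besselDensity κ l)).map (· + w) +
    (volume.withDensity fun l => ENNReal.ofReal (besselDensity κ l)).map (· + -w))

theorem isFiniteMeasure_besselMeasure {κ : ℝ} (hκ : 0 < κ) (w : ℝ) :
    IsFiniteMeasure (besselMeasure κ w) := by
  have := isFiniteMeasure_withDensity_ofReal (integrable_besselDensity hκ).2
  unfold besselMeasure
  infer_instance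

theorem integral_besselMeasure {κ : ℝ} (hκ : 0 < κ) (w : ℝ) {φ : ℝ → ℂ} (hφ : Measurable φ)
    {C : ℝ} (hC : ∀ l, ‖φ l‖ ≤ C) :
    ∫ l, φ l ∂(besselMeasure κ w) = 2⁻¹ * ((∫ l, besselDensity κ l • φ (l + w)) +
      ∫ l, besselDensity κ l • φ (l + -w)) := by
  have := isFiniteMeasure_withDensity_ofReal (integrable_besselDensity hκ).2
  have hi : ∀ (ρ : Measure ℝ) [IsFiniteMeasure ρ], Integrable φ ρ := fun ρ _ =>
    Integrable.of_bound hφ.aestronglyMeasurable C (Eventually.of_forall hC)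
  have h1 : ∀ a : ℝ, ∫ l, φ l ∂((volume.withDensity fun l =>
      ENNReal.ofReal (besselDensity κ l)).map (· + a)) = ∫ l, besselDensity κ l • φ (l + a) := by
    intro a
    rw [integral_map (by fun_prop) hφ.aestronglyMeasurable,
      integral_withDensity_eq_integral_toReal_smul (measurable_besselDensity κ).ennreal_ofReal
        (by simp)]
    simp_rw [ENNReal.toReal_ofReal (besselDensity_nonneg hκ _)]
  rw [besselMeasure, integral_smul_nnreal_measure, integral_add_measure (hi _) (hi _), h1, h1]
  rw [NNReal.smul_def, Complex.real_smul]
  simp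

theorem charFun_besselMeasure {κ : ℝ} (hκ : 0 < κ) (w x : ℝ) :
    charFun (besselMeasure κ w) x =
      ((Real.cos (w * x) / (1 + x ^ 2) ^ (κ / 2) : ℝ) : ℂ) := by
  rw [charFun_apply_real, integral_besselMeasure hκ w (C := 1) (by fun_prop)
    (fun l => by rw [← Complex.ofReal_mul, Complex.norm_exp_ofReal_mul_I])]
  have h1 : ∀ a : ℝ, ∫ l : ℝ, besselDensity κ l • Complex.exp (x * ((l + a : ℝ) : ℂ) * Complex.I) =
      Complex.exp (x * a * Complex.I) * (((1 + x ^ 2) ^ (-(κ / 2)) : ℝ) : ℂ) := by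
    intro a
    rw [← integral_exp_mul_besselDensity hκ, ← integral_const_mul]
    congr 1
    ext l
    rw [Complex.real_smul, ← mul_assoc, ← Complex.exp_add, mul_comm]
    congr 2
    push_cast
    ring
  rw [h1, h1, Real.rpow_neg (by positivity), Complex.ofReal_div, Complex.ofReal_inv,
    Complex.ofReal_cos, Complex.cos]
  push_cast
  rw [show (x : ℂ) * w * Complex.I = w * x * Complex.I by ring,
    show (x : ℂ) * -w * Complex.I = -(w * x) * Complex.I by ring]
  ring

end BesselDensity

/-! ### Identification of the transfer function -/

section TransferFunction

/-- Continuous linear maps commute with the integral and the derivative. Freezing the function at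
negative times makes it continuous on the whole line without changing the derivative at t > 0. -/
theorem HasCaputoDerivAt.clm_comp_max {H E : Type*} [NormedAddCommGroup H] [NormedSpace ℝ H]
    [CompleteSpace H] [NormedAddCommGroup E] [NormedSpace ℝ E] [CompleteSpace E] {β : ℝ}
    (hβ₁ : β ≤ 1) {V : ℝ → H} {d : H} {t : ℝ} (ht : 0 < t) (L : H →L[ℝ] E)
    (hV : ContinuousOn V (Set.Ici 0)) (h : HasCaputoDerivAt β V d t) :
    HasCaputoDerivAt β (fun τ => L (V (max τ 0))) (L d) t := by
  unfold HasCaputoDerivAt at h ⊢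
  split_ifs at h ⊢ with hβ
  · refine (L.hasFDerivAt.comp_hasDerivAt t h).congr_of_eventuallyEq ?_
    filter_upwards [Ici_mem_nhds ht] with s hs
    rw [max_eq_left hs]
    rfl
  · have hβ' : 0 < 1 - β := by
      have := lt_of_le_of_ne hβ₁ hβ
      linarith
    obtain ⟨d', hd', rfl⟩ := h
    refine ⟨L d', ?_, ?_⟩
    · refine (L.hasFDerivAt.comp_hasDerivAt t hd').congr_of_eventuallyEq ?_
      filter_upwards [Ici_mem_nhds ht] with s hs
      have hi : IntervalIntegrable (fun τ => (s - τ) ^ (-β) • V τ) volume 0 s := by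
        have := intervalIntegrable_sub_rpow hβ' s
        rw [show 1 - β - 1 = -β by ring] at this
        refine this.smul_continuousOn (hV.mono ?_)
        rw [Set.uIcc_of_le hs]
        exact Set.Icc_subset_Ici_self
      rw [Function.comp_apply, ← L.intervalIntegral_comp_comm hi]
      refine intervalIntegral.integral_congr fun τ hτ => ?_
      rw [Set.uIcc_of_le hs] at hτ
      simp only [map_smul, max_eq_left hτ.1]
    · simp [map_smul]

variable {Ω : Type*} [MeasurableSpace Ω] {P : Measure Ω}

theorem IsStochIntegral.congr_left {ν : Measure ℝ} {Z : Set ℝ → Ω → ℂ} {g g' : ℝ → ℂ} {X : Ω → ℂ}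
    (h : IsStochIntegral P ν Z g X) (hg : g =ᵐ[ν] g') : IsStochIntegral P ν Z g' X := by
  obtain ⟨hg2, hX, s, hs, h1, h2⟩ := h
  refine ⟨hg2.ae_eq hg, hX, s, hs, h1.congr fun k => eLpNorm_congr_ae ?_, h2⟩
  filter_upwards [hg] with l hl
  rw [hl]

theorem toL2_eq_toLp {X : Ω → ℝ} (hX : MemLp X 2 P) : toL2 P X = hX.toLp X := by
  rw [toL2, dif_pos hX]

/-- The complexification of the classes of square-integrable real random variables. -/
noncomputable def ofRealL2 (P : Measure Ω) : Lp ℝ 2 P →L[ℝ] Lp ℂ 2 P :=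
  Complex.ofRealCLM.compLpL 2 P

theorem ofRealL2_toL2 {X : Ω → ℝ} (hX : MemLp X 2 P) (hX' : MemLp (fun ω => (X ω : ℂ)) 2 P) :
    ofRealL2 P (toL2 P X) = hX'.toLp _ := by
  rw [toL2_eq_toLp hX]
  refine Lp.ext ?_
  filter_upwards [Complex.ofRealCLM.coeFn_compLpL (p := 2) (μ := P) (hX.toLp X), hX.coeFn_toLp,
    hX'.coeFn_toLp] with ω h1 h2 h3
  rw [ofRealL2, h1, h2, h3]
  rfl

/-- The functional `X ↦ E[X conj(Y)]`. -/
noncomputable def innerL2 (Y : Lp ℂ 2 P) : Lp ℝ 2 P →L[ℝ] ℂ :=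
  ((innerSL ℂ Y).restrictScalars ℝ).comp (ofRealL2 P)

theorem norm_innerL2_le (Y : Lp ℂ 2 P) (X : Lp ℝ 2 P) : ‖innerL2 Y X‖ ≤ ‖Y‖ * ‖ofRealL2 P X‖ := by
  have h : innerL2 Y X = inner ℂ Y (ofRealL2 P X) := rfl
  rw [h]
  exact norm_inner_le_norm (𝕜 := ℂ) Y (ofRealL2 P X)

theorem innerL2_toL2 {F : Measure ℝ} {Z : Set ℝ → Ω → ℂ} (hZ : IsOrthogonalRandomMeasure P F Z)
    {g y : ℝ → ℂ} {X : Ω → ℝ} {Y : Ω → ℂ} (hX : IsStochIntegral P F Z g (fun ω => (X ω : ℂ)))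
    (hY : IsStochIntegral P F Z y Y) :
    innerL2 (hY.memLp.toLp Y) (toL2 P X) = ∫ l, g l * (starRingEnd ℂ) (y l) ∂F := by
  rw [innerL2, ContinuousLinearMap.comp_apply, ofRealL2_toL2 hX.memLp_real hX.memLp]
  change inner ℂ (hY.memLp.toLp Y) (hX.memLp.toLp _) = _
  rw [hY.inner_eq hZ hX, inner_toLp]

/-- The Fourier symbol of the Riesz–Bessel operator. -/
noncomputable def symbol (α γ l : ℝ) : ℝ := |l| ^ α * (1 + |l| ^ 2) ^ (γ / 2)

theorem symbol_nonneg (α γ l : ℝ) : 0 ≤ symbol α γ l := by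
  unfold symbol
  positivity

theorem measurable_symbol (α γ : ℝ) : Measurable (symbol α γ) := by
  unfold symbol
  fun_prop

theorem tendsto_pow_div_Gamma {β : ℝ} (hβ : 0 < β) (s : ℝ) :
    Tendsto (fun k : ℕ => s ^ k / Real.Gamma (1 + β * k)) atTop (𝓝 0) :=
  (summable_pow_div_Gamma hβ s).tendsto_atTop_zero

theorem norm_mittagLeffler_neg_le_one {β : ℝ} (hβ₀ : 0 < β) (hβ₁ : β ≤ 1) {s : ℝ} (hs : 0 ≤ s) :
    ‖mittagLeffler β (-s)‖ ≤ 1 := by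
  rw [Real.norm_of_nonneg (mittagLeffler_neg_nonneg hβ₀ hβ₁ hs)]
  exact mittagLeffler_neg_le_one hβ₀ hβ₁ hs

/-- On a set where the symbol is bounded, the transfer function of a mean-square solution has
the same integral as the Mittag-Leffler function. -/
theorem setIntegral_transfer_eq {α β γ μ : ℝ} (hβ₀ : 0 < β) (hβ₁ : β ≤ 1)
    (hμ : 0 < μ) {u : ℝ → ℝ → Ω → ℝ} {F : Measure ℝ} [IsFiniteMeasure F] {Z : Set ℝ → Ω → ℂ}
    (hZ : IsOrthogonalRandomMeasure P F Z) {v : ℝ → ℝ → Ω → ℝ} {g : ℝ → ℝ → ℂ}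
    (hg : ∀ t, 0 ≤ t → HasSpectralRep P F Z (g t) (u t)) (hg0 : g 0 = fun _ => 1)
    (hv : ∀ t, 0 < t → HasSpectralRep P F Z (fun l => (symbol α γ l : ℂ) * g t l) (v t))
    (hcont : ContinuousOn (fun t => toL2 P (u t 0)) (Set.Ici 0))
    (heq : ∀ t, 0 < t → HasCaputoDerivAt β (fun τ => toL2 P (u τ 0)) (-μ • toL2 P (v t 0)) t)
    {N : ℝ} (hN : 0 ≤ N) {A : Set ℝ} (hA : MeasurableSet A) (hAN : ∀ l ∈ A, symbol α γ l ≤ N)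
    {t : ℝ} (ht : 0 < t) :
    ∫ l in A, g t l ∂F = ∫ l in A, (mittagLeffler β (-μ * symbol α γ l * t ^ β) : ℂ) ∂F := by
  -- Test functions on A: multiplication by -μσ leads from `y k` to `y (k + 1)`, so powers of the
  -- unbounded spatial operator fall on bounded functions.
  set y : ℕ → ℝ → ℂ := fun k => A.indicator fun l => (((-μ * symbol α γ l) ^ k : ℝ) : ℂ) with hy
  have hyb : ∀ k l, ‖y k l‖ ≤ (μ * N) ^ k := by
    intro k l
    by_cases hl : l ∈ A
    · simp only [hy, Set.indicator_of_mem hl]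
      rw [Complex.norm_real, norm_pow, norm_mul, norm_neg, Real.norm_of_nonneg hμ.le,
        Real.norm_of_nonneg (symbol_nonneg _ _ _)]
      have := symbol_nonneg α γ l
      gcongr
      exact hAN l hl
    · simp only [hy, Set.indicator_of_notMem hl, norm_zero]
      positivity
  have hym : ∀ k, Measurable (y k) := fun k =>
    (Complex.measurable_ofReal.comp (((measurable_symbol α γ).const_mul _).pow_const k)).indicator hA
  have hyL : ∀ k, MemLp (y k) 2 F := fun k =>
    MemLp.of_bound (hym k).aestronglyMeasurable _ (Eventually.of_forall (hyb k))
  have hyc : ∀ k l, (starRingEnd ℂ) (y k l) = y k l := by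
    intro k l
    by_cases hl : l ∈ A
    · simp only [hy, Set.indicator_of_mem hl, Complex.conj_ofReal]
    · simp only [hy, Set.indicator_of_notMem hl, map_zero]
  have hys : ∀ k l, y (k + 1) l = (-μ : ℂ) * (symbol α γ l : ℂ) * y k l := by
    intro k l
    by_cases hl : l ∈ A
    · simp only [hy, Set.indicator_of_mem hl]
      push_cast
      ring
    · simp only [hy, Set.indicator_of_notMem hl, mul_zero]
  choose Y hY using fun k => exists_isStochIntegral hZ (hyL k)
  set a : ℕ → ℝ → ℂ := fun k t => innerL2 ((hY k).memLp.toLp (Y k)) (toL2 P (u (max t 0) 0)) with ha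
  have hg' : ∀ t, 0 ≤ t → IsStochIntegral P F Z (g t) (fun ω => (u t 0 ω : ℂ)) := fun t ht => by
    simpa using hg t ht 0
  have hv' : ∀ t, 0 < t → IsStochIntegral P F Z (fun l => (symbol α γ l : ℂ) * g t l)
      (fun ω => (v t 0 ω : ℂ)) := fun t ht => by
    simpa using hv t ht 0
  have haval : ∀ k t, 0 ≤ t → a k t = ∫ l, g t l * y k l ∂F := by
    intro k t ht
    simp only [ha]
    rw [max_eq_left ht, innerL2_toL2 hZ (hg' t ht) (hY k)]
    simp_rw [hyc]
  have hVc : Continuous fun t => toL2 P (u (max t 0) 0) :=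
    hcont.comp_continuous (continuous_id.max continuous_const)
      fun t => Set.mem_Ici.2 (le_max_right _ _)
  have hac : ∀ k, Continuous (a k) := fun k => (innerL2 _).continuous.comp hVc
  -- Pairing the equation with `Y k` moves the symbol onto the test function: the fractional
  -- derivative of `a k` is `a (k + 1)`.
  have had : ∀ k t, 0 < t → HasCaputoDerivAt β (a k) (a (k + 1) t) t := by
    intro k t ht
    have h1 := (heq t ht).clm_comp_max hβ₁ ht (innerL2 ((hY k).memLp.toLp (Y k))) hcont
    rw [map_smul, innerL2_toL2 hZ (hv' t ht) (hY k)] at h1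
    convert! h1 using 1
    rw [haval (k + 1) t ht.le, Complex.real_smul, ← integral_const_mul]
    congr 1
    ext l
    rw [hys, hyc]
    push_cast
    ring
  have hvol : ∀ k t, 0 ≤ t → a k t = a k 0 + fracInt β (a (k + 1)) t := fun k t ht =>
    eq_add_fracInt_of_hasCaputoDerivAt hβ₀ hβ₁ (hac k) (hac (k + 1)) (had k) ht
  obtain ⟨M, hM⟩ := (isCompact_Icc (a := 0) (b := t)).exists_bound_of_continuousOn
    (((ofRealL2 P).continuous.comp hVc).continuousOn)
  obtain ⟨J, hJ⟩ := exists_linearIsometry_stochIntegral hZ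
  -- By isometry ‖Y k‖ equals the L²(F) norm of `y k`, at most F(ℝ)^(1/2) (μN)^k; M bounds ‖u(s, 0)‖
  -- for s in [0, t].
  set M' : ℝ := (F.real Set.univ) ^ (2 : ℝ≥0∞).toReal⁻¹ * M with hM'
  have hbound : ∀ k, ∀ s ∈ Set.Icc 0 t, ‖a k s‖ ≤ M' * (μ * N) ^ k := by
    intro k s hs
    have h1 : ‖a k s‖ ≤ ‖(hY k).memLp.toLp (Y k)‖ * ‖ofRealL2 P (toL2 P (u (max s 0) 0))‖ :=
      norm_innerL2_le _ _
    have h2 : ‖(hY k).memLp.toLp (Y k)‖ ≤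
        (F.real Set.univ) ^ (2 : ℝ≥0∞).toReal⁻¹ * (μ * N) ^ k := by
      rw [← hJ _ _ (hY k), J.norm_map]
      refine Lp.norm_le_of_ae_bound (by positivity) ?_
      filter_upwards [(hY k).memLp_integrand.coeFn_toLp] with l hl
      rw [hl]
      exact hyb k l
    have h3 := hM s hs
    calc ‖a k s‖ ≤ _ := h1
      _ ≤ ((F.real Set.univ) ^ (2 : ℝ≥0∞).toReal⁻¹ * (μ * N) ^ k) * M := by
        refine mul_le_mul h2 h3 (norm_nonneg _) (by positivity)
      _ = M' * (μ * N) ^ k := by rw [hM']; ring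
  -- The Taylor remainder is at most M' (μ N t^β)^n / Γ(1 + βn), a term of a convergent series up to
  -- a factor.
  have hlim1 : Tendsto (fun n => ∑ i ∈ Finset.range n,
      (t ^ (β * i) / Real.Gamma (1 + β * i)) • a i 0) atTop (𝓝 (a 0 t)) := by
    rw [tendsto_iff_norm_sub_tendsto_zero]
    have h1 : Tendsto (fun n : ℕ => M' * (((μ * N) * t ^ β) ^ n / Real.Gamma (1 + β * n))) atTop
        (𝓝 0) := by
      simpa using (tendsto_pow_div_Gamma hβ₀ (μ * N * t ^ β)).const_mul M'
    refine squeeze_zero (fun _ => norm_nonneg _) (fun n => ?_) h1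
    rw [norm_sub_rev]
    have h2 := norm_sub_sum_le_of_eq_add_fracInt hβ₀ hac hvol hbound n 0 t ⟨ht.le, le_rfl⟩
    simp only [zero_add] at h2
    rw [mul_rpow_pow ht.le]
    refine h2.trans_eq ?_
    ring
  -- As g₀ = 1, the Taylor polynomials are integrals over A of partial Mittag-Leffler sums,
  -- dominated by the full series at μ N t^β.
  have hlim2 : Tendsto (fun n => ∑ i ∈ Finset.range n,
      (t ^ (β * i) / Real.Gamma (1 + β * i)) • a i 0) atTop
      (𝓝 (∫ l in A, (mittagLeffler β (-μ * symbol α γ l * t ^ β) : ℂ) ∂F)) := by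
    have h1 : ∀ n, ∑ i ∈ Finset.range n, (t ^ (β * i) / Real.Gamma (1 + β * i)) • a i 0 =
        ∫ l in A, ((∑ i ∈ Finset.range n, (-μ * symbol α γ l * t ^ β) ^ i /
          Real.Gamma (1 + β * i) : ℝ) : ℂ) ∂F := by
      intro n
      have h2 : ∀ l, A.indicator (fun l => ((∑ i ∈ Finset.range n,
          (-μ * symbol α γ l * t ^ β) ^ i / Real.Gamma (1 + β * i) : ℝ) : ℂ)) l =
          ∑ i ∈ Finset.range n, (t ^ (β * i) / Real.Gamma (1 + β * i)) • y i l := by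
        intro l
        by_cases hl : l ∈ A
        · simp only [hy, Set.indicator_of_mem hl, Complex.ofReal_sum]
          refine Finset.sum_congr rfl fun i _ => ?_
          rw [mul_rpow_pow ht.le, Complex.real_smul, ← Complex.ofReal_mul]
          congr 1
          ring
        · simp only [hy, Set.indicator_of_notMem hl, smul_zero, Finset.sum_const_zero]
      rw [← integral_indicator hA]
      simp_rw [h2]
      rw [integral_finsetSum (f := fun (i : ℕ) l => (t ^ (β * i) / Real.Gamma (1 + β * i)) • y i l) _
        fun i _ => ((hyL i).integrable one_le_two).smul (t ^ (β * i) / Real.Gamma (1 + β * i))]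
      refine Finset.sum_congr rfl fun i _ => ?_
      rw [integral_smul, haval i 0 le_rfl, hg0]
      simp
    simp_rw [h1]
    refine tendsto_integral_of_dominated_convergence
      (fun _ => ∑' i : ℕ, (μ * N * t ^ β) ^ i / Real.Gamma (1 + β * i)) (fun n => ?_)
      (integrable_const _) (fun n => ?_) ?_
    · refine (Complex.measurable_ofReal.comp ?_).aestronglyMeasurable
      refine Finset.measurable_sum _ fun i _ => ?_
      exact ((((measurable_symbol α γ).const_mul _).mul_const _).pow_const i).div_const _
    · filter_upwards [ae_restrict_mem hA] with l hl
      rw [Complex.norm_real]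
      refine (norm_sum_le _ _).trans ?_
      refine le_trans (Finset.sum_le_sum fun i _ => ?_)
        ((summable_pow_div_Gamma hβ₀ (μ * N * t ^ β)).sum_le_tsum (Finset.range n) fun i _ => ?_)
      · have hs := symbol_nonneg α γ l
        have hs' := hAN l hl
        rw [norm_div, norm_pow, Real.norm_of_nonneg (Gamma_one_add_mul_pos hβ₀ i).le, norm_mul,
          norm_mul, norm_neg, Real.norm_of_nonneg hμ.le, Real.norm_of_nonneg hs,
          Real.norm_of_nonneg (by positivity : 0 ≤ t ^ β)]
        have := Gamma_one_add_mul_pos hβ₀ i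
        gcongr
      · have := Gamma_one_add_mul_pos hβ₀ i
        positivity
    · refine Eventually.of_forall fun l => ?_
      refine (Complex.continuous_ofReal.tendsto _).comp ?_
      exact (summable_pow_div_Gamma hβ₀ _).hasSum.tendsto_sum_nat
  have h1 := tendsto_nhds_unique hlim1 hlim2
  rw [← h1, haval 0 t ht.le, ← integral_indicator hA]
  congr 1
  ext l
  by_cases hl : l ∈ A
  · simp [hy, Set.indicator_of_mem hl]
  · simp [hy, Set.indicator_of_notMem hl]

/-- The transfer function of a mean-square solution is the Mittag-Leffler function. -/
theorem IsMeanSquareSolution.exists_hasSpectralRep {α β γ μ : ℝ} (hβ₀ : 0 < β)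
    (hβ₁ : β ≤ 1) (hμ : 0 < μ) {ξ : ℝ → Ω → ℝ} {u : ℝ → ℝ → Ω → ℝ}
    (hu : IsMeanSquareSolution P α β γ μ ξ u) :
    ∃ (F : Measure ℝ) (Z : Set ℝ → Ω → ℂ), IsFiniteMeasure F ∧
      IsOrthogonalRandomMeasure P F Z ∧ HasSpectralRep P F Z (fun _ => 1) ξ ∧
      ∀ t, 0 < t → HasSpectralRep P F Z
        (fun l => (mittagLeffler β (-μ * symbol α γ l * t ^ β) : ℂ)) (u t) := by
  obtain ⟨F, Z, hF, hZ, hrep, hu0, hcont, heq⟩ := hu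
  refine ⟨F, Z, hF, hZ, hrep, fun t ht => ?_⟩
  choose! v hv using heq
  choose! g hg using fun t ht => (hv t ht).1
  -- The initial condition enters as transfer function 1 at time 0.
  set g' : ℝ → ℝ → ℂ := fun t => if t = 0 then fun _ => 1 else g t with hg'
  have hgp : ∀ t, 0 < t → g' t = g t := fun t ht => by simp [hg', ht.ne']
  have hrep' : ∀ t, 0 ≤ t → HasSpectralRep P F Z (g' t) (u t) := by
    intro t ht
    rcases eq_or_lt_of_le ht with rfl | ht0
    · intro x
      simp only [hg', if_true]
      refine (hrep x).congr ?_
      filter_upwards [hu0 x] with ω hω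
      rw [hω]
    · rw [hgp t ht0]
      exact (hg t ht0).1
  have key : ∀ N : ℕ, ∀ A, MeasurableSet A → (∀ l ∈ A, symbol α γ l ≤ N) →
      ∫ l in A, g t l ∂F = ∫ l in A, (mittagLeffler β (-μ * symbol α γ l * t ^ β) : ℂ) ∂F := by
    intro N A hA hAN
    -- The equation at x = 0 suffices, because one transfer function serves all x.
    have := setIntegral_transfer_eq hβ₀ hβ₁ hμ hZ (α := α) (γ := γ) (v := v) hrep' (by simp [hg'])
      (fun t ht => by rw [hgp t ht]; exact (hg t ht).2) (hcont 0) (fun t ht => (hv t ht).2 0)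
      N.cast_nonneg hA hAN ht
    rwa [hgp t ht] at this
  have hgi : Integrable (g t) F := by
    have h1 := ((hg t ht).1 0).memLp_integrand.integrable one_le_two
    simpa using h1
  have hEm : Measurable fun l => (mittagLeffler β (-μ * symbol α γ l * t ^ β) : ℂ) :=
    Complex.measurable_ofReal.comp ((continuous_mittagLeffler hβ₀).measurable.comp
      (((measurable_symbol α γ).const_mul _).mul_const _))
  have hEi : Integrable (fun l => (mittagLeffler β (-μ * symbol α γ l * t ^ β) : ℂ)) F := by
    refine Integrable.of_bound hEm.aestronglyMeasurable 1 (Eventually.of_forall fun l => ?_)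
    rw [Complex.norm_real, neg_mul, neg_mul]
    have := symbol_nonneg α γ l
    exact norm_mittagLeffler_neg_le_one hβ₀ hβ₁ (by positivity)
  have hae : g t =ᵐ[F] fun l => (mittagLeffler β (-μ * symbol α γ l * t ^ β) : ℂ) := by
    have h1 : ∀ N : ℕ, ∀ᵐ l ∂F, symbol α γ l ≤ N →
        g t l = (mittagLeffler β (-μ * symbol α γ l * t ^ β) : ℂ) := by
      intro N
      have hB : MeasurableSet {l | symbol α γ l ≤ N} :=
        measurableSet_le (measurable_symbol α γ) measurable_const
      have h2 := Integrable.ae_eq_of_forall_setIntegral_eq (μ := F.restrict {l | symbol α γ l ≤ N})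
        (g t) (fun l => (mittagLeffler β (-μ * symbol α γ l * t ^ β) : ℂ)) hgi.restrict hEi.restrict
        fun s hs _ => by
          rw [Measure.restrict_restrict hs]
          exact key N _ (hs.inter hB) fun l hl => hl.2
      exact (ae_restrict_iff' hB).1 h2
    -- The sets {σ ≤ N} exhaust the line, so almost everywhere equality on each of them is enough.
    filter_upwards [ae_all_iff.2 h1] with l hl
    obtain ⟨N, hN⟩ := exists_nat_ge (symbol α γ l)
    exact hl N hN
  intro x
  refine ((hg t ht).1 x).congr_left ?_
  filter_upwards [hae] with l hl
  rw [hl]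

end TransferFunction

/-! ### Scaling limits near and away from the spectral singularity -/

section Scaling

theorem integrable_of_even {E : Type*} [NormedAddCommGroup E] {f : ℝ → E} (hf : ∀ x, f (-x) = f x)
    (h : IntegrableOn f (Set.Ioi 0)) : Integrable f := by
  have h1 : IntegrableOn f (Set.Iio 0) := by
    have h2 := (Measure.measurePreserving_neg (volume : Measure ℝ)).integrableOn_comp_preimage
      (Homeomorph.neg ℝ).measurableEmbedding (f := f) (s := Set.Ioi 0)
    have h3 := h2.2 h
    simp only [Set.neg_preimage, Set.neg_Ioi, neg_zero] at h3
    exact h3.congr_fun (fun x _ => hf x) measurableSet_Iio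
  have h2 : IntegrableOn f (Set.Iic 0) := by
    rwa [integrableOn_Iic_iff_integrableOn_Iio]
  have h3 := h2.union h
  rwa [Set.Iic_union_Ioi, integrableOn_univ] at h3

theorem integrable_indicator_abs_rpow {p : ℝ} (hp : p < 1) (r : ℝ) :
    Integrable ((Set.Ioo (-r) r).indicator fun l : ℝ => |l| ^ (-p)) := by
  refine integrable_of_even (fun x => ?_) ?_
  · have hx : -x ∈ Set.Ioo (-r) r ↔ x ∈ Set.Ioo (-r) r := by
      constructor <;> rintro ⟨h1, h2⟩ <;> constructor <;> linarith
    by_cases h : x ∈ Set.Ioo (-r) r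
    · rw [Set.indicator_of_mem h, Set.indicator_of_mem (hx.2 h), abs_neg]
    · rw [Set.indicator_of_notMem h, Set.indicator_of_notMem (fun h' => h (hx.1 h'))]
  · rcases le_or_gt r 0 with hr | hr
    · rw [Set.Ioo_eq_empty (by linarith), Set.indicator_empty]
      exact integrableOn_zero
    have h1 := (intervalIntegral.intervalIntegrable_rpow' (a := 0) (b := r)
      (show -1 < -p by linarith)).1
    have h2 : IntegrableOn (fun l : ℝ => |l| ^ (-p)) (Set.Ioo (-r) r ∩ Set.Ioi 0) := by
      refine (h1.mono_set fun x hx => ⟨hx.2, hx.1.2.le⟩).congr_fun (fun x hx => ?_)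
        (measurableSet_Ioo.inter measurableSet_Ioi)
      rw [abs_of_pos hx.2]
    rw [IntegrableOn, integrable_indicator_iff measurableSet_Ioo, IntegrableOn,
      Measure.restrict_restrict measurableSet_Ioo]
    exact h2

/-- The singularities at 0 and -a are at distance |a|: within |a|/2 of -a the density is bounded and
p < 1 gives integrability, elsewhere the power is bounded. -/
theorem integrable_besselDensity_mul_rpow {κ p a : ℝ} (h0 : 0 < κ) (h1 : κ < 1) (ha : a ≠ 0)
    (hp0 : 0 ≤ p) (hp : p < 1) : Integrable fun l => besselDensity κ l * |l + a| ^ (-p) := by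
  have hr : 0 < |a| / 2 := by positivity
  have hc := c₂_pos h0 h1
  have hi := (((integrable_indicator_abs_rpow hp (|a| / 2)).comp_add_right a).const_mul
    (c₂ κ * (|a| / 2) ^ (κ - 1))).add
    ((integrable_besselDensity h0).mul_const ((|a| / 2) ^ (-p)))
  refine hi.mono' ?_ (Eventually.of_forall fun l => ?_)
  · refine Measurable.aestronglyMeasurable ?_
    have := measurable_besselDensity κ
    fun_prop
  have hf := besselDensity_nonneg h0 l
  rw [Real.norm_of_nonneg (by positivity), Pi.add_apply]
  by_cases hl : l + a ∈ Set.Ioo (-(|a| / 2)) (|a| / 2)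
  · rw [Set.indicator_of_mem hl]
    have hl' : |a| / 2 ≤ |l| := by
      have h3 : |l + a| < |a| / 2 := abs_lt.2 hl
      have h4 : |a| ≤ |l + a| + |l| := by
        have := abs_sub (l + a) l
        simpa using this
      linarith
    have hl0 : l ≠ 0 := by
      rintro rfl
      simp only [abs_zero] at hl'
      linarith
    have h5 : besselDensity κ l ≤ c₂ κ * (|a| / 2) ^ (κ - 1) := by
      refine (besselDensity_le h0 h1 hl0).trans ?_
      gcongr ?_ * ?_
      exact Real.rpow_le_rpow_of_nonpos hr hl' (by linarith)
    have h6 : 0 ≤ besselDensity κ l * (|a| / 2) ^ (-p) := by positivity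
    have h7 : besselDensity κ l * |l + a| ^ (-p) ≤
        c₂ κ * (|a| / 2) ^ (κ - 1) * |l + a| ^ (-p) := by gcongr
    linarith
  · rw [Set.indicator_of_notMem hl, mul_zero, zero_add]
    have h3 : |a| / 2 ≤ |l + a| := by
      by_contra! h
      exact hl (abs_lt.1 h)
    have := Real.rpow_le_rpow_of_nonpos hr h3 (show -p ≤ 0 by linarith)
    gcongr

/-- The integral is O(h^p), so the product is O(h^(p-κ₀)): p > κ₀ makes it vanish, and p < 1 keeps
the constant finite. -/
theorem tendsto_rpow_mul_integral_besselDensity_shift {κ κ₀ p a K : ℝ} (h0 : 0 < κ) (h1 : κ < 1)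
    (ha : a ≠ 0) (hp0 : 0 ≤ p) (hp : κ₀ < p) (hp1 : p < 1) {Φ : ℝ → ℝ → ℂ}
    (hΦ : ∀ h, 0 < h → ∀ l, l ≠ 0 → ‖Φ h l‖ ≤ K * (|l| / h) ^ (-p)) :
    Tendsto (fun h : ℝ => ((h ^ (-κ₀) : ℝ) : ℂ) * ∫ l, besselDensity κ l • Φ h (l + a))
      (𝓝[>] 0) (𝓝 0) := by
  have hi := integrable_besselDensity_mul_rpow h0 h1 ha hp0 hp1
  have hlim : Tendsto (fun h : ℝ => h ^ (p - κ₀) * (K * ∫ l, besselDensity κ l * |l + a| ^ (-p)))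
      (𝓝[>] 0) (𝓝 0) := by
    have h2 : Tendsto (fun h : ℝ => h ^ (p - κ₀)) (𝓝[>] 0) (𝓝 0) := by
      have h3 := (Real.continuousAt_rpow_const 0 (p - κ₀) (Or.inr (by linarith))).tendsto
      rw [Real.zero_rpow (by linarith)] at h3
      exact h3.mono_left nhdsWithin_le_nhds
    simpa using h2.mul_const (K * ∫ l, besselDensity κ l * |l + a| ^ (-p))
  refine squeeze_zero_norm' ?_ hlim
  filter_upwards [self_mem_nhdsWithin] with h hh
  have hh : 0 < h := hh
  rw [norm_mul, Complex.norm_real, Real.norm_of_nonneg (by positivity)]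
  have h3 : ‖∫ l, besselDensity κ l • Φ h (l + a)‖ ≤
      ∫ l, K * h ^ p * (besselDensity κ l * |l + a| ^ (-p)) := by
    refine norm_integral_le_of_norm_le (hi.const_mul _) ?_
    have hne : ∀ᵐ l : ℝ, l ≠ -a := by simp [ae_iff]
    filter_upwards [hne] with l hl
    have hl' : l + a ≠ 0 := fun h' => hl (eq_neg_of_add_eq_zero_left h')
    have hf := besselDensity_nonneg h0 l
    rw [norm_smul, Real.norm_of_nonneg hf]
    refine (mul_le_mul_of_nonneg_left (hΦ h hh _ hl') hf).trans_eq ?_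
    rw [Real.div_rpow (abs_nonneg _) hh.le, Real.rpow_neg hh.le]
    field_simp
  refine (mul_le_mul_of_nonneg_left h3 (by positivity)).trans_eq ?_
  rw [integral_const_mul, sub_eq_neg_add, Real.rpow_add hh]
  ring

/-- After l = h v the weight f(hv) |hv|^(1-κ) is bounded by c₂(κ) and converges to it; dominated
convergence does the rest. -/
theorem tendsto_rpow_mul_integral_besselDensity {κ : ℝ} (h0 : 0 < κ) (h1 : κ < 1)
    {Φ : ℝ → ℝ → ℂ} {Φ₀ : ℝ → ℂ} {H : ℝ → ℝ} (hm : ∀ h, 0 < h → Measurable (Φ h))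
    (hb : ∀ h, 0 < h → ∀ v, v ≠ 0 → ‖Φ h (h * v)‖ ≤ H v)
    (hlim : ∀ v, Tendsto (fun h => Φ h (h * v)) (𝓝[>] 0) (𝓝 (Φ₀ v)))
    (hi : Integrable fun v => H v / |v| ^ (1 - κ)) :
    Tendsto (fun h : ℝ => ((h ^ (-κ) : ℝ) : ℂ) * ∫ l, besselDensity κ l • Φ h l)
      (𝓝[>] 0) (𝓝 ((c₂ κ : ℂ) * ∫ v, Φ₀ v / ((|v| ^ (1 - κ) : ℝ) : ℂ))) := by
  have hne : ∀ᵐ v : ℝ, v ≠ 0 := by simp [ae_iff]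
  have hkey : Tendsto (fun h : ℝ => ∫ v, ((besselDensity κ (h * v) * |h * v| ^ (1 - κ) : ℝ) : ℂ) *
      (Φ h (h * v) / ((|v| ^ (1 - κ) : ℝ) : ℂ))) (𝓝[>] 0)
      (𝓝 (∫ v, (c₂ κ : ℂ) * (Φ₀ v / ((|v| ^ (1 - κ) : ℝ) : ℂ)))) := by
    refine tendsto_integral_filter_of_dominated_convergence
      (fun v => c₂ κ * (H v / |v| ^ (1 - κ))) ?_ ?_ (hi.const_mul _) ?_
    · filter_upwards [self_mem_nhdsWithin] with h hh
      have := hm h hh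
      have := measurable_besselDensity κ
      exact Measurable.aestronglyMeasurable (by fun_prop)
    · filter_upwards [self_mem_nhdsWithin] with h hh
      filter_upwards [hne] with v hv
      have hh : 0 < h := hh
      have hhv : h * v ≠ 0 := mul_ne_zero hh.ne' hv
      have hv' : 0 < |v| := abs_pos.2 hv
      have hhv' : 0 < |h * v| := abs_pos.2 hhv
      have hf := besselDensity_nonneg h0 (h * v)
      rw [norm_mul, norm_div, Complex.norm_real, Complex.norm_real,
        Real.norm_of_nonneg (by positivity), Real.norm_of_nonneg (by positivity)]
      have h3 : besselDensity κ (h * v) * |h * v| ^ (1 - κ) ≤ c₂ κ := by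
        refine (mul_le_mul_of_nonneg_right (besselDensity_le h0 h1 hhv) (by positivity)).trans_eq ?_
        rw [mul_assoc, ← Real.rpow_add hhv', show κ - 1 + (1 - κ) = 0 by ring, Real.rpow_zero,
          mul_one]
      have hc := c₂_pos h0 h1
      have h4 := hb h hh v hv
      gcongr
    · filter_upwards [hne] with v hv
      refine Tendsto.mul ?_ ((hlim v).div_const _)
      refine (Complex.continuous_ofReal.tendsto _).comp ?_
      refine (tendsto_besselDensity_div h0 h1).comp (tendsto_nhdsWithin_iff.2 ⟨?_, ?_⟩)
      · have : Tendsto (fun h : ℝ => h * v) (𝓝 0) (𝓝 (0 * v)) := tendsto_id.mul_const v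
        rw [zero_mul] at this
        exact this.mono_left nhdsWithin_le_nhds
      · filter_upwards [self_mem_nhdsWithin] with h hh
        exact mul_ne_zero (ne_of_gt hh) hv
  rw [integral_const_mul] at hkey
  refine hkey.congr' ?_
  filter_upwards [self_mem_nhdsWithin] with h hh
  have hh : 0 < h := hh
  have h3 := Measure.integral_comp_mul_left (fun l => besselDensity κ l • Φ h l) h
  rw [abs_of_pos (inv_pos.2 hh), Complex.real_smul, Complex.ofReal_inv,
    eq_inv_mul_iff_mul_eq₀ (by exact_mod_cast hh.ne')] at h3
  rw [← h3, ← mul_assoc, ← Complex.ofReal_mul, ← integral_const_mul]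
  refine integral_congr_ae ?_
  filter_upwards [hne] with v hv
  have hv' : 0 < |v| := abs_pos.2 hv
  have hv2 : (0 : ℝ) < |v| ^ (1 - κ) := by positivity
  rw [abs_mul, abs_of_pos hh, Real.mul_rpow hh.le hv'.le, Complex.real_smul,
    show 1 - κ = -κ + 1 by ring, Real.rpow_add hh, Real.rpow_one, ← show 1 - κ = -κ + 1 by ring]
  have hv3 : ((|v| ^ (1 - κ) : ℝ) : ℂ) ≠ 0 := by exact_mod_cast hv2.ne'
  push_cast at hv3 ⊢
  field_simp

end Scaling

/-! ### The limit of the rescaled covariance -/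

section CovarianceLimit

/-- The transfer function `E_β(-μ |l|^α t^β)` of the limit field. -/
noncomputable def stableTransfer (α β μ t l : ℝ) : ℝ := mittagLeffler β (-μ * |l| ^ α * t ^ β)

variable {α β γ μ t t' : ℝ}

theorem stableTransfer_nonneg (hβ₀ : 0 < β) (hβ₁ : β ≤ 1) (hμ : 0 < μ) (ht : 0 < t) (l : ℝ) :
    0 ≤ stableTransfer α β μ t l := by
  rw [stableTransfer, neg_mul, neg_mul]
  exact mittagLeffler_neg_nonneg hβ₀ hβ₁ (by positivity)

theorem stableTransfer_le_one (hβ₀ : 0 < β) (hβ₁ : β ≤ 1) (hμ : 0 < μ) (ht : 0 < t) (l : ℝ) :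
    stableTransfer α β μ t l ≤ 1 := by
  rw [stableTransfer, neg_mul, neg_mul]
  exact mittagLeffler_neg_le_one hβ₀ hβ₁ (by positivity)

theorem stableTransfer_neg (l : ℝ) : stableTransfer α β μ t (-l) = stableTransfer α β μ t l := by
  rw [stableTransfer, stableTransfer, abs_neg]

theorem continuous_stableTransfer (hβ₀ : 0 < β) (hα : 0 < α) :
    Continuous (stableTransfer α β μ t) := by
  refine (continuous_mittagLeffler hβ₀).comp ?_
  have : Continuous fun l : ℝ => |l| ^ α := continuous_abs.rpow_const fun _ => Or.inr hα.le
  fun_prop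

/-- Interpolates between the bound 1, used for s ≤ 1, and the decay Γ(1+β)/s, used for s ≥ 1. The
free exponent θ is needed for the terms away from the origin. -/
theorem mittagLeffler_neg_le_rpow (hβ₀ : 0 < β) (hβ₁ : β ≤ 1) {θ s : ℝ} (hθ₀ : 0 ≤ θ) (hθ₁ : θ ≤ 1)
    (hs : 0 < s) : mittagLeffler β (-s) ≤ (1 + Real.Gamma (1 + β)) * s ^ (-θ) := by
  have hG : 0 < Real.Gamma (1 + β) := Real.Gamma_pos_of_pos (by linarith)
  rcases le_total s 1 with h | h
  · have h1 : 1 ≤ s ^ (-θ) := Real.one_le_rpow_of_pos_of_le_one_of_nonpos hs h (by linarith)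
    have h2 := mittagLeffler_neg_le_one hβ₀ hβ₁ hs.le
    nlinarith
  · have h1 : s ^ (-1 : ℝ) ≤ s ^ (-θ) := Real.rpow_le_rpow_of_exponent_le h (by linarith)
    have h2 := mittagLeffler_neg_mul_le hβ₀ hβ₁ hs.le
    rw [← le_div_iff₀ hs] at h2
    rw [Real.rpow_neg_one] at h1
    have h3 : 0 < s⁻¹ := by positivity
    rw [div_eq_mul_inv] at h2
    nlinarith

theorem stableTransfer_le_rpow (hβ₀ : 0 < β) (hβ₁ : β ≤ 1) (hμ : 0 < μ) (ht : 0 < t) {θ l : ℝ}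
    (hθ₀ : 0 ≤ θ) (hθ₁ : θ ≤ 1) (hl : l ≠ 0) :
    stableTransfer α β μ t l ≤
      (1 + Real.Gamma (1 + β)) * (μ * t ^ β) ^ (-θ) * |l| ^ (-(α * θ)) := by
  have hl' : 0 < |l| := abs_pos.2 hl
  rw [stableTransfer, neg_mul, neg_mul]
  refine (mittagLeffler_neg_le_rpow hβ₀ hβ₁ hθ₀ hθ₁ (by positivity)).trans_eq ?_
  rw [show μ * |l| ^ α * t ^ β = (μ * t ^ β) * |l| ^ α by ring,
    Real.mul_rpow (by positivity) (by positivity), ← Real.rpow_mul hl'.le]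
  ring_nf

theorem stableTransfer_mul_le_rpow (hβ₀ : 0 < β) (hβ₁ : β ≤ 1) (hμ : 0 < μ) (ht : 0 < t)
    (ht' : 0 < t') {θ : ℝ} (hθ₀ : 0 ≤ θ) (hθ₁ : θ ≤ 1) :
    ∃ K, ∀ l, l ≠ 0 →
      stableTransfer α β μ t l * stableTransfer α β μ t' l ≤ K * |l| ^ (-(2 * α * θ)) := by
  refine ⟨(1 + Real.Gamma (1 + β)) * (μ * t ^ β) ^ (-θ) *
    ((1 + Real.Gamma (1 + β)) * (μ * t' ^ β) ^ (-θ)), fun l hl => ?_⟩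
  have hG : 0 < Real.Gamma (1 + β) := Real.Gamma_pos_of_pos (by linarith)
  refine (mul_le_mul (stableTransfer_le_rpow hβ₀ hβ₁ hμ ht hθ₀ hθ₁ hl)
    (stableTransfer_le_rpow hβ₀ hβ₁ hμ ht' hθ₀ hθ₁ hl)
    (stableTransfer_nonneg hβ₀ hβ₁ hμ ht' l) (by positivity)).trans_eq ?_
  rw [show -(2 * α * θ) = -(α * θ) + -(α * θ) by ring, Real.rpow_add (abs_pos.2 hl)]
  ring

/-- Near 0 the integrand is at most v^(κ-1); at infinity it is O(v^(κ-1-2α)), integrable because α >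
κ/2. -/
theorem integrable_stableTransfer_mul (hβ₀ : 0 < β) (hβ₁ : β ≤ 1) (hμ : 0 < μ) (ht : 0 < t)
    (ht' : 0 < t') {κ : ℝ} (hκ : 0 < κ) (hα : κ / 2 < α) :
    Integrable fun v => stableTransfer α β μ t v * stableTransfer α β μ t' v / |v| ^ (1 - κ) := by
  have hα0 : 0 < α := by linarith
  have hm : Measurable fun v => stableTransfer α β μ t v * stableTransfer α β μ t' v /
      |v| ^ (1 - κ) := by
    have h1 := (continuous_stableTransfer (μ := μ) (t := t) hβ₀ hα0).measurable
    have h2 := (continuous_stableTransfer (μ := μ) (t := t') hβ₀ hα0).measurable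
    fun_prop
  have hnn : ∀ v, 0 ≤ stableTransfer α β μ t v * stableTransfer α β μ t' v := fun v =>
    mul_nonneg (stableTransfer_nonneg hβ₀ hβ₁ hμ ht v) (stableTransfer_nonneg hβ₀ hβ₁ hμ ht' v)
  refine integrable_of_even (fun v => by rw [stableTransfer_neg, stableTransfer_neg, abs_neg]) ?_
  rw [← Set.Ioc_union_Ioi_eq_Ioi zero_le_one]
  refine IntegrableOn.union ?_ ?_
  · have h1 := (intervalIntegral.intervalIntegrable_rpow' (a := 0) (b := 1)
      (show -1 < κ - 1 by linarith)).1
    refine Integrable.mono' h1 hm.aestronglyMeasurable ?_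
    filter_upwards [ae_restrict_mem measurableSet_Ioc] with v hv
    have hv0 : 0 < v := hv.1
    rw [Real.norm_of_nonneg (div_nonneg (hnn v) (by positivity)), abs_of_pos hv0, div_eq_mul_inv,
      ← Real.rpow_neg hv0.le, neg_sub]
    refine mul_le_of_le_one_left (by positivity) ?_
    exact mul_le_one₀ (stableTransfer_le_one hβ₀ hβ₁ hμ ht v)
      (stableTransfer_nonneg hβ₀ hβ₁ hμ ht' v) (stableTransfer_le_one hβ₀ hβ₁ hμ ht' v)
  · obtain ⟨K, hK⟩ := stableTransfer_mul_le_rpow (α := α) hβ₀ hβ₁ hμ ht ht' zero_le_one le_rfl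
    have h1 := (integrableOn_Ioi_rpow_of_lt (show κ - 1 - 2 * α < -1 by linarith)
      one_pos).const_mul K
    refine Integrable.mono' h1 hm.aestronglyMeasurable ?_
    filter_upwards [ae_restrict_mem measurableSet_Ioi] with v hv
    have hv0 : 0 < v := lt_trans one_pos hv
    rw [Real.norm_of_nonneg (div_nonneg (hnn v) (by positivity))]
    have h2 := hK v hv0.ne'
    rw [abs_of_pos hv0] at h2 ⊢
    rw [div_eq_mul_inv, ← Real.rpow_neg hv0.le, neg_sub]
    refine (mul_le_mul_of_nonneg_right h2 (by positivity)).trans_eq ?_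
    rw [show κ - 1 - 2 * α = -(2 * α * 1) + (κ - 1) by ring, Real.rpow_add hv0]
    ring

/-- The integrand is nonnegative, and the transfer function is 1 at the origin and continuous.
Strict positivity later determines the sign of `A 0`. -/
theorem integral_stableTransfer_sq_pos (hβ₀ : 0 < β) (hβ₁ : β ≤ 1) (hμ : 0 < μ) (ht : 0 < t)
    {κ : ℝ} (hκ : 0 < κ) (hα : κ / 2 < α) :
    0 < ∫ v, stableTransfer α β μ t v * stableTransfer α β μ t v / |v| ^ (1 - κ) := by
  have hα0 : 0 < α := by linarith
  rw [integral_pos_iff_support_of_nonneg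
    (fun v => div_nonneg (mul_self_nonneg _) (by positivity))
    (integrable_stableTransfer_mul hβ₀ hβ₁ hμ ht ht hκ hα)]
  have hc := (continuous_stableTransfer (μ := μ) (t := t) hβ₀ hα0)
  have h0 : stableTransfer α β μ t 0 = 1 := by
    rw [stableTransfer, abs_zero, Real.zero_rpow hα0.ne', mul_zero, zero_mul, mittagLeffler_zero]
  have hev : ∀ᶠ v in 𝓝 (0 : ℝ), 0 < stableTransfer α β μ t v :=
    hc.continuousAt.eventually_const_lt (by rw [h0]; exact one_pos)
  obtain ⟨δ, hδ, hball⟩ := Metric.eventually_nhds_iff.1 hev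
  refine lt_of_lt_of_le (b := volume (Set.Ioo 0 δ)) (by simp [hδ]) (measure_mono fun v hv => ?_)
  have h1 : 0 < stableTransfer α β μ t v := hball (by
    rw [Real.dist_eq, sub_zero, abs_of_pos hv.1]; exact hv.2)
  have h2 : 0 < |v| ^ (1 - κ) := Real.rpow_pos_of_pos (abs_pos.2 hv.1.ne') _
  rw [Function.mem_support]
  positivity

/-- The integrand of the covariance function of the rescaled solution, in terms of the spatial
scale `h = ε ^ (β / α)`. -/
noncomputable def rescaledKernel (α β γ μ t t' y h l : ℝ) : ℂ :=
  Complex.exp (Complex.I * (l * (y / h) : ℝ)) *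
    ((mittagLeffler β (-μ * symbol α γ l * (t ^ β / h ^ α)) *
      mittagLeffler β (-μ * symbol α γ l * (t' ^ β / h ^ α)) : ℝ) : ℂ)

theorem norm_exp_I_mul_ofReal (r : ℝ) : ‖Complex.exp (Complex.I * (r : ℝ))‖ = 1 := by
  rw [mul_comm, Complex.norm_exp_ofReal_mul_I]

theorem measurable_rescaledKernel (hβ₀ : 0 < β) (y h : ℝ) :
    Measurable (rescaledKernel α β γ μ t t' y h) := by
  have h1 := (continuous_mittagLeffler hβ₀).measurable
  have h2 := measurable_symbol α γ
  unfold rescaledKernel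
  fun_prop

theorem mittagLeffler_symbol_nonneg (hβ₀ : 0 < β) (hβ₁ : β ≤ 1) (hμ : 0 < μ) {s : ℝ} (hs : 0 ≤ s)
    (l : ℝ) : 0 ≤ mittagLeffler β (-μ * symbol α γ l * s) := by
  have := symbol_nonneg α γ l
  rw [neg_mul, neg_mul]
  exact mittagLeffler_neg_nonneg hβ₀ hβ₁ (by positivity)

/-- The Bessel factor (1 + l²)^(γ/2) is at least 1 and s ↦ E_β(-s) is decreasing, so dropping it
gives a bound free of γ. -/
theorem mittagLeffler_symbol_le_stableTransfer (hβ₀ : 0 < β) (hβ₁ : β ≤ 1) (hγ : 0 < γ)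
    (hμ : 0 < μ) (ht : 0 < t) {h : ℝ} (hh : 0 < h) (l : ℝ) :
    mittagLeffler β (-μ * symbol α γ l * (t ^ β / h ^ α)) ≤ stableTransfer α β μ t (l / h) := by
  rw [stableTransfer, neg_mul, neg_mul, neg_mul, neg_mul]
  refine mittagLeffler_neg_anti hβ₀ hβ₁ (by positivity) ?_
  rw [abs_div, abs_of_pos hh, Real.div_rpow (abs_nonneg l) hh.le, symbol]
  have h1 : 1 ≤ (1 + |l| ^ 2) ^ (γ / 2) :=
    Real.one_le_rpow (by linarith [sq_nonneg |l|]) (by positivity)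
  have h2 : 0 ≤ μ * |l| ^ α * (t ^ β / h ^ α) := by positivity
  calc μ * (|l| ^ α / h ^ α) * t ^ β = μ * |l| ^ α * (t ^ β / h ^ α) * 1 := by ring
    _ ≤ μ * |l| ^ α * (t ^ β / h ^ α) * (1 + |l| ^ 2) ^ (γ / 2) := by gcongr
    _ = _ := by ring

theorem norm_rescaledKernel_le (hβ₀ : 0 < β) (hβ₁ : β ≤ 1) (hγ : 0 < γ) (hμ : 0 < μ) (ht : 0 < t)
    (ht' : 0 < t') (y : ℝ) {h : ℝ} (hh : 0 < h) (l : ℝ) :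
    ‖rescaledKernel α β γ μ t t' y h l‖ ≤
      stableTransfer α β μ t (l / h) * stableTransfer α β μ t' (l / h) := by
  have h1 := mittagLeffler_symbol_nonneg (α := α) (γ := γ) hβ₀ hβ₁ hμ
    (show 0 ≤ t ^ β / h ^ α by positivity) l
  have h2 := mittagLeffler_symbol_nonneg (α := α) (γ := γ) hβ₀ hβ₁ hμ
    (show 0 ≤ t' ^ β / h ^ α by positivity) l
  rw [rescaledKernel, norm_mul, norm_exp_I_mul_ofReal, one_mul, Complex.norm_real,
    Real.norm_of_nonneg (mul_nonneg h1 h2)]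
  exact mul_le_mul (mittagLeffler_symbol_le_stableTransfer hβ₀ hβ₁ hγ hμ ht hh l)
    (mittagLeffler_symbol_le_stableTransfer hβ₀ hβ₁ hγ hμ ht' hh l) h2
    (stableTransfer_nonneg hβ₀ hβ₁ hμ ht _)

/-- On the scale l = h v the Riesz factor is exactly homogeneous and cancels h^α, while the Bessel
factor tends to 1. -/
theorem tendsto_mittagLeffler_symbol (hβ₀ : 0 < β) (v : ℝ) :
    Tendsto (fun h => mittagLeffler β (-μ * symbol α γ (h * v) * (t ^ β / h ^ α))) (𝓝[>] 0)
      (𝓝 (stableTransfer α β μ t v)) := by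
  refine ((continuous_mittagLeffler hβ₀).tendsto _).comp ?_
  have h1 : Tendsto (fun h : ℝ => -μ * |v| ^ α * t ^ β * (1 + |h * v| ^ 2) ^ (γ / 2)) (𝓝[>] 0)
      (𝓝 (-μ * |v| ^ α * t ^ β * (1 + |0 * v| ^ 2) ^ (γ / 2))) := by
    have hc : Continuous fun h : ℝ => -μ * |v| ^ α * t ^ β * (1 + |h * v| ^ 2) ^ (γ / 2) := by
      refine continuous_const.mul (Continuous.rpow_const (by fun_prop) fun h => Or.inl ?_)
      positivity
    exact hc.continuousAt.tendsto.mono_left nhdsWithin_le_nhds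
  rw [zero_mul, abs_zero, zero_pow two_ne_zero, add_zero, Real.one_rpow, mul_one] at h1
  refine h1.congr' ?_
  filter_upwards [self_mem_nhdsWithin] with h hh
  have hh : 0 < h := hh
  have hh' : 0 < h ^ α := by positivity
  simp only [symbol]
  rw [abs_mul, abs_of_pos hh, Real.mul_rpow hh.le (abs_nonneg v)]
  field_simp

/-- Only the singularity of the spectral density at the origin contributes to the limit. -/
theorem tendsto_integral_rescaledKernel (hβ₀ : 0 < β) (hβ₁ : β ≤ 1) (hγ : 0 < γ) (hμ : 0 < μ)
    {n : ℕ} {A w κ : Fin (n + 1) → ℝ} (hw₀ : w 0 = 0) (hw : ∀ j, j ≠ 0 → 0 < w j)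
    (hκ : ∀ j, 0 < κ j ∧ κ j < 1) (hα : κ 0 / 2 < α) {F : Measure ℝ} [IsFiniteMeasure F]
    (hF : ∀ x, charFun F x = (cyclicCov A w κ x : ℂ)) (ht : 0 < t) (ht' : 0 < t') (y : ℝ) :
    Tendsto (fun h : ℝ => ((h ^ (-κ 0) : ℝ) : ℂ) * ∫ l, rescaledKernel α β γ μ t t' y h l ∂F)
      (𝓝[>] 0) (𝓝 ((A 0 : ℂ) * ((c₂ (κ 0) : ℂ) * ∫ v : ℝ, Complex.exp (Complex.I * (v * y : ℝ)) *
        ((stableTransfer α β μ t v * stableTransfer α β μ t' v : ℝ) : ℂ) /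
          ((|v| ^ (1 - κ 0) : ℝ) : ℂ)))) := by
  have hα0 : 0 < α := by linarith [(hκ 0).1]
  have hfin : ∀ j, IsFiniteMeasure (besselMeasure (κ j) (w j)) := fun j =>
    isFiniteMeasure_besselMeasure (hκ j).1 (w j)
  have hF' : ∀ x, charFun F x = ∑ j, (A j : ℂ) * charFun (besselMeasure (κ j) (w j)) x := by
    intro x
    rw [hF, cyclicCov, Complex.ofReal_sum]
    refine Finset.sum_congr rfl fun j _ => ?_
    rw [charFun_besselMeasure (hκ j).1, Complex.ofReal_mul, mul_comm]
  have hm : ∀ h, Measurable (rescaledKernel α β γ μ t t' y h) := measurable_rescaledKernel hβ₀ y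
  have hb : ∀ h, 0 < h → ∀ l, ‖rescaledKernel α β γ μ t t' y h l‖ ≤ 1 := by
    intro h hh l
    exact (norm_rescaledKernel_le hβ₀ hβ₁ hγ hμ ht ht' y hh l).trans
      (mul_le_one₀ (stableTransfer_le_one hβ₀ hβ₁ hμ ht _)
        (stableTransfer_nonneg hβ₀ hβ₁ hμ ht' _) (stableTransfer_le_one hβ₀ hβ₁ hμ ht' _))
  have hcenter := tendsto_rpow_mul_integral_besselDensity (hκ 0).1 (hκ 0).2
    (Φ := rescaledKernel α β γ μ t t' y)
    (Φ₀ := fun v => Complex.exp (Complex.I * (v * y : ℝ)) *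
        ((stableTransfer α β μ t v * stableTransfer α β μ t' v : ℝ) : ℂ))
    (H := fun v => stableTransfer α β μ t v * stableTransfer α β μ t' v)
    (fun h _ => hm h)
    (fun h hh v _ => by
      have := norm_rescaledKernel_le (α := α) hβ₀ hβ₁ hγ hμ ht ht' y hh (h * v)
      rwa [mul_div_cancel_left₀ _ hh.ne'] at this)
    (fun v => by
      have h1 := (tendsto_mittagLeffler_symbol (α := α) (γ := γ) (μ := μ) (t := t) hβ₀ v).mul
        (tendsto_mittagLeffler_symbol (α := α) (γ := γ) (μ := μ) (t := t') hβ₀ v)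
      have h2 := ((Complex.continuous_ofReal.tendsto _).comp h1).const_mul
        (Complex.exp (Complex.I * (v * y : ℝ)))
      refine h2.congr' ?_
      filter_upwards [self_mem_nhdsWithin] with h hh
      have hh : h ≠ 0 := ne_of_gt hh
      rw [rescaledKernel, show h * v * (y / h) = v * y by field_simp]
      rfl)
    (integrable_stableTransfer_mul hβ₀ hβ₁ hμ ht ht' (hκ 0).1 hα)
  -- Room for p is what κ₀ < 1 and κ₀ < 2α provide; θ = p/(2α) ≤ 1 then gives the product of the two
  -- transfer functions decay of order p.
  obtain ⟨p, hp1, hp2⟩ := exists_between (show κ 0 < min 1 (2 * α) from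
    lt_min (hκ 0).2 (by linarith))
  have hp0 : 0 < p := (hκ 0).1.trans hp1
  obtain ⟨K, hK⟩ := stableTransfer_mul_le_rpow (α := α) (θ := p / (2 * α)) hβ₀ hβ₁ hμ ht ht'
    (by positivity) (by rw [div_le_one (by positivity)]; exact (hp2.trans_le (min_le_right _ _)).le)
  have hshift : ∀ j, ∀ a : ℝ, a ≠ 0 → Tendsto (fun h : ℝ => ((h ^ (-κ 0) : ℝ) : ℂ) *
      ∫ l, besselDensity (κ j) l • rescaledKernel α β γ μ t t' y h (l + a)) (𝓝[>] 0) (𝓝 0) := by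
    intro j a ha
    refine tendsto_rpow_mul_integral_besselDensity_shift (K := K) (hκ j).1 (hκ j).2 ha hp0.le hp1
      (hp2.trans_le (min_le_left _ _)) fun h hh l hl => ?_
    refine (norm_rescaledKernel_le hβ₀ hβ₁ hγ hμ ht ht' y hh l).trans ?_
    have := hK (l / h) (div_ne_zero hl hh.ne')
    rwa [abs_div, abs_of_pos hh, mul_div_cancel₀ _ (by positivity : 2 * α ≠ 0)] at this
  -- For j = 0 both translates in `besselMeasure` coincide as w₀ = 0; for j ≠ 0 both are genuine
  -- shifts and vanish in the limit, however κ_j compares with κ₀.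
  have hterm : ∀ j, Tendsto (fun h : ℝ => ((h ^ (-κ 0) : ℝ) : ℂ) *
      ∫ l, rescaledKernel α β γ μ t t' y h l ∂(besselMeasure (κ j) (w j))) (𝓝[>] 0)
      (𝓝 (if j = 0 then ((c₂ (κ 0) : ℂ) * ∫ v : ℝ, Complex.exp (Complex.I * (v * y : ℝ)) *
        ((stableTransfer α β μ t v * stableTransfer α β μ t' v : ℝ) : ℂ) /
          ((|v| ^ (1 - κ 0) : ℝ) : ℂ)) else 0)) := by
    intro j
    split_ifs with hj
    · subst hj
      refine hcenter.congr' ?_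
      filter_upwards [self_mem_nhdsWithin] with h hh
      rw [integral_besselMeasure (hκ 0).1 _ (hm h) (hb h hh), hw₀]
      simp only [neg_zero, add_zero]
      ring
    · have hwj := (hw j hj).ne'
      have h1 := ((hshift j (w j) hwj).add (hshift j (-w j) (neg_ne_zero.2 hwj))).const_mul
        (2⁻¹ : ℂ)
      rw [add_zero, mul_zero] at h1
      refine h1.congr' ?_
      filter_upwards [self_mem_nhdsWithin] with h hh
      rw [integral_besselMeasure (hκ j).1 _ (hm h) (hb h hh)]
      ring
  have hsum := tendsto_finsetSum Finset.univ fun j _ => (hterm j).const_mul (A j : ℂ)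
  have e : (∑ j, (A j : ℂ) * (if j = 0 then ((c₂ (κ 0) : ℂ) *
      ∫ v : ℝ, Complex.exp (Complex.I * (v * y : ℝ)) *
        ((stableTransfer α β μ t v * stableTransfer α β μ t' v : ℝ) : ℂ) /
          ((|v| ^ (1 - κ 0) : ℝ) : ℂ)) else 0)) = (A 0 : ℂ) * ((c₂ (κ 0) : ℂ) *
      ∫ v : ℝ, Complex.exp (Complex.I * (v * y : ℝ)) *
        ((stableTransfer α β μ t v * stableTransfer α β μ t' v : ℝ) : ℂ) /
          ((|v| ^ (1 - κ 0) : ℝ) : ℂ)) := by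
    simp [mul_ite]
  rw [e] at hsum
  refine hsum.congr' ?_
  filter_upwards [self_mem_nhdsWithin] with h hh
  rw [integral_eq_sum_of_charFun_eq_sum hF' (hm h) (hb h hh), Finset.mul_sum]
  refine Finset.sum_congr rfl fun j _ => ?_
  ring

theorem integral_cos_mul_stableTransfer (κ y : ℝ) :
    ∫ v : ℝ, Real.cos (v * y) / |v| ^ (1 - κ) * stableTransfer α β μ t v * stableTransfer α β μ t' v =
      2 * ∫ v in Set.Ioi (0 : ℝ), Real.cos (v * y) / |v| ^ (1 - κ) * stableTransfer α β μ t v *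
        stableTransfer α β μ t' v := by
  rw [← integral_comp_abs (f := fun v => Real.cos (v * y) / |v| ^ (1 - κ) *
    stableTransfer α β μ t v * stableTransfer α β μ t' v)]
  congr 1
  ext v
  have h2 : ∀ s, stableTransfer α β μ s |v| = stableTransfer α β μ s v := fun s => by
    rw [stableTransfer, stableTransfer, abs_abs]
  have h3 : Real.cos (|v| * y) = Real.cos (v * y) := by
    rcases abs_cases v with ⟨h, -⟩ | ⟨h, -⟩ <;> simp [h]
  rw [h2, h2, h3, abs_abs]

theorem integrable_cos_mul_stableTransfer (hβ₀ : 0 < β) (hβ₁ : β ≤ 1) (hμ : 0 < μ) (ht : 0 < t)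
    (ht' : 0 < t') {κ : ℝ} (hκ : 0 < κ) (hα : κ / 2 < α) (y : ℝ) :
    Integrable fun v : ℝ => Real.cos (v * y) / |v| ^ (1 - κ) * stableTransfer α β μ t v *
      stableTransfer α β μ t' v := by
  have h := (integrable_stableTransfer_mul hβ₀ hβ₁ hμ ht ht' hκ hα).bdd_mul (c := 1)
    (f := fun v : ℝ => Real.cos (v * y)) (Continuous.aestronglyMeasurable (by fun_prop))
    (Eventually.of_forall fun v => Real.abs_cos_le_one _)
  refine h.congr (Eventually.of_forall fun v => ?_)
  ring

theorem re_integral_exp_mul_stableTransfer (hβ₀ : 0 < β) (hβ₁ : β ≤ 1) (hμ : 0 < μ) (ht : 0 < t)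
    (ht' : 0 < t') {κ : ℝ} (hκ : 0 < κ) (hα : κ / 2 < α) (y : ℝ) :
    (∫ v : ℝ, Complex.exp (Complex.I * (v * y : ℝ)) *
      ((stableTransfer α β μ t v * stableTransfer α β μ t' v : ℝ) : ℂ) /
        ((|v| ^ (1 - κ) : ℝ) : ℂ)).re =
      2 * ∫ v in Set.Ioi (0 : ℝ), Real.cos (v * y) / |v| ^ (1 - κ) * stableTransfer α β μ t v *
        stableTransfer α β μ t' v := by
  have hi := integrable_stableTransfer_mul hβ₀ hβ₁ hμ ht ht' hκ hα
  have hi' : Integrable fun v : ℝ => Complex.exp (Complex.I * (v * y : ℝ)) *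
      ((stableTransfer α β μ t v * stableTransfer α β μ t' v : ℝ) : ℂ) /
        ((|v| ^ (1 - κ) : ℝ) : ℂ) := by
    have h1 := hi.ofReal (𝕜 := ℂ)
    have h2 := h1.bdd_mul (c := 1) (f := fun v : ℝ => Complex.exp (Complex.I * (v * y : ℝ)))
      (Continuous.aestronglyMeasurable (by fun_prop))
      (Eventually.of_forall fun v => (norm_exp_I_mul_ofReal _).le)
    refine h2.congr (Eventually.of_forall fun v => ?_)
    simp only
    rw [mul_div_assoc (Complex.exp _), ← Complex.ofReal_div]
    rfl
  have h1 := (Complex.reCLM.integral_comp_comm hi').symm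
  rw [Complex.reCLM_apply] at h1
  rw [h1, ← integral_cos_mul_stableTransfer]
  congr 1
  ext v
  have h4 : (Complex.exp (Complex.I * (v * y : ℝ))).re = Real.cos (v * y) := by
    rw [mul_comm, Complex.exp_ofReal_mul_I_re]
  rw [Complex.reCLM_apply, Complex.div_ofReal_re, Complex.re_mul_ofReal, h4]
  ring

end CovarianceLimit

/-! ### Covariances of the rescaled solution and of the limit field -/

section LimitField

variable {Ω : Type*} [MeasurableSpace Ω] {P : Measure Ω}

theorem IsStochIntegral.integral_real_eq_zero [IsProbabilityMeasure P] {ν : Measure ℝ} {Z : Set ℝ → Ω → ℂ}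
    (hZ : IsOrthogonalRandomMeasure P ν Z) {g : ℝ → ℂ} {X : Ω → ℝ}
    (h : IsStochIntegral P ν Z g fun ω => (X ω : ℂ)) : ∫ ω, X ω ∂P = 0 := by
  have h1 := h.integral_eq_zero hZ
  rw [integral_complex_ofReal] at h1
  exact_mod_cast h1

theorem IsStochIntegral.covariance_eq [IsProbabilityMeasure P] {ν : Measure ℝ} {Z : Set ℝ → Ω → ℂ}
    (hZ : IsOrthogonalRandomMeasure P ν Z) {g g' : ℝ → ℂ} {X X' : Ω → ℝ}
    (h : IsStochIntegral P ν Z g fun ω => (X ω : ℂ))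
    (h' : IsStochIntegral P ν Z g' fun ω => (X' ω : ℂ)) :
    (cov[X, X'; P] : ℂ) = ∫ l, g l * (starRingEnd ℂ) (g' l) ∂ν := by
  rw [covariance_eq_sub h.memLp_real h'.memLp_real, h.integral_real_eq_zero hZ, zero_mul, sub_zero,
    ← h.integral_mul_conj hZ h', ← integral_complex_ofReal]
  simp

/-- The isometry applied to ξ(x) and ξ(0) identifies the control measure with the spectral measure
of the given covariance function. -/
theorem charFun_eq_of_hasSpectralRep [IsProbabilityMeasure P] {F : Measure ℝ} {Z : Set ℝ → Ω → ℂ}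
    (hZ : IsOrthogonalRandomMeasure P F Z) {ξ : ℝ → Ω → ℝ}
    (hrep : HasSpectralRep P F Z (fun _ => 1) ξ) (x : ℝ) :
    charFun F x = (cov[ξ x, ξ 0; P] : ℂ) := by
  rw [(hrep x).covariance_eq hZ (hrep 0), charFun_apply_real]
  congr 1
  ext l
  simp only [mul_zero, Complex.ofReal_zero, Complex.exp_zero, mul_one, map_one]
  push_cast
  ring_nf

theorem cyclicCov_neg {n : ℕ} (A w κ : Fin (n + 1) → ℝ) (x : ℝ) :
    cyclicCov A w κ (-x) = cyclicCov A w κ x := by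
  simp [cyclicCov]

theorem hasGaussianLaw_of_isGaussianProcess_fin {k : ℕ} {X : Fin k → Ω → ℝ}
    (h : IsGaussianProcess X P) : HasGaussianLaw (fun ω j => X j ω) P :=
  (h.hasGaussianLaw Finset.univ).map_fun (ContinuousLinearMap.pi fun j =>
    ContinuousLinearMap.proj (R := ℝ) (φ := fun _ : (Finset.univ : Finset (Fin k)) => ℝ)
      ⟨j, Finset.mem_univ j⟩)

theorem conj_exp_I_mul_ofReal (r : ℝ) :
    (starRingEnd ℂ) (Complex.exp (Complex.I * (r : ℝ))) = Complex.exp (Complex.I * (-r : ℝ)) := by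
  rw [← Complex.exp_conj]
  simp

/-- The covariance function of the rescaled solution. -/
theorem covariance_rescaled_eq [IsProbabilityMeasure P] {α β γ μ κ₀ : ℝ} (hα : 0 < α)
    {F : Measure ℝ} {Z : Set ℝ → Ω → ℂ} (hZ : IsOrthogonalRandomMeasure P F Z)
    {u : ℝ → ℝ → Ω → ℝ} (hu : ∀ t, 0 < t → HasSpectralRep P F Z
      (fun l => (mittagLeffler β (-μ * symbol α γ l * t ^ β) : ℂ)) (u t))
    {ε t t' : ℝ} (hε : 0 < ε) (ht : 0 < t) (ht' : 0 < t') (x x' : ℝ) :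
    (cov[rescaled α β κ₀ u ε t x, rescaled α β κ₀ u ε t' x'; P] : ℂ) =
      (((ε ^ (β / α)) ^ (-κ₀) : ℝ) : ℂ) *
        ∫ l, rescaledKernel α β γ μ t t' (x - x') (ε ^ (β / α)) l ∂F := by
  have hh : 0 < ε ^ (β / α) := by positivity
  have hhα : (ε ^ (β / α)) ^ α = ε ^ β := by
    rw [← Real.rpow_mul hε.le, div_mul_cancel₀ _ hα.ne']
  have h1 := (hu (t / ε) (by positivity) (x / ε ^ (β / α))).covariance_eq hZ
    (hu (t' / ε) (by positivity) (x' / ε ^ (β / α)))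
  -- The squared normalisation ε^(-κ₀β/α) is h^(-κ₀) for h = ε^(β/α); likewise `hhα` turns (t/ε)^β
  -- into t^β / h^α.
  have h2 : cov[rescaled α β κ₀ u ε t x, rescaled α β κ₀ u ε t' x'; P] =
      (ε ^ (β / α)) ^ (-κ₀) *
        cov[u (t / ε) (x / ε ^ (β / α)), u (t' / ε) (x' / ε ^ (β / α)); P] := by
    unfold rescaled
    rw [covariance_const_mul_left, covariance_const_mul_right, ← mul_assoc, ← Real.rpow_add hε,
      ← Real.rpow_mul hε.le]
    congr 2
    field_simp
    ring
  rw [h2, Complex.ofReal_mul, h1]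
  congr 2
  ext l
  rw [rescaledKernel, hhα, ← Real.div_rpow ht.le hε.le, ← Real.div_rpow ht'.le hε.le, map_mul,
    conj_exp_I_mul_ofReal, Complex.conj_ofReal, mul_mul_mul_comm, ← Complex.exp_add, ← mul_add,
    ← Complex.ofReal_add, Complex.ofReal_mul (mittagLeffler _ _)]
  congr 4
  ring

theorem tendsto_rpow_comap_val {θ : ℝ} (hθ : 0 < θ) :
    Tendsto (fun ε : Set.Ioi (0 : ℝ) => (ε : ℝ) ^ θ) (comap Subtype.val (𝓝 0)) (𝓝[>] 0) := by
  refine tendsto_nhdsWithin_iff.2 ⟨?_, Eventually.of_forall fun ε => Real.rpow_pos_of_pos ε.2 _⟩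
  have h := (Real.continuousAt_rpow_const 0 θ (Or.inr hθ.le)).tendsto
  rw [Real.zero_rpow hθ.ne'] at h
  exact h.comp tendsto_comap

/-- This filter on (0, ∞) expresses ε → 0+; nontriviality lets inequalities pass to the limit. -/
theorem neBot_comap_val_nhds_zero : (comap (Subtype.val : Set.Ioi (0 : ℝ) → ℝ) (𝓝 0)).NeBot :=
  mem_closure_iff_comap_neBot.1 (by simp)

/-- The covariance function of the rescaled solution converges to the one of the limit field. -/
theorem tendsto_covariance_rescaled [IsProbabilityMeasure P] {α β γ μ : ℝ} (hβ₀ : 0 < β) (hβ₁ : β ≤ 1) (hγ : 0 < γ)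
    (hμ : 0 < μ) {n : ℕ} {A w κ : Fin (n + 1) → ℝ} (hw₀ : w 0 = 0) (hw : ∀ j, j ≠ 0 → 0 < w j)
    (hκ : ∀ j, 0 < κ j ∧ κ j < 1) (hα : κ 0 / 2 < α) {F : Measure ℝ} [IsFiniteMeasure F]
    (hF : ∀ x, charFun F x = (cyclicCov A w κ x : ℂ)) {Z : Set ℝ → Ω → ℂ}
    (hZ : IsOrthogonalRandomMeasure P F Z)
    {u : ℝ → ℝ → Ω → ℝ} (hu : ∀ t, 0 < t → HasSpectralRep P F Z
      (fun l => (mittagLeffler β (-μ * symbol α γ l * t ^ β) : ℂ)) (u t))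
    {t t' : ℝ} (ht : 0 < t) (ht' : 0 < t') (x x' : ℝ) :
    Tendsto (fun ε : Set.Ioi (0 : ℝ) =>
      cov[rescaled α β (κ 0) u ε t x, rescaled α β (κ 0) u ε t' x'; P]) (comap Subtype.val (𝓝 0))
      (𝓝 (2 * A 0 * c₂ (κ 0) * ∫ v in Set.Ioi (0 : ℝ), Real.cos (v * (x - x')) / |v| ^ (1 - κ 0) *
        stableTransfer α β μ t v * stableTransfer α β μ t' v)) := by
  have hα0 : 0 < α := by linarith [(hκ 0).1]
  have h1 := (tendsto_integral_rescaledKernel hβ₀ hβ₁ hγ hμ hw₀ hw hκ hα hF ht ht' (x - x')).comp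
    (tendsto_rpow_comap_val (div_pos hβ₀ hα0))
  have h2 := (Complex.continuous_re.tendsto _).comp h1
  rw [Complex.re_ofReal_mul, Complex.re_ofReal_mul,
    re_integral_exp_mul_stableTransfer hβ₀ hβ₁ hμ ht ht' (hκ 0).1 hα] at h2
  convert! h2 using 1
  · ext ε
    simp only [Function.comp_apply]
    rw [← covariance_rescaled_eq hα0 hZ hu ε.2 ht ht' x x', Complex.ofReal_re]
  · congr 1
    ring

/-- The integrand of the stochastic integral that defines the limit field. -/
noncomputable def limitIntegrand (α β μ κ C t x l : ℝ) : ℂ :=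
  (√C : ℂ) * (Complex.exp (Complex.I * (l * x : ℝ)) * (stableTransfer α β μ t l : ℂ) /
    ((|l| ^ ((1 - κ) / 2) : ℝ) : ℂ))

variable {α β μ κ C : ℝ}

theorem limitIntegrand_neg (t x l : ℝ) :
    limitIntegrand α β μ κ C t x (-l) = (starRingEnd ℂ) (limitIntegrand α β μ κ C t x l) := by
  unfold limitIntegrand
  rw [map_mul, map_div₀, map_mul, conj_exp_I_mul_ofReal]
  simp only [Complex.conj_ofReal, stableTransfer_neg, abs_neg, neg_mul]

theorem limitIntegrand_mul_conj (hC : 0 ≤ C) (hκ : κ < 1) (t t' x x' l : ℝ) :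
    limitIntegrand α β μ κ C t x l * (starRingEnd ℂ) (limitIntegrand α β μ κ C t' x' l) =
      (C : ℂ) * (Complex.exp (Complex.I * (l * (x - x') : ℝ)) *
        ((stableTransfer α β μ t l * stableTransfer α β μ t' l : ℝ) : ℂ) /
          ((|l| ^ (1 - κ) : ℝ) : ℂ)) := by
  have h1 : |l| ^ (1 - κ) = |l| ^ ((1 - κ) / 2) * |l| ^ ((1 - κ) / 2) := by
    rw [← Real.rpow_add_of_nonneg (abs_nonneg l) (by linarith) (by linarith)]
    ring_nf
  have h2 : (C : ℂ) = (√C : ℂ) * (√C : ℂ) := by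
    rw [← Complex.ofReal_mul, Real.mul_self_sqrt hC]
  unfold limitIntegrand
  rw [map_mul, map_div₀, map_mul, conj_exp_I_mul_ofReal, h1, h2,
    show l * (x - x') = l * x + -(l * x') by ring, Complex.ofReal_add, mul_add, Complex.exp_add]
  simp only [Complex.conj_ofReal, Complex.ofReal_mul]
  rw [mul_mul_mul_comm, div_mul_div_comm, mul_mul_mul_comm]

theorem memLp_limitIntegrand (hβ₀ : 0 < β) (hβ₁ : β ≤ 1) (hμ : 0 < μ) (hκ₀ : 0 < κ) (hκ₁ : κ < 1)
    (hα : κ / 2 < α) (hC : 0 ≤ C) {t : ℝ} (ht : 0 < t) (x : ℝ) :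
    MemLp (limitIntegrand α β μ κ C t x) 2 volume := by
  have hα0 : 0 < α := by linarith
  have hm : Measurable (limitIntegrand α β μ κ C t x) := by
    have h1 := (continuous_stableTransfer (μ := μ) (t := t) hβ₀ hα0).measurable
    unfold limitIntegrand
    fun_prop
  rw [memLp_two_iff_integrable_sq_norm hm.aestronglyMeasurable]
  refine ((integrable_stableTransfer_mul hβ₀ hβ₁ hμ ht ht hκ₀ hα).const_mul C).congr
    (Eventually.of_forall fun l => ?_)
  have h1 := limitIntegrand_mul_conj (α := α) (β := β) (μ := μ) hC hκ₁ t t x x l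
  rw [Complex.mul_conj, Complex.normSq_eq_norm_sq, sub_self, mul_zero, Complex.ofReal_zero,
    mul_zero, Complex.exp_zero, one_mul] at h1
  simp only
  exact_mod_cast h1.symm

theorem exists_isStochIntegral_limitIntegrand {W : Set ℝ → Ω → ℂ} (hW : IsGaussianWhiteNoise P W)
    (hβ₀ : 0 < β) (hβ₁ : β ≤ 1) (hμ : 0 < μ) (hκ₀ : 0 < κ) (hκ₁ : κ < 1)
    (hα : κ / 2 < α) (hC : 0 ≤ C) {t : ℝ} (ht : 0 < t) (x : ℝ) :
    ∃ X : Ω → ℝ, IsStochIntegral P volume W (limitIntegrand α β μ κ C t x)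
      fun ω => (X ω : ℂ) := by
  obtain ⟨X, hX⟩ := exists_isStochIntegral hW.toIsOrthogonalRandomMeasure
    (memLp_limitIntegrand hβ₀ hβ₁ hμ hκ₀ hκ₁ hα hC ht x)
  refine ⟨fun ω => (X ω).re, hX.congr ?_⟩
  filter_upwards [hW.conj_ae_eq (limitIntegrand_neg t x) hX] with ω hω
  exact (Complex.conj_eq_iff_re.1 hω).symm

theorem covariance_limitField_eq [IsProbabilityMeasure P] {W : Set ℝ → Ω → ℂ} (hW : IsGaussianWhiteNoise P W)
    (hβ₀ : 0 < β) (hβ₁ : β ≤ 1) (hμ : 0 < μ) (hκ₀ : 0 < κ) (hκ₁ : κ < 1)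
    (hα : κ / 2 < α) (hC : 0 ≤ C) {t t' : ℝ} (ht : 0 < t) (ht' : 0 < t') {x x' : ℝ} {X X' : Ω → ℝ}
    (hX : IsStochIntegral P volume W (limitIntegrand α β μ κ C t x) fun ω => (X ω : ℂ))
    (hX' : IsStochIntegral P volume W (limitIntegrand α β μ κ C t' x') fun ω => (X' ω : ℂ)) :
    cov[X, X'; P] = 2 * C * ∫ v in Set.Ioi (0 : ℝ), Real.cos (v * (x - x')) / |v| ^ (1 - κ) *
        stableTransfer α β μ t v * stableTransfer α β μ t' v := by
  have h1 := congrArg Complex.re (hX.covariance_eq hW.toIsOrthogonalRandomMeasure hX')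
  simp_rw [limitIntegrand_mul_conj hC hκ₁] at h1
  rw [Complex.ofReal_re, integral_const_mul, Complex.re_ofReal_mul,
    re_integral_exp_mul_stableTransfer hβ₀ hβ₁ hμ ht ht' hκ₀ hα] at h1
  rw [h1]
  ring

end LimitField

end RieszBessel

/-! ### The main theorem -/

theorem mainTheorem2
    {Ω : Type*} [MeasurableSpace Ω] (P : Measure Ω) [IsProbabilityMeasure P]
    {Ω' : Type*} [MeasurableSpace Ω'] (P' : Measure Ω') [IsProbabilityMeasure P']
    (α β γ μ : ℝ) (hβ₀ : 0 < β) (hβ₁ : β ≤ 1) (hγ : 0 < γ) (hμ : 0 < μ)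
    -- the parameters of the covariance function
    (n : ℕ) (A w κ : Fin (n + 1) → ℝ) (hA : ∑ j, A j = 1)
    (hw₀ : w 0 = 0) (hw : ∀ j, j ≠ 0 → 0 < w j) (hκ : ∀ j, 0 < κ j ∧ κ j < 1)
    (hA₀ : A 0 ≠ 0) (hα : κ 0 / 2 < α)
    -- the initial condition: a measurable zero-mean stationary Gaussian field
    (ξ : ℝ → Ω → ℝ) (hξ_meas : Measurable (fun p : ℝ × Ω => ξ p.1 p.2))
    (hξ_gauss : IsGaussianProcess ξ P) (hξ_mean : ∀ x, ∫ ω, ξ x ω ∂P = 0)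
    (hξ_cov : ∀ x y, cov[ξ x, ξ y; P] = RieszBessel.cyclicCov A w κ (y - x))
    -- the solution of the initial value problem
    (u : ℝ → ℝ → Ω → ℝ) (hu : RieszBessel.IsMeanSquareSolution P α β γ μ ξ u)
    -- the white noise that defines the limit field
    (W : Set ℝ → Ω' → ℂ) (hW : RieszBessel.IsGaussianWhiteNoise P' W) :
    ∃ U₀ : ℝ → ℝ → Ω' → ℝ,
      -- the limit field is the stochastic integral
      (∀ t x, 0 < t →
        RieszBessel.IsStochIntegral P' volume W
          (fun l : ℝ => (√(RieszBessel.c₂ (κ 0) * A 0) : ℂ) *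
            (Complex.exp (Complex.I * (l * x : ℝ)) *
              (RieszBessel.mittagLeffler β (-μ * |l| ^ α * t ^ β) : ℂ) /
              ((|l| ^ ((1 - κ 0) / 2) : ℝ) : ℂ)))
          (fun ω => (U₀ t x ω : ℂ))) ∧
      -- it is a zero-mean Gaussian field
      IsGaussianProcess (fun p : Set.Ioi (0 : ℝ) × ℝ => U₀ p.1 p.2) P' ∧
      (∀ t x, 0 < t → ∫ ω, U₀ t x ω ∂P' = 0) ∧
      -- with the stated covariance function
      (∀ t x t' x', 0 < t → 0 < t' →
        IntegrableOn (fun l : ℝ => Real.cos (l * (x - x')) / |l| ^ (1 - κ 0) *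
            RieszBessel.mittagLeffler β (-μ * |l| ^ α * t ^ β) *
            RieszBessel.mittagLeffler β (-μ * |l| ^ α * t' ^ β)) (Set.Ioi 0) ∧
        cov[U₀ t x, U₀ t' x'; P'] = 2 * A 0 * RieszBessel.c₂ (κ 0) *
          ∫ l in Set.Ioi (0 : ℝ), Real.cos (l * (x - x')) / |l| ^ (1 - κ 0) *
            RieszBessel.mittagLeffler β (-μ * |l| ^ α * t ^ β) *
            RieszBessel.mittagLeffler β (-μ * |l| ^ α * t' ^ β)) ∧
      -- and the finite-dimensional distributions converge weakly as `ε → 0+`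
      ∀ (k : ℕ) (t x : Fin k → ℝ), (∀ i, 0 < t i) →
        TendstoInDistribution
          (fun (ε : Set.Ioi (0 : ℝ)) (ω : Ω) (i : Fin k) =>
            RieszBessel.rescaled α β (κ 0) u ε (t i) (x i) ω)
          (comap Subtype.val (𝓝 0))
          (fun (ω : Ω') (i : Fin k) => U₀ (t i) (x i) ω)
          (fun _ => P) P' := by
  have hκ₀ := (hκ 0).1
  have hκ₁ := (hκ 0).2
  have hc := RieszBessel.c₂_pos hκ₀ hκ₁
  have hne := RieszBessel.neBot_comap_val_nhds_zero
  obtain ⟨F, Z, hF, hZ, hrep, hut⟩ := hu.exists_hasSpectralRep hβ₀ hβ₁ hμ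
  have hchar : ∀ x, charFun F x = (RieszBessel.cyclicCov A w κ x : ℂ) := fun x => by
    rw [RieszBessel.charFun_eq_of_hasSpectralRep hZ hrep, hξ_cov, zero_sub,
      RieszBessel.cyclicCov_neg]
  have hlim : ∀ {t t' : ℝ}, 0 < t → 0 < t' → ∀ x x', _ := fun {t t'} ht ht' x x' =>
    RieszBessel.tendsto_covariance_rescaled hβ₀ hβ₁ hγ hμ hw₀ hw hκ hα hchar hZ hut ht ht' x x'
  -- `A 0` is nonnegative because the limit of the variances at t = 1, x = 0 is `A 0` times a
  -- positive number. Without this the real square root in the integrand would be the default value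
  -- 0.
  have hC : 0 ≤ RieszBessel.c₂ (κ 0) * A 0 := by
    have h1 : 0 ≤ 2 * A 0 * RieszBessel.c₂ (κ 0) * ∫ v in Set.Ioi (0 : ℝ),
        Real.cos (v * (0 - 0)) / |v| ^ (1 - κ 0) * RieszBessel.stableTransfer α β μ 1 v *
          RieszBessel.stableTransfer α β μ 1 v := by
      refine ge_of_tendsto (hlim one_pos one_pos 0 0) (Eventually.of_forall fun ε => ?_)
      have hm : AEMeasurable (RieszBessel.rescaled α β (κ 0) u ε 1 0) P :=
        ((hut _ (div_pos one_pos ε.2) _).memLp_real.aestronglyMeasurable.aemeasurable).const_mul _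
      rw [covariance_self hm]
      exact variance_nonneg _ _
    have h2 := RieszBessel.integral_stableTransfer_sq_pos (μ := μ) hβ₀ hβ₁ hμ one_pos hκ₀ hα
    have h3 := RieszBessel.integral_cos_mul_stableTransfer (α := α) (β := β) (μ := μ) (t := 1)
      (t' := 1) (κ 0) (0 - 0)
    have h4 : ∫ v : ℝ, Real.cos (v * (0 - 0)) / |v| ^ (1 - κ 0) *
        RieszBessel.stableTransfer α β μ 1 v * RieszBessel.stableTransfer α β μ 1 v =
        ∫ v, RieszBessel.stableTransfer α β μ 1 v * RieszBessel.stableTransfer α β μ 1 v /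
          |v| ^ (1 - κ 0) := by
      congr 1
      ext v
      rw [sub_zero, mul_zero, Real.cos_zero]
      ring
    rw [h4] at h3
    rw [h3] at h2
    by_contra! h
    nlinarith
  -- The integrand is Hermitian, so its integral against W is almost surely real and a real-valued
  -- version can be chosen.
  choose! U₀ hU₀ using fun (t : ℝ) (x : ℝ) (ht : 0 < t) =>
    RieszBessel.exists_isStochIntegral_limitIntegrand hW hβ₀ hβ₁ hμ hκ₀ hκ₁ hα hC ht x
  have hWo := hW.toIsOrthogonalRandomMeasure
  have hmean : ∀ t x, 0 < t → ∫ ω, U₀ t x ω ∂P' = 0 := fun t x ht =>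
    (hU₀ t x ht).integral_real_eq_zero hWo
  have hcov : ∀ t x t' x', 0 < t → 0 < t' →
      cov[U₀ t x, U₀ t' x'; P'] = 2 * A 0 * RieszBessel.c₂ (κ 0) *
        ∫ v in Set.Ioi (0 : ℝ), Real.cos (v * (x - x')) / |v| ^ (1 - κ 0) *
          RieszBessel.stableTransfer α β μ t v * RieszBessel.stableTransfer α β μ t' v := by
    intro t x t' x' ht ht'
    rw [RieszBessel.covariance_limitField_eq hW hβ₀ hβ₁ hμ hκ₀ hκ₁ hα hC ht ht' (hU₀ t x ht)
      (hU₀ t' x' ht')]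
    ring
  have hgauss : IsGaussianProcess (fun p : Set.Ioi (0 : ℝ) × ℝ => U₀ p.1 p.2) P' :=
    hW.isGaussianProcess fun p => hU₀ p.1 p.2 p.1.2
  refine ⟨U₀, hU₀, hgauss, hmean, fun t x t' x' ht ht' => ⟨?_, hcov t x t' x' ht ht'⟩,
    fun k t x ht => ?_⟩
  · exact (RieszBessel.integrable_cos_mul_stableTransfer hβ₀ hβ₁ hμ ht ht' hκ₀ hα
      (x - x')).integrableOn
  -- Both sides are centred Gaussian vectors, so only the covariance limit remains.
  · refine RieszBessel.tendstoInDistribution_of_tendsto_covariance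
      (X := fun (ε : Set.Ioi (0 : ℝ)) i => RieszBessel.rescaled α β (κ 0) u ε (t i) (x i))
      (U := fun i => U₀ (t i) (x i)) (fun ε => ?_) ?_ (fun ε i => ?_) (fun i => hmean _ _ (ht i))
      fun a b => ?_
    · have h1 : IsGaussianProcess (fun i => u (t i / ε) (x i / (ε : ℝ) ^ (β / α))) P :=
        RieszBessel.isGaussianProcess_of_hasSpectralRep hZ hξ_gauss hrep fun i =>
          hut _ (div_pos (ht i) ε.2) _
      exact RieszBessel.hasGaussianLaw_of_isGaussianProcess_fin
        (h1.smul fun _ => (ε : ℝ) ^ (-(κ 0 * β / (2 * α))))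
    · exact RieszBessel.hasGaussianLaw_of_isGaussianProcess_fin
        (hgauss.comp_right fun i => (⟨t i, ht i⟩, x i))
    · simp only [RieszBessel.rescaled]
      rw [integral_const_mul, (hut _ (div_pos (ht i) ε.2) _).integral_real_eq_zero hZ, mul_zero]
    · rw [hcov _ _ _ _ (ht a) (ht b)]
      exact hlim (ht a) (ht b) (x a) (x b)
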